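/- All graphs are finite and loopless; parallel edges are allowed. For a graph $G$ and a matching $M$ of $G$ (a set of edges no two of which share an end-vertex), let $V(M)$ be the set of end-vertices of the edges of $M$. The matching $M$ is *semistrong* if every edge of $M$ has an end-vertex of degree one in the subgraph induced by $V(M)$ in the underlying simple graph of $G$ (the graph in which any two vertices adjacent in $G$ are joined by exactly one edge). A *semistrong edge-coloring* of $G$ is a proper edge-coloring in which every color class is a semistrong matching, and the *semistrong chromatic index* $\chi'_{ss}(G)$ is the least integer $k$ such that $G$ admits a semistrong edge-coloring with at most $k$ colors. **Theorem 2.** Every connected graph $G$ of maximum degree at most $3$ that is not isomorphic to $K_{3,3}$ satisfies $$\chi'_{ss}(G)\le 8.$$ The bound is tight: the $5$-prism $C_5\,\square\,K_2$ is a connected simple graph of maximum degree $3$, is not isomorphic to $K_{3,3}$, and has $\chi'_{ss}(C_5\,\square\,K_2)=8$. -/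

import Mathlib

/-!
Multigraphs are Mathlib's `Graph α β` (vertex set `V(G) : Set α`, edge set `E(G) : Set β`,
parallel edges allowed, no loops when `G.Loopless`). The underlying simple graph, in which
adjacent vertices are joined by exactly one edge, is `G.toSimpleGraph`.
-/

namespace SemistrongColoring

open scoped Graph

/-- The degree of `x`: the number of edges incident with `x`, loops being counted twice. -/
noncomputable def degree {α β : Type*} (G : Graph α β) (x : α) : ℕ∞ :=
  {e | G.Inc e x}.encard + {e | G.IsLoopAt e x}.encard

/-- The maximum degree `Δ(G)`. -/
noncomputable def maxDegree {α β : Type*} (G : Graph α β) : ℕ∞ :=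
  ⨆ x ∈ V(G), degree G x

/-- `V(M)`: the set of end-vertices of the edges of `M`. -/
def endSet {α β : Type*} (G : Graph α β) (M : Set β) : Set α :=
  {x | ∃ e ∈ M, G.Inc e x}

/-- `M` is a matching of `G`: a set of edges of which no two have a common end-vertex. -/
def IsMatching {α β : Type*} (G : Graph α β) (M : Set β) : Prop :=
  M ⊆ E(G) ∧ ∀ e ∈ M, ∀ f ∈ M, e ≠ f → ∀ x, ¬ (G.Inc e x ∧ G.Inc f x)

/-- For `x ∈ X`, the degree of `x` in the subgraph that `X` induces in the underlying simple
graph of `G`. -/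
noncomputable def inducedDegree {α β : Type*} (G : Graph α β) (X : Set α) (x : α) : ℕ∞ :=
  {y | y ∈ X ∧ x ≠ y ∧ G.Adj x y}.encard

/-- A matching `M` is semistrong if each of its edges has an end-vertex of degree one in the
subgraph induced by `V(M)` (in the underlying simple graph, so that parallel edges are
harmless). -/
def IsSemistrongMatching {α β : Type*} (G : Graph α β) (M : Set β) : Prop :=
  IsMatching G M ∧ ∀ e ∈ M, ∃ x, G.Inc e x ∧ inducedDegree G (endSet G M) x = 1

/-- The set of edges that have color `i`. -/
def colorClass {α β C : Type*} (G : Graph α β) (c : E(G) → C) (i : C) : Set β :=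
  {e | ∃ h : e ∈ E(G), c ⟨e, h⟩ = i}

/-- A semistrong edge-coloring: every color class is a semistrong matching. (That the coloring is
proper is the statement that every color class is a matching.) -/
def IsSemistrongColoring {α β C : Type*} (G : Graph α β) (c : E(G) → C) : Prop :=
  ∀ i, IsSemistrongMatching G (colorClass G c i)

/-- The semistrong chromatic index: the least `k` such that `G` has a semistrong edge-coloring
with at most `k` colors (`⊤` if there is no such `k`). -/
noncomputable def semistrongChromaticIndex {α β : Type*} (G : Graph α β) : ℕ∞ :=
  ⨅ (k : ℕ) (_ : ∃ c : E(G) → Fin k, IsSemistrongColoring G c), (k : ℕ∞)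

/-- `G` is (isomorphic to) the complete bipartite graph `K_{3,3}`. -/
def IsK33 {α β : Type*} (G : Graph α β) : Prop :=
  G.Simple ∧ Nonempty (G.toSimpleGraph ≃g completeBipartiteGraph (Fin 3) (Fin 3))

/-- The 5-prism `C₅ □ K₂`. -/
def fivePrism : Graph (Fin 5 × Fin 2) (Sym2 (Fin 5 × Fin 2)) :=
  Graph.ofSimpleGraph ((SimpleGraph.cycleGraph 5).boxProd (⊤ : SimpleGraph (Fin 2)))

end SemistrongColoring

/-!
Give every edge a designated end. If each color class is a matching and no neighbor of a designated
end, apart from the other end of its edge, meets an edge of the same color, then designated ends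
have degree one and the coloring is semistrong. In a graph of maximum degree three, an edge `uv`
that is designated at `v` and joins a new vertex `u` to a colored part has at most six forbidden
colors at the two other neighbors of `v`, and one more for each edge designated at another neighbor
of `u`; so seven colors are forbidden at most if little is designated near `u`.

A vertex set all of whose components have a vertex of degree at most two is colored by induction,
removing such a vertex, with at most one edge designated at every vertex of degree two. In a
connected cubic graph this colors the complement of any nonempty set `X`. The edges from `X` to its
complement come next, designated at their ends outside `X`, and the edges inside `X` come last,
greedily or by Hall's theorem. This works for a suitable `X` around a triangle or around two
vertices with the same neighbors. If there are none of either, the complement of a shortest cycle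
is colored with nothing designated at some neighbor of the cycle, and the coloring is extended
vertex by vertex along the cycle, which closes up at that neighbor.

A multigraph is colored by starting with one edge from each parallel class and adding the remaining
edges one by one: each of them has at most seven edges with which it may not share a color.

In the 5-prism, a semistrong matching has at most two of the fifteen edges.
-/

namespace SemistrongColoring

/-- A partial edge coloring in which every colored edge has a designated end: `K u v a` means that
the edge `uv` has color `a` and that its designated end is `v`. In a semistrong coloring the
designated end is the one of degree one. -/
abbrev ArcColoring (V C : Type*) := V → V → C → Prop

namespace ArcColoring

section Basic

variable {V C : Type*} {G : SimpleGraph V} {K : ArcColoring V C} {u v w : V} {a b : C}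

/-- The edge `uv` has color `a`, with either end designated. -/
def HasColor (K : ArcColoring V C) (u v : V) (a : C) : Prop := K u v a ∨ K v u a

lemma HasColor.symm (h : K.HasColor u v a) : K.HasColor v u a := Or.symm h

/-- A partial edge coloring with designated ends is valid if it is proper and no neighbor of the
designated end of an edge, other than its second end, meets an edge of the same color. -/
structure IsValid (K : ArcColoring V C) (G : SimpleGraph V) : Prop where
  adj : ∀ {u v a}, K u v a → G.Adj u v
  color_unique : ∀ {u v a b}, K.HasColor u v a → K.HasColor u v b → a = b
  proper : ∀ {u v w a}, K.HasColor u v a → K.HasColor u w a → v = w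
  head : ∀ {u v w x a}, K u v a → G.Adj v w → w ≠ u → ¬ K.HasColor w x a

lemma IsValid.adj_of_hasColor (hK : K.IsValid G) (h : K.HasColor u v a) : G.Adj u v :=
  h.elim hK.adj fun h' => (hK.adj h').symm

lemma IsValid.card_le_of_hasColor (hK : K.IsValid G) {F : Finset C} (X : Finset V)
    (hX : ∀ a ∈ F, ∃ x ∈ X, K.HasColor w x a) : F.card ≤ X.card :=
  Finset.card_le_card_of_forall_subsingleton (fun a x => K.HasColor w x a) hX
    fun _ _ _ ha _ hb => hK.color_unique ha.2 hb.2

variable [Fintype C]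

open scoped Classical in
/-- The colors of the edges at `w`. -/
noncomputable def colorsAt (K : ArcColoring V C) (w : V) : Finset C :=
  {a | ∃ x, K.HasColor w x a}

open scoped Classical in
/-- The colors of the edges whose designated end is `w`. -/
noncomputable def headColors (K : ArcColoring V C) (w : V) : Finset C :=
  {a | ∃ x, K x w a}

lemma mem_colorsAt : a ∈ K.colorsAt w ↔ ∃ x, K.HasColor w x a := by simp [colorsAt]

lemma mem_headColors : a ∈ K.headColors w ↔ ∃ x, K x w a := by simp [headColors]

lemma headColors_subset_colorsAt (K : ArcColoring V C) (w : V) :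
    K.headColors w ⊆ K.colorsAt w := fun _ ha =>
  let ⟨x, hx⟩ := mem_headColors.1 ha
  mem_colorsAt.2 ⟨x, Or.inr hx⟩

lemma IsValid.card_colorsAt_le (hK : K.IsValid G) (X : Finset V)
    (hX : ∀ x a, K.HasColor w x a → x ∈ X) : (K.colorsAt w).card ≤ X.card :=
  hK.card_le_of_hasColor X fun a ha => (mem_colorsAt.1 ha).imp fun x hx => ⟨hX x a hx, hx⟩

lemma IsValid.card_headColors_le (hK : K.IsValid G) (X : Finset V)
    (hX : ∀ x a, K x w a → x ∈ X) : (K.headColors w).card ≤ X.card :=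
  hK.card_le_of_hasColor X fun a ha =>
    (mem_headColors.1 ha).imp fun x hx => ⟨hX x a hx, Or.inr hx⟩

lemma IsValid.card_colorsAt_le_degree [G.LocallyFinite] (hK : K.IsValid G) (w : V) :
    (K.colorsAt w).card ≤ G.degree w :=
  hK.card_colorsAt_le _ fun _ _ hx => (G.mem_neighborFinset _ _).2 (hK.adj_of_hasColor hx)

lemma IsValid.card_colorsAt_le_three [G.LocallyFinite] (hG : ∀ v, G.degree v ≤ 3)
    (hK : K.IsValid G) (w : V) : (K.colorsAt w).card ≤ 3 :=
  (hK.card_colorsAt_le_degree w).trans (hG w)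

lemma colorsAt_eq_empty (h : ∀ x a, ¬ K.HasColor w x a) : K.colorsAt w = ∅ := by
  ext a
  simp [mem_colorsAt, h]

lemma headColors_eq_empty (h : ∀ x a, ¬ K x w a) : K.headColors w = ∅ := by
  ext a
  simp [mem_headColors, h]

end Basic

section AddArcs

variable {V C ι : Type*} {G : SimpleGraph V} {K : ArcColoring V C} {e : ι → V × V} {f : ι → C}
  {u v : V} {a : C}

/-- The coloring `K` together with the arcs `e i`, the `i`-th one colored `f i`. -/
def addArcs (K : ArcColoring V C) (e : ι → V × V) (f : ι → C) : ArcColoring V C :=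
  fun u v a => K u v a ∨ ∃ i, e i = (u, v) ∧ f i = a

/-- `K'` is a valid coloring that arises from `K` by coloring the arcs `e i`. -/
structure IsExtension (K : ArcColoring V C) (G : SimpleGraph V) (e : ι → V × V)
    (K' : ArcColoring V C) : Prop extends K'.IsValid G where
  le : ∀ {u v a}, K u v a → K' u v a
  arc : ∀ {u v a}, K' u v a → K u v a ∨ ∃ i, e i = (u, v)
  colored : ∀ i, ∃ a, K' (e i).1 (e i).2 a

/-- The arcs `e i` join adjacent vertices, their edges are distinct and not colored by `K`. -/
structure IsFresh (K : ArcColoring V C) (G : SimpleGraph V) (e : ι → V × V) : Prop where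
  adj : ∀ i, G.Adj (e i).1 (e i).2
  uncolored : ∀ i a, ¬ K.HasColor (e i).1 (e i).2 a
  edge_injective : Function.Injective fun i => s((e i).1, (e i).2)

lemma hasColor_addArcs : (K.addArcs e f).HasColor u v a ↔
    K.HasColor u v a ∨ ∃ i, s((e i).1, (e i).2) = s(u, v) ∧ f i = a := by
  simp only [HasColor, addArcs, Sym2.eq_iff, Prod.ext_iff, or_and_right, exists_or]
  rw [or_or_or_comm]

lemma IsFresh.uncolored_of_eq (he : K.IsFresh G e) {i : ι} (hi : s((e i).1, (e i).2) = s(u, v))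
    (a : C) : ¬ K.HasColor u v a := by
  obtain ⟨rfl, rfl⟩ | ⟨rfl, rfl⟩ := Sym2.eq_iff.1 hi
  exacts [he.uncolored i a, fun h => he.uncolored i a h.symm]

end AddArcs

section Extension

variable {V C ι : Type*} [Fintype C] {G : SimpleGraph V} {K : ArcColoring V C} {e : ι → V × V}
  {f : ι → C} {u v w : V} {a : C}

open scoped Classical in
/-- The colors that an edge `uv` with designated end `v` cannot take once the edges of `K` are
colored: those at `u`, those at the other neighbors of `v`, and those designated at the other
neighbors of `u`. -/
noncomputable def forbidden (K : ArcColoring V C) (G : SimpleGraph V) (u v : V) : Finset C :=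
  {a | a ∈ K.colorsAt u ∨ (∃ w, w ≠ u ∧ G.Adj v w ∧ a ∈ K.colorsAt w) ∨
    ∃ w, w ≠ v ∧ G.Adj u w ∧ a ∈ K.headColors w}

lemma mem_forbidden : a ∈ K.forbidden G u v ↔ a ∈ K.colorsAt u ∨
    (∃ w, w ≠ u ∧ G.Adj v w ∧ a ∈ K.colorsAt w) ∨
      ∃ w, w ≠ v ∧ G.Adj u w ∧ a ∈ K.headColors w := by
  simp [forbidden]

lemma forbidden_subset {F : Finset C} (hu : K.colorsAt u ⊆ F)
    (hv : ∀ w, w ≠ u → G.Adj v w → K.colorsAt w ⊆ F)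
    (hh : ∀ w, w ≠ v → G.Adj u w → K.headColors w ⊆ F) : K.forbidden G u v ⊆ F := by
  intro a ha
  obtain ha | ⟨w, hw, hvw, ha⟩ | ⟨w, hw, huw, ha⟩ := mem_forbidden.1 ha
  exacts [hu ha, hv w hw hvw ha, hh w hw huw ha]

lemma not_hasColor_of_notMem_forbidden (ha : a ∉ K.forbidden G u v) (x : V) :
    ¬ K.HasColor u x a := fun h =>
  ha <| mem_forbidden.2 <| Or.inl <| mem_colorsAt.2 ⟨x, h⟩

lemma not_hasColor_of_adj_head (ha : a ∉ K.forbidden G u v) (hvw : G.Adj v w) (hw : w ≠ u)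
    (x : V) : ¬ K.HasColor w x a := fun h =>
  ha <| mem_forbidden.2 <| Or.inr <| Or.inl ⟨w, hw, hvw, mem_colorsAt.2 ⟨x, h⟩⟩

lemma IsValid.not_hasColor_head (hK : K.IsValid G) (hnew : ∀ b, ¬ K.HasColor u v b)
    (ha : a ∉ K.forbidden G u v) (x : V) : ¬ K.HasColor v x a := fun h =>
  not_hasColor_of_adj_head ha (hK.adj_of_hasColor h) (by rintro rfl; exact hnew a h.symm) v h.symm

lemma IsFresh.not_hasColor_of_mem_edge (he : K.IsFresh G e) (hK : K.IsValid G)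
    (hf : ∀ i, f i ∉ K.forbidden G (e i).1 (e i).2) {i : ι} (h : s((e i).1, (e i).2) = s(u, v))
    (x : V) : ¬ K.HasColor u x (f i) := by
  obtain ⟨hu, -⟩ | ⟨-, hu⟩ := Sym2.eq_iff.1 h
  exacts [hu ▸ not_hasColor_of_notMem_forbidden (hf i) x,
    hu ▸ hK.not_hasColor_head (he.uncolored i) (hf i) x]

lemma IsFresh.not_hasColor_addArcs_of_adj_head (he : K.IsFresh G e) (hK : K.IsValid G)
    (hf : ∀ i, f i ∉ K.forbidden G (e i).1 (e i).2) (huv : K u v a) (hvw : G.Adj v w)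
    (hw : w ≠ u) {i : ι} {x : V} (hi : s((e i).1, (e i).2) = s(w, x)) : f i ≠ a := by
  rintro rfl
  obtain ⟨rfl, rfl⟩ | ⟨rfl, rfl⟩ := Sym2.eq_iff.1 hi
  · refine hf i <| mem_forbidden.2 <| Or.inr <| Or.inr ⟨v, ?_, hvw.symm, mem_headColors.2 ⟨u, huv⟩⟩
    rintro rfl
    exact he.not_hasColor_of_mem_edge hK hf Sym2.eq_swap u (Or.inr huv)
  · refine not_hasColor_of_adj_head (hf i) hvw.symm ?_ u (Or.inr huv)
    rintro rfl
    exact he.not_hasColor_of_mem_edge hK hf rfl u (Or.inr huv)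

/-- Forbidden colors of all new arcs are computed with respect to `K` only: arcs of distinct colors
do not interact. -/
theorem IsFresh.isExtension_addArcs (he : K.IsFresh G e) (hK : K.IsValid G)
    (hinj : Function.Injective f) (hf : ∀ i, f i ∉ K.forbidden G (e i).1 (e i).2) :
    K.IsExtension G e (K.addArcs e f) where
  adj := by
    rintro u v a (h | ⟨i, hi, -⟩)
    exacts [hK.adj h, by simpa [hi] using he.adj i]
  color_unique := by
    intro u v a b ha hb
    rw [hasColor_addArcs] at ha hb
    obtain ha | ⟨i, hi, rfl⟩ := ha <;> obtain hb | ⟨j, hj, rfl⟩ := hb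
    · exact hK.color_unique ha hb
    · exact absurd ha (he.uncolored_of_eq hj a)
    · exact absurd hb (he.uncolored_of_eq hi b)
    · exact congrArg f (he.edge_injective (hi.trans hj.symm))
  proper := by
    intro u v w a ha hb
    rw [hasColor_addArcs] at ha hb
    obtain ha | ⟨i, hi, rfl⟩ := ha <;> obtain hb | ⟨j, hj, hji⟩ := hb
    · exact hK.proper ha hb
    · exact absurd (hji ▸ ha) (he.not_hasColor_of_mem_edge hK hf hj v)
    · exact absurd hb (he.not_hasColor_of_mem_edge hK hf hi w)
    · obtain rfl := hinj hji
      exact Sym2.congr_right.1 (hi.symm.trans hj)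
  head := by
    rintro u v w x a (h | ⟨i, hi, rfl⟩) hvw hw hc
    · obtain hc | ⟨j, hj, hja⟩ := hasColor_addArcs.1 hc
      exacts [hK.head h hvw hw hc, he.not_hasColor_addArcs_of_adj_head hK hf h hvw hw hj hja]
    · obtain hc | ⟨j, hj, hji⟩ := hasColor_addArcs.1 hc
      · exact not_hasColor_of_adj_head (hf i) (by simpa [hi]) (by simpa [hi]) x hc
      · obtain rfl := hinj hji
        have := hvw.ne
        simp_all
  le := Or.inl
  arc := by
    rintro u v a (h | ⟨i, hi, -⟩)
    exacts [Or.inl h, Or.inr ⟨i, hi⟩]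
  colored i := ⟨f i, Or.inr ⟨i, rfl, rfl⟩⟩

theorem IsFresh.exists_addArcs_of_hall [DecidableEq C] (he : K.IsFresh G e)
    (hK : K.IsValid G) {F : ι → Finset C} (hF : ∀ i, K.forbidden G (e i).1 (e i).2 ⊆ F i)
    (h : ∀ s : Finset ι, s.card ≤ (s.biUnion fun i => (F i)ᶜ).card) :
    ∃ f, f.Injective ∧ (∀ i, f i ∉ F i) ∧ K.IsExtension G e (K.addArcs e f) := by
  obtain ⟨f, hinj, hf⟩ := (Finset.all_card_le_biUnion_card_iff_exists_injective _).1 h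
  have hfF : ∀ i, f i ∉ F i := fun i => Finset.mem_compl.1 (hf i)
  exact ⟨f, hinj, hfF, he.isExtension_addArcs hK hinj fun i hi => hfF i (hF i hi)⟩

theorem IsFresh.exists_addArcs_of_card_inter_le [DecidableEq C] [Fintype ι] (he : K.IsFresh G e)
    (hK : K.IsValid G) {F : ι → Finset C} (hF : ∀ i, K.forbidden G (e i).1 (e i).2 ⊆ F i)
    (hcard : ∀ i, (F i).card + Fintype.card ι ≤ Fintype.card C + 1) {i j : ι}
    (hij : (F i ∩ F j).card + Fintype.card ι ≤ Fintype.card C) :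
    ∃ f, f.Injective ∧ (∀ i, f i ∉ F i) ∧ K.IsExtension G e (K.addArcs e f) := by
  classical
  refine he.exists_addArcs_of_hall hK hF fun s => ?_
  obtain rfl | hs := eq_or_ne s Finset.univ
  · have hsub : (F i ∩ F j)ᶜ ⊆ Finset.univ.biUnion fun i => (F i)ᶜ := by
      rw [Finset.compl_inter]
      exact Finset.union_subset (Finset.subset_biUnion_of_mem (fun i => (F i)ᶜ) (Finset.mem_univ i))
        (Finset.subset_biUnion_of_mem (fun i => (F i)ᶜ) (Finset.mem_univ j))
    have := Finset.card_le_card hsub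
    rw [Finset.card_compl] at this
    rw [Finset.card_univ]
    omega
  obtain rfl | ⟨k, hk⟩ := s.eq_empty_or_nonempty
  · simp
  have hs' := Finset.card_lt_card (Finset.ssubset_univ_iff.2 hs)
  rw [Finset.card_univ] at hs'
  have := Finset.card_le_card (Finset.subset_biUnion_of_mem (fun i => (F i)ᶜ) hk)
  rw [Finset.card_compl] at this
  have := hcard k
  omega

theorem IsFresh.exists_addArcs {n : ℕ} {e : Fin n → V × V} (he : K.IsFresh G e)
    (hK : K.IsValid G) {F : Fin n → Finset C} (hF : ∀ i, K.forbidden G (e i).1 (e i).2 ⊆ F i)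
    (h : ∀ i, (F i).card + i < Fintype.card C) :
    ∃ f, f.Injective ∧ (∀ i, f i ∉ F i) ∧ K.IsExtension G e (K.addArcs e f) := by
  classical
  refine he.exists_addArcs_of_hall hK hF fun s => ?_
  obtain rfl | hs := s.eq_empty_or_nonempty
  · simp
  calc s.card ≤ (Finset.Iic (s.max' hs)).card :=
        Finset.card_le_card fun i hi => Finset.mem_Iic.2 (s.le_max' i hi)
    _ = s.max' hs + 1 := Fin.card_Iic _
    _ ≤ (F (s.max' hs))ᶜ.card := by
        have := h (s.max' hs)
        rw [Finset.card_compl]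
        omega
    _ ≤ _ := Finset.card_le_card
        (Finset.subset_biUnion_of_mem (fun i => (F i)ᶜ) (s.max'_mem hs))

lemma card_forbidden_le [G.LocallyFinite] (hG : ∀ v, G.degree v ≤ 3) (huv : G.Adj u v) {k : ℕ}
    (hk : ∀ w, G.Adj v w → (K.colorsAt w).card ≤ k) {H : Finset C}
    (hH : ∀ w, w ≠ v → G.Adj u w → K.headColors w ⊆ H) :
    (K.forbidden G u v).card ≤ (K.colorsAt u).card + 2 * k + H.card := by
  classical
  have hN : (((G.neighborFinset v).erase u).biUnion K.colorsAt).card ≤ 2 * k := by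
    refine (Finset.card_biUnion_le_card_mul _ _ k fun w hw => hk w <| by simp_all).trans
      (Nat.mul_le_mul_right k ?_)
    rw [Finset.card_erase_of_mem (by simpa using huv.symm), G.card_neighborFinset_eq_degree]
    exact Nat.sub_le_sub_right (hG v) 1
  calc (K.forbidden G u v).card
      ≤ (K.colorsAt u ∪ ((G.neighborFinset v).erase u).biUnion K.colorsAt ∪ H).card := by
        refine Finset.card_le_card (forbidden_subset ?_ (fun w hw hvw a ha => ?_) ?_)
        · exact Finset.subset_union_left.trans Finset.subset_union_left
        · refine Finset.mem_union_left _ (Finset.mem_union_right _ ?_)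
          exact Finset.mem_biUnion.2 ⟨w, by simpa using ⟨hw, hvw⟩, ha⟩
        · exact fun w hw huw => (hH w hw huw).trans Finset.subset_union_right
    _ ≤ _ := (Finset.card_union_le _ _).trans <| Nat.add_le_add_right
        ((Finset.card_union_le _ _).trans <| Nat.add_le_add_left hN _) _

end Extension

end ArcColoring

section Connectivity

variable {V : Type*} {G : SimpleGraph V} {S T U : Finset V} {r w x z z' : V}

variable (G) in
open scoped Classical in
/-- The number of neighbors of `w` in `S`; for `w ∈ S`, the degree of `w` in the subgraph induced
by `S`. -/
noncomputable def degreeOn (S : Finset V) (w : V) : ℕ := (S.filter (G.Adj w)).card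

variable (G) in
/-- `T` is closed in `S`: it contains all neighbors in `S` of its elements. Together with `T ⊆ S`
this says that `T` is a union of components of the subgraph induced by `S`. -/
def IsClosedIn (S T : Finset V) : Prop := ∀ a ∈ T, ∀ b ∈ S, G.Adj a b → b ∈ T

variable (G) in
/-- The set `S` induces a connected subgraph, expressed through closed subsets. -/
def IsConnectedOn (S : Finset V) : Prop :=
  S.Nonempty ∧ ∀ T ⊆ S, T.Nonempty → IsClosedIn G S T → T = S

lemma degreeOn_mono (h : S ⊆ T) (w : V) : degreeOn G S w ≤ degreeOn G T w := by
  classical exact Finset.card_le_card (Finset.filter_subset_filter _ h)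

lemma degreeOn_le_card {X : Finset V} (h : ∀ x ∈ S, G.Adj w x → x ∈ X) :
    degreeOn G S w ≤ X.card := by
  classical
  refine Finset.card_le_card fun x hx => ?_
  rw [Finset.mem_filter] at hx
  exact h x hx.1 hx.2

lemma degreeOn_le_degree [G.LocallyFinite] (S : Finset V) (w : V) : degreeOn G S w ≤ G.degree w :=
  degreeOn_le_card fun _ _ h => (G.mem_neighborFinset _ _).2 h

lemma degreeOn_lt_degree_iff [G.LocallyFinite] :
    degreeOn G S w < G.degree w ↔ ∃ x ∉ S, G.Adj w x := by
  classical
  have hsub : S.filter (G.Adj w) ⊆ G.neighborFinset w := fun x hx => by simp_all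
  rw [degreeOn, ← G.card_neighborFinset_eq_degree]
  refine ⟨fun h => ?_, fun ⟨x, hx, hwx⟩ => Finset.card_lt_card
    ((Finset.ssubset_iff_of_subset hsub).2 ⟨x, by simpa using hwx, by simp [hx]⟩)⟩
  obtain ⟨x, hx, hxS⟩ := Finset.exists_mem_notMem_of_card_lt_card h
  rw [SimpleGraph.mem_neighborFinset] at hx
  exact ⟨x, fun h => hxS (by simp [h, hx]), hx⟩

lemma degreeOn_insert_of_adj [DecidableEq V] (hr : r ∉ S) (h : G.Adj w r) :
    degreeOn G (insert r S) w = degreeOn G S w + 1 := by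
  classical
  rw [degreeOn, Finset.filter_insert, if_pos h, Finset.card_insert_of_notMem (by simp [hr]),
    degreeOn]

lemma degreeOn_insert_of_not_adj [DecidableEq V] (h : ¬ G.Adj w r) :
    degreeOn G (insert r S) w = degreeOn G S w := by
  classical
  rw [degreeOn, Finset.filter_insert, if_neg h, degreeOn]

lemma degreeOn_erase_of_adj [DecidableEq V] (hr : r ∈ S) (h : G.Adj w r) :
    degreeOn G (S.erase r) w + 1 = degreeOn G S w := by
  rw [← degreeOn_insert_of_adj (S.notMem_erase r) h, Finset.insert_erase hr]

lemma degreeOn_erase_of_not_adj [DecidableEq V] (h : ¬ G.Adj w r) :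
    degreeOn G (S.erase r) w = degreeOn G S w := by
  classical
  rw [degreeOn, degreeOn, Finset.filter_erase, Finset.erase_eq_of_notMem (by simp [h])]

lemma degreeOn_congr (hTS : T ⊆ S) (hT : IsClosedIn G S T) (hw : w ∈ T) :
    degreeOn G T w = degreeOn G S w := by
  classical
  refine (degreeOn_mono hTS w).antisymm <| Finset.card_le_card fun x hx => ?_
  rw [Finset.mem_filter] at hx ⊢
  exact ⟨hT w hw x hx.1 hx.2, hx.2⟩

lemma not_adj_of_degreeOn_eq_zero (h : degreeOn G S r = 0) (hx : x ∈ S) : ¬ G.Adj r x := by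
  classical exact Finset.filter_eq_empty_iff.1 (Finset.card_eq_zero.1 h) hx

lemma exists_of_degreeOn_eq_one (h : degreeOn G S r = 1) :
    ∃ z ∈ S, ∀ x ∈ S, G.Adj r x ↔ x = z := by
  classical
  obtain ⟨z, hz⟩ := Finset.card_eq_one.1 h
  have key (x : V) : x ∈ S ∧ G.Adj r x ↔ x = z := by
    rw [← Finset.mem_singleton, ← hz, Finset.mem_filter]
  exact ⟨z, ((key z).2 rfl).1, fun x hx => by rw [← key x, and_iff_right hx]⟩

lemma exists_of_degreeOn_eq_two (h : degreeOn G S r = 2) :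
    ∃ z ∈ S, ∃ z' ∈ S, z ≠ z' ∧ ∀ x ∈ S, G.Adj r x ↔ x = z ∨ x = z' := by
  classical
  obtain ⟨z, z', hne, hz⟩ := Finset.card_eq_two.1 h
  have key (x : V) : x ∈ S ∧ G.Adj r x ↔ x = z ∨ x = z' := by
    have : x ∈ S.filter (G.Adj r) ↔ x ∈ ({z, z'} : Finset V) := by rw [← hz]
    simpa using this
  exact ⟨z, ((key z).2 (Or.inl rfl)).1, z', ((key z').2 (Or.inr rfl)).1, hne,
    fun x hx => by rw [← key x, and_iff_right hx]⟩

lemma IsClosedIn.sdiff [DecidableEq V] (hT : IsClosedIn G S T) : IsClosedIn G S (S \ T) := by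
  intro a ha b hb hab
  rw [Finset.mem_sdiff] at ha ⊢
  exact ⟨hb, fun hbT => ha.2 (hT b hbT a ha.1 hab.symm)⟩

lemma IsClosedIn.trans (hT : IsClosedIn G S T) (hU : IsClosedIn G T U) (hUT : U ⊆ T) :
    IsClosedIn G S U := fun a ha b hb hab => hU a ha b (hT a (hUT ha) b hb hab) hab

lemma exists_component (S : Finset V) (hr : r ∈ S) :
    ∃ T ⊆ S, r ∈ T ∧ IsClosedIn G S T ∧ IsConnectedOn G T := by
  classical
  let T := S.filter fun w => ∀ U ⊆ S, IsClosedIn G S U → r ∈ U → w ∈ U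
  have hT (w : V) : w ∈ T ↔ w ∈ S ∧ ∀ U ⊆ S, IsClosedIn G S U → r ∈ U → w ∈ U :=
    Finset.mem_filter
  have hTS : T ⊆ S := Finset.filter_subset _ _
  have hrT : r ∈ T := (hT r).2 ⟨hr, fun U _ _ h => h⟩
  have hcl : IsClosedIn G S T := fun a ha b hb hab =>
    (hT b).2 ⟨hb, fun U hU hc hrU => hc a (((hT a).1 ha).2 U hU hc hrU) b hb hab⟩
  refine ⟨T, hTS, hrT, hcl, ⟨r, hrT⟩, fun U hUT hne hU => ?_⟩
  have hUS := hcl.trans hU hUT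
  by_cases hrU : r ∈ U
  · exact hUT.antisymm fun w hw => ((hT w).1 hw).2 U (hUT.trans hTS) hUS hrU
  · obtain ⟨x, hx⟩ := hne
    have := ((hT x).1 (hUT hx)).2 (S \ U) Finset.sdiff_subset hUS.sdiff (by simp [hr, hrU])
    exact absurd hx (Finset.mem_sdiff.1 this).2

lemma IsClosedIn.of_erase [DecidableEq V] (hT : IsClosedIn G (S.erase r) T)
    (h : ∀ a ∈ T, ¬ G.Adj a r) : IsClosedIn G S T := fun a ha b hb hab =>
  hT a ha b (Finset.mem_erase.2 ⟨by rintro rfl; exact h a ha hab, hb⟩) hab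

lemma IsConnectedOn.exists_adj_of_subset_erase [DecidableEq V] (hS : IsConnectedOn G S)
    (hr : r ∈ S) (hT : T ⊆ S.erase r) (hne : T.Nonempty) (hcl : IsClosedIn G (S.erase r) T) :
    ∃ a ∈ T, G.Adj a r := by
  by_contra! h
  have := hS.2 T (hT.trans (Finset.erase_subset _ _)) hne (hcl.of_erase h)
  exact S.notMem_erase r (hT (this ▸ hr))

lemma IsConnectedOn.erase_of_degreeOn_eq_one [DecidableEq V] (hS : IsConnectedOn G S)
    (hr : r ∈ S) (hz : z ∈ S) (hN : ∀ x ∈ S, G.Adj r x ↔ x = z) :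
    IsConnectedOn G (S.erase r) := by
  have hrz : G.Adj r z := (hN z hz).2 rfl
  have hzT {T : Finset V} (hT : T ⊆ S.erase r) (hne : T.Nonempty)
      (hcl : IsClosedIn G (S.erase r) T) : z ∈ T := by
    obtain ⟨a, ha, har⟩ := hS.exists_adj_of_subset_erase hr hT hne hcl
    exact (hN a (Finset.mem_of_mem_erase (hT ha))).1 har.symm ▸ ha
  refine ⟨⟨z, by simp [hz, hrz.ne']⟩, fun T hT hne hcl => hT.antisymm ?_⟩
  by_contra hST
  have := hzT Finset.sdiff_subset (Finset.sdiff_nonempty.2 hST) hcl.sdiff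
  exact (Finset.mem_sdiff.1 this).2 (hzT hT hne hcl)

/-- Take for `A` the component of `z`: since `S` is connected, every nonempty closed set that
avoids `z` contains `z'`, so the remaining vertices induce a connected subgraph as well. -/
lemma IsConnectedOn.exists_split [DecidableEq V] (hS : IsConnectedOn G S) (hr : r ∈ S)
    (hz : z ∈ S) (hN : ∀ x ∈ S, G.Adj r x ↔ x = z ∨ x = z')
    (hd : ¬ IsConnectedOn G (S.erase r)) :
    ∃ A B, A ∪ B = S.erase r ∧ Disjoint A B ∧ z ∈ A ∧ z' ∈ B ∧ IsConnectedOn G A ∧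
      IsConnectedOn G B ∧ IsClosedIn G (S.erase r) A ∧ IsClosedIn G (S.erase r) B := by
  have hzr : z ∈ S.erase r := by simp [hz, ((hN z hz).2 (Or.inl rfl)).ne']
  obtain ⟨A, hAS, hzA, hAcl, hA⟩ := exists_component (G := G) _ hzr
  have hB : (S.erase r \ A).Nonempty := Finset.sdiff_nonempty.2 fun h => hd (hAS.antisymm h ▸ hA)
  have hz' {U : Finset V} (hU : U ⊆ S.erase r \ A) (hne : U.Nonempty)
      (hcl : IsClosedIn G (S.erase r) U) : z' ∈ U := by
    obtain ⟨a, ha, har⟩ :=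
      hS.exists_adj_of_subset_erase hr (hU.trans Finset.sdiff_subset) hne hcl
    have haS := Finset.mem_sdiff.1 (hU ha)
    obtain rfl | rfl := (hN a (Finset.mem_of_mem_erase haS.1)).1 har.symm
    exacts [absurd hzA haS.2, ha]
  refine ⟨A, S.erase r \ A, Finset.union_sdiff_of_subset hAS, Finset.disjoint_sdiff, hzA,
    hz' subset_rfl hB hAcl.sdiff, hA, ⟨hB, fun U hU hne hcl => hU.antisymm ?_⟩, hAcl, hAcl.sdiff⟩
  by_contra hBU
  have := hz' Finset.sdiff_subset (Finset.sdiff_nonempty.2 hBU)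
    (hAcl.sdiff.trans hcl.sdiff Finset.sdiff_subset)
  exact (Finset.mem_sdiff.1 this).2 (hz' hU hne (hAcl.sdiff.trans hcl hU))

end Connectivity

namespace ArcColoring

section ColoringOn

variable {V C ι : Type*} {G : SimpleGraph V} {K K' L : ArcColoring V C} {e : ι → V × V}
  {S T : Finset V} {u v w : V} {a : C}

/-- `K` is a valid coloring of all edges with both ends in `S`, and of no other edges. -/
structure IsColoringOn (K : ArcColoring V C) (G : SimpleGraph V) (S : Finset V) : Prop
    extends K.IsValid G where
  colored_iff : ∀ u v, (∃ a, K.HasColor u v a) ↔ G.Adj u v ∧ u ∈ S ∧ v ∈ S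

lemma IsColoringOn.mem_left (hK : K.IsColoringOn G S) (h : K.HasColor u v a) : u ∈ S :=
  ((hK.colored_iff u v).1 ⟨a, h⟩).2.1

lemma IsColoringOn.mem_right (hK : K.IsColoringOn G S) (h : K.HasColor u v a) : v ∈ S :=
  hK.mem_left h.symm

lemma isColoringOn_of_forall_not_adj (h : ∀ u ∈ S, ∀ v ∈ S, ¬ G.Adj u v) :
    IsColoringOn (fun _ _ _ => False : ArcColoring V C) G S where
  adj := False.elim
  color_unique h := (h.elim id id).elim
  proper h := (h.elim id id).elim
  head := False.elim
  colored_iff u v := by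
    simp only [HasColor, or_self, exists_false, false_iff]
    exact fun ⟨huv, hu, hv⟩ => h u hu v hv huv

/-- The arcs `e i` enumerate, without repetition, the edges inside `T` that are not inside `S`. -/
structure EnumeratesNewEdges (G : SimpleGraph V) (S T : Finset V) (e : ι → V × V) : Prop where
  adj : ∀ i, G.Adj (e i).1 (e i).2
  mem : ∀ i, (e i).1 ∈ T ∧ (e i).2 ∈ T
  notMem : ∀ i, (e i).1 ∉ S ∨ (e i).2 ∉ S
  edge_injective : Function.Injective fun i => s((e i).1, (e i).2)
  exists_eq : ∀ u ∈ T, u ∉ S → ∀ v ∈ T, G.Adj u v → ∃ i, s((e i).1, (e i).2) = s(u, v)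

lemma EnumeratesNewEdges.reorient (he : EnumeratesNewEdges G S T e) {e' : ι → V × V}
    (h : ∀ i, e' i = e i ∨ e' i = (e i).swap) : EnumeratesNewEdges G S T e' := by
  have hs (i : ι) : s((e' i).1, (e' i).2) = s((e i).1, (e i).2) := by
    obtain h | h := h i <;> simp [h, Sym2.eq_swap]
  refine ⟨fun i => ?_, fun i => ?_, fun i => ?_, by simpa only [hs] using he.edge_injective,
    by simpa only [hs] using he.exists_eq⟩
  · rw [← G.mem_edgeSet, hs]
    exact he.adj i
  · obtain h | h := h i <;> simpa [h, and_comm] using he.mem i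
  · obtain h | h := h i <;> simpa [h, or_comm] using he.notMem i

lemma EnumeratesNewEdges.isFresh (he : EnumeratesNewEdges G S T e) (hK : K.IsColoringOn G S) :
    K.IsFresh G e where
  adj := he.adj
  uncolored i _ h := (he.notMem i).elim (fun h' => h' (hK.mem_left h)) fun h' => h' (hK.mem_right h)
  edge_injective := he.edge_injective

lemma IsExtension.hasColor_iff (h : K.IsExtension G e K') : (∃ a, K'.HasColor u v a) ↔
    (∃ a, K.HasColor u v a) ∨ ∃ i, s((e i).1, (e i).2) = s(u, v) := by
  refine ⟨fun ⟨a, ha⟩ => ?_, ?_⟩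
  · obtain ha | ha := ha
    · exact (h.arc ha).imp (fun ha => ⟨a, Or.inl ha⟩) fun ⟨i, hi⟩ => ⟨i, by rw [hi]⟩
    · exact (h.arc ha).imp (fun ha => ⟨a, Or.inr ha⟩) fun ⟨i, hi⟩ => ⟨i, by rw [hi, Sym2.eq_swap]⟩
  · rintro (⟨a, ha⟩ | ⟨i, hi⟩)
    · exact ⟨a, ha.imp h.le h.le⟩
    · obtain ⟨a, ha⟩ := h.colored i
      obtain ⟨rfl, rfl⟩ | ⟨rfl, rfl⟩ := Sym2.eq_iff.1 hi
      exacts [⟨a, Or.inl ha⟩, ⟨a, Or.inr ha⟩]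

lemma IsExtension.isColoringOn (h : K.IsExtension G e K') (hK : K.IsColoringOn G S) (hST : S ⊆ T)
    (he : EnumeratesNewEdges G S T e) : K'.IsColoringOn G T where
  toIsValid := h.toIsValid
  colored_iff u v := by
    rw [h.hasColor_iff, hK.colored_iff]
    constructor
    · rintro (⟨huv, hu, hv⟩ | ⟨i, hi⟩)
      · exact ⟨huv, hST hu, hST hv⟩
      · have := he.adj i
        have := he.mem i
        obtain ⟨rfl, rfl⟩ | ⟨rfl, rfl⟩ := Sym2.eq_iff.1 hi
        exacts [⟨he.adj i, he.mem i⟩, ⟨(he.adj i).symm, (he.mem i).symm⟩]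
    · rintro ⟨huv, hu, hv⟩
      by_cases huS : u ∈ S
      · by_cases hvS : v ∈ S
        · exact Or.inl ⟨huv, huS, hvS⟩
        · exact Or.inr (Sym2.eq_swap (a := u) ▸ he.exists_eq v hv hvS u hu huv.symm)
      · exact Or.inr (he.exists_eq u hu huS v hv huv)

variable [Fintype C]

lemma IsExtension.headColors_eq (h : K.IsExtension G e K') (hw : ∀ i, (e i).2 ≠ w) :
    K'.headColors w = K.headColors w := by
  ext a
  simp only [mem_headColors]
  refine exists_congr fun x => ⟨fun hx => (h.arc hx).resolve_right ?_, h.le⟩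
  rintro ⟨i, hi⟩
  exact hw i (by rw [hi])

lemma IsExtension.colorsAt_eq (h : K.IsExtension G e K') (hw : ∀ i, (e i).1 ≠ w ∧ (e i).2 ≠ w) :
    K'.colorsAt w = K.colorsAt w := by
  have hiff (u v a) (huv : ∀ i, e i ≠ (u, v)) : K' u v a ↔ K u v a :=
    ⟨fun hx => (h.arc hx).resolve_right fun ⟨i, hi⟩ => huv i hi, h.le⟩
  ext a
  simp only [mem_colorsAt, HasColor]
  refine exists_congr fun x => or_congr (hiff _ _ _ fun i hi => (hw i).1 ?_)
    (hiff _ _ _ fun i hi => (hw i).2 ?_) <;> rw [hi]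

lemma IsExtension.card_headColors_le (h : K.IsExtension G e K') (hw : K.headColors w = ∅)
    (X : Finset V) (hX : ∀ i, (e i).2 = w → (e i).1 ∈ X) : (K'.headColors w).card ≤ X.card :=
  h.toIsValid.card_headColors_le X fun x a hx => by
    obtain hx | ⟨i, hi⟩ := h.arc hx
    · exact absurd (mem_headColors.2 ⟨x, hx⟩) (by simp [hw])
    · simpa [hi] using hX i (by rw [hi])

lemma IsColoringOn.colorsAt_eq_empty (hK : K.IsColoringOn G S) (hw : w ∉ S) :
    K.colorsAt w = ∅ := ArcColoring.colorsAt_eq_empty fun _ _ hx => hw (hK.mem_left hx)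

lemma IsColoringOn.headColors_eq_empty (hK : K.IsColoringOn G S) (hw : w ∉ S) :
    K.headColors w = ∅ :=
  Finset.subset_empty.1 (hK.colorsAt_eq_empty hw ▸ K.headColors_subset_colorsAt w)

lemma IsColoringOn.card_colorsAt_le (hK : K.IsColoringOn G S) (w : V) :
    (K.colorsAt w).card ≤ degreeOn G S w := by
  classical
  exact hK.toIsValid.card_colorsAt_le _ fun x a hx =>
    Finset.mem_filter.2 ⟨hK.mem_right hx, hK.adj_of_hasColor hx⟩

lemma IsColoringOn.card_headColors_le (hK : K.IsColoringOn G S) (w : V) :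
    (K.headColors w).card ≤ degreeOn G S w :=
  (Finset.card_le_card (K.headColors_subset_colorsAt w)).trans (hK.card_colorsAt_le w)

lemma IsColoringOn.card_forbidden_le [G.LocallyFinite] (hG : ∀ v, G.degree v ≤ 3)
    (hK : K.IsColoringOn G S) (hu : u ∉ S) (huv : G.Adj u v) {k : ℕ}
    (hk : ∀ w ∈ S, (K.colorsAt w).card ≤ k) {H : Finset C}
    (hH : ∀ w ∈ S, w ≠ v → G.Adj u w → K.headColors w ⊆ H) :
    (K.forbidden G u v).card ≤ 2 * k + H.card := by
  have := ArcColoring.card_forbidden_le (K := K) (k := k) (H := H) hG huv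
    (fun w _ => ?_) fun w hw huw => ?_
  · simpa [hK.colorsAt_eq_empty hu] using this
  · by_cases hw : w ∈ S
    exacts [hk w hw, by simp [hK.colorsAt_eq_empty hw]]
  · by_cases hwS : w ∈ S
    exacts [hH w hwS hw huw, by simp [hK.headColors_eq_empty hwS]]

lemma IsColoringOn.card_forbidden_le_six [G.LocallyFinite] (hG : ∀ v, G.degree v ≤ 3)
    (hK : K.IsColoringOn G S) (hu : u ∈ S) (huv : G.Adj u v)
    (hd : ∀ w ∈ S, G.Adj v w → degreeOn G S w = 1) : (K.forbidden G u v).card ≤ 6 := by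
  obtain ⟨y, -, hyN⟩ := exists_of_degreeOn_eq_one (hd u hu huv.symm)
  have := ArcColoring.card_forbidden_le (K := K) (k := 1) (H := K.headColors y) hG huv
    (fun w hvw => ?_) fun w _ huw => ?_
  · have := (hK.card_colorsAt_le u).trans_eq (hd u hu huv.symm)
    have := (Finset.card_le_card (K.headColors_subset_colorsAt y)).trans
      (hK.toIsValid.card_colorsAt_le_three hG y)
    omega
  · by_cases hwS : w ∈ S
    · exact (hK.card_colorsAt_le w).trans_eq (hd w hwS hvw)
    · simp [hK.colorsAt_eq_empty hwS]
  · by_cases hwS : w ∈ S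
    · rw [(hyN w hwS).1 huw]
    · simp [hK.headColors_eq_empty hwS]

theorem IsColoringOn.exists_isExtension {n : ℕ} {e : Fin n → V × V} (hK : K.IsColoringOn G S)
    (hST : S ⊆ T) (he : EnumeratesNewEdges G S T e)
    (h : ∀ i, (K.forbidden G (e i).1 (e i).2).card + i < Fintype.card C) :
    ∃ K', K.IsExtension G e K' ∧ K'.IsColoringOn G T :=
  let ⟨_, _, _, hK'⟩ := (he.isFresh hK).exists_addArcs hK.toIsValid (fun _ => subset_rfl) h
  ⟨_, hK', hK'.isColoringOn hK hST he⟩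

end ColoringOn

section GoodOn

variable {V : Type*} {G : SimpleGraph V} {K K' L : ArcColoring V (Fin 8)}
  {S A B : Finset V} {r z z' : V}

/-- `K` is a coloring of the edges inside `S` with eight colors such that every vertex of degree
two in the subgraph induced by `S` is the designated end of at most one edge. This leaves enough
colors for a further edge at such a vertex. -/
structure IsGoodOn (K : ArcColoring V (Fin 8)) (G : SimpleGraph V) (S : Finset V) : Prop
    extends K.IsColoringOn G S where
  card_headColors_le_one : ∀ w ∈ S, degreeOn G S w = 2 → (K.headColors w).card ≤ 1

lemma isGoodOn_of_forall_not_adj (h : ∀ u ∈ S, ∀ v ∈ S, ¬ G.Adj u v) :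
    IsGoodOn (fun _ _ _ => False) G S where
  toIsColoringOn := isColoringOn_of_forall_not_adj h
  card_headColors_le_one w _ _ := by
    simp [ArcColoring.headColors_eq_empty]

lemma headColors_sup (hK : K.IsColoringOn G A) (hr : r ∉ A) :
    (K ⊔ L).headColors r = L.headColors r := by
  ext a
  simp only [mem_headColors]
  exact exists_congr fun x => or_iff_right fun h => hr (hK.mem_right (Or.inl h))

lemma IsColoringOn.sup [DecidableEq V] (hd : Disjoint A B) (hA : IsClosedIn G (A ∪ B) A)
    (hB : IsClosedIn G (A ∪ B) B) (hK : K.IsColoringOn G A) (hL : L.IsColoringOn G B) :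
    (K ⊔ L).IsColoringOn G (A ∪ B) := by
  have hcol {u v a} : (K ⊔ L).HasColor u v a ↔ K.HasColor u v a ∨ L.HasColor u v a := or_or_or_comm
  have hdis {u v w a b} (h₁ : K.HasColor u v a) (h₂ : L.HasColor u w b) : False :=
    Finset.disjoint_left.1 hd (hK.mem_left h₁) (hL.mem_left h₂)
  refine ⟨⟨?_, ?_, ?_, ?_⟩, ?_⟩
  · rintro u v a (h | h)
    exacts [hK.adj h, hL.adj h]
  · intro u v a b h₁ h₂
    obtain h₁ | h₁ := hcol.1 h₁ <;> obtain h₂ | h₂ := hcol.1 h₂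
    exacts [hK.color_unique h₁ h₂, (hdis h₁ h₂).elim, (hdis h₂ h₁).elim, hL.color_unique h₁ h₂]
  · intro u v w a h₁ h₂
    obtain h₁ | h₁ := hcol.1 h₁ <;> obtain h₂ | h₂ := hcol.1 h₂
    exacts [hK.proper h₁ h₂, (hdis h₁ h₂).elim, (hdis h₂ h₁).elim, hL.proper h₁ h₂]
  · rintro u v w x a h₁ hvw hwu h₂
    obtain h₁ | h₁ := h₁ <;> obtain h₂ | h₂ := hcol.1 h₂
    · exact hK.head h₁ hvw hwu h₂
    · have := hA v (hK.mem_right (Or.inl h₁)) w (Finset.mem_union_right _ (hL.mem_left h₂)) hvw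
      exact Finset.disjoint_left.1 hd this (hL.mem_left h₂)
    · have := hB v (hL.mem_right (Or.inl h₁)) w (Finset.mem_union_left _ (hK.mem_left h₂)) hvw
      exact Finset.disjoint_left.1 hd (hK.mem_left h₂) this
    · exact hL.head h₁ hvw hwu h₂
  · intro u v
    simp only [hcol, exists_or, hK.colored_iff, hL.colored_iff]
    constructor
    · rintro (⟨h, hu, hv⟩ | ⟨h, hu, hv⟩)
      exacts [⟨h, Finset.mem_union_left _ hu, Finset.mem_union_left _ hv⟩,
        ⟨h, Finset.mem_union_right _ hu, Finset.mem_union_right _ hv⟩]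
    · rintro ⟨h, hu, hv⟩
      obtain hu | hu := Finset.mem_union.1 hu
      exacts [Or.inl ⟨h, hu, hA u hu v hv h⟩, Or.inr ⟨h, hu, hB u hu v hv h⟩]

theorem IsGoodOn.exists_union [DecidableEq V] (hAB : A ∪ B = S) (hd : Disjoint A B)
    (hA : IsClosedIn G S A) (hB : IsClosedIn G S B) (hK : K.IsGoodOn G A) (hL : L.IsGoodOn G B) :
    ∃ M : ArcColoring V (Fin 8), M.IsGoodOn G S ∧ (∀ w ∈ A, M.headColors w = K.headColors w) ∧
      ∀ w ∈ B, M.headColors w = L.headColors w := by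
  subst hAB
  have hMA : ∀ w ∈ A, (K ⊔ L).headColors w = K.headColors w := fun w hw => by
    rw [sup_comm, headColors_sup hL.toIsColoringOn (Finset.disjoint_left.1 hd hw)]
  have hMB : ∀ w ∈ B, (K ⊔ L).headColors w = L.headColors w := fun w hw => by
    rw [headColors_sup hK.toIsColoringOn (Finset.disjoint_right.1 hd hw)]
  refine ⟨K ⊔ L, ⟨hK.toIsColoringOn.sup hd hA hB hL.toIsColoringOn, fun w hw hdeg => ?_⟩, hMA, hMB⟩
  obtain hw | hw := Finset.mem_union.1 hw
  · rw [hMA w hw]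
    exact hK.card_headColors_le_one w hw <| by
      rw [degreeOn_congr Finset.subset_union_left hA hw, hdeg]
  · rw [hMB w hw]
    exact hL.card_headColors_le_one w hw <| by
      rw [degreeOn_congr Finset.subset_union_right hB hw, hdeg]

variable [DecidableEq V]

lemma IsGoodOn.of_isExtension_insert {ι : Type*} {e : ι → V × V} (hK : K.IsGoodOn G S)
    (hK' : K.IsExtension G e K') (hcol : K'.IsColoringOn G (insert r S))
    (he : ∀ i, (e i).1 = r ∨ (e i).2 = r)
    (h : ∀ w ∈ insert r S, w = r ∨ G.Adj w r → degreeOn G (insert r S) w = 2 →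
      (K'.headColors w).card ≤ 1) : K'.IsGoodOn G (insert r S) where
  toIsColoringOn := hcol
  card_headColors_le_one w hw hdeg := by
    by_cases hwr : w = r ∨ G.Adj w r
    · exact h w hw hwr hdeg
    push Not at hwr
    rw [hK'.headColors_eq]
    · exact hK.card_headColors_le_one w (Finset.mem_of_mem_insert_of_ne hw hwr.1)
        (by rwa [degreeOn_insert_of_not_adj hwr.2] at hdeg)
    · rintro i rfl
      obtain ⟨a, ha⟩ := hK'.colored i
      obtain hi | hi := he i
      exacts [hwr.2 (hi ▸ (hK'.adj ha).symm), hwr.1 hi]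

lemma enumeratesNewEdges_insert_one (hr : r ∉ S) (hz : z ∈ S) (hN : ∀ x ∈ S, G.Adj r x ↔ x = z) :
    EnumeratesNewEdges G S (insert r S) ![(r, z)] where
  adj := by simp [(hN z hz).2]
  mem := by simp [hz]
  notMem := by simp [hr]
  edge_injective := Function.injective_of_subsingleton _
  exists_eq u hu huS v hv huv := by
    obtain rfl : u = r := by simpa [huS] using hu
    have hvS : v ∈ S := Finset.mem_of_mem_insert_of_ne hv huv.ne'
    simp [(hN v hvS).1 huv]

lemma enumeratesNewEdges_insert_two (hr : r ∉ S) (hz : z ∈ S) (hz' : z' ∈ S) (hne : z ≠ z')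
    (hN : ∀ x ∈ S, G.Adj r x ↔ x = z ∨ x = z') :
    EnumeratesNewEdges G S (insert r S) ![(r, z), (r, z')] where
  adj := by simp [Fin.forall_fin_two, (hN z hz).2, (hN z' hz').2]
  mem := by simp [Fin.forall_fin_two, hz, hz']
  notMem := by simp [Fin.forall_fin_two, hr]
  edge_injective := by
    have : z ≠ r := fun h => hr (h ▸ hz)
    simp [Function.Injective, Fin.forall_fin_two, hne, hne.symm, this, this.symm]
  exists_eq u hu huS v hv huv := by
    obtain rfl : u = r := by simpa [huS] using hu
    have hvS : v ∈ S := Finset.mem_of_mem_insert_of_ne hv huv.ne'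
    obtain rfl | rfl := (hN v hvS).1 huv
    exacts [⟨0, rfl⟩, ⟨1, rfl⟩]

variable [G.LocallyFinite]

theorem IsGoodOn.exists_insert_one (hG : ∀ v, G.degree v ≤ 3) (hK : K.IsGoodOn G S) (hr : r ∉ S)
    (hz : z ∈ S) (hN : ∀ x ∈ S, G.Adj r x ↔ x = z)
    (hIz : degreeOn G S z = 1 → K.headColors z = ∅) :
    ∃ K' : ArcColoring V (Fin 8), K'.IsGoodOn G (insert r S) ∧
      ∀ w, w ≠ z → K'.headColors w = K.headColors w := by
  have hrz : G.Adj r z := (hN z hz).2 rfl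
  have hforb : (K.forbidden G r z).card ≤ 6 :=
    hK.toIsColoringOn.card_forbidden_le hG hr hrz (H := ∅)
      (fun w _ => hK.toIsValid.card_colorsAt_le_three hG w)
      fun w hw hwz hrw => absurd ((hN w hw).1 hrw) hwz
  obtain ⟨K', hK', hcol⟩ := hK.toIsColoringOn.exists_isExtension (S.subset_insert r)
    (enumeratesNewEdges_insert_one hr hz hN) (by simp; omega)
  have hhead (w : V) (hw : w ≠ z) : K'.headColors w = K.headColors w :=
    hK'.headColors_eq (by simpa using hw.symm)
  refine ⟨K', hK.of_isExtension_insert hK' hcol (by simp) ?_, hhead⟩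
  rintro w hw hwr hdeg
  obtain rfl | hwz := eq_or_ne w z
  · rw [degreeOn_insert_of_adj hr hrz.symm] at hdeg
    exact hK'.card_headColors_le (hIz (by omega)) {r} (by simp)
  · obtain rfl : w = r := by
      by_contra hne
      exact hwz ((hN w (Finset.mem_of_mem_insert_of_ne hw hne)).1 (hwr.resolve_left hne).symm)
    simp [hhead w hwz, hK.toIsColoringOn.headColors_eq_empty hr]

lemma IsGoodOn.exists_insert_two_of_card_headColors_le (hG : ∀ v, G.degree v ≤ 3)
    (hK : K.IsGoodOn G S) (hr : r ∉ S)
    (hz : z ∈ S) (hz' : z' ∈ S) (hne : z ≠ z') (hN : ∀ x ∈ S, G.Adj r x ↔ x = z ∨ x = z')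
    (hIz : K.headColors z = ∅ ∨
      (K.headColors z).card ≤ 1 ∧ degreeOn G S z = 2 ∧ ∀ w ∈ S, degreeOn G S w ≤ 2)
    (hIz' : (K.headColors z').card ≤ 1) (hdz' : degreeOn G S z' = 1 → K.headColors z' = ∅) :
    ∃ K' : ArcColoring V (Fin 8), K'.IsGoodOn G (insert r S) ∧ K'.headColors r = ∅ := by
  have hrz : G.Adj r z := (hN z hz).2 (Or.inl rfl)
  have hrz' : G.Adj r z' := (hN z' hz').2 (Or.inr rfl)
  have h3 (w : V) (_ : w ∈ S) := hK.toIsValid.card_colorsAt_le_three hG w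
  have hforb : (K.forbidden G r z).card ≤ 7 :=
    (hK.toIsColoringOn.card_forbidden_le hG hr hrz h3 fun w hw hwz hrw => by
      rw [((hN w hw).1 hrw).resolve_left hwz]).trans (Nat.add_le_add_left hIz' 6)
  have hforb' : (K.forbidden G r z').card ≤ 6 := by
    have hH (w : V) (hw : w ∈ S) (hwz : w ≠ z') (hrw : G.Adj r w) :
        K.headColors w ⊆ K.headColors z := by rw [((hN w hw).1 hrw).resolve_right hwz]
    obtain hI | ⟨hI, -, hS⟩ := hIz
    · simpa [hI] using hK.toIsColoringOn.card_forbidden_le hG hr hrz' h3 hH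
    · have := hK.toIsColoringOn.card_forbidden_le hG hr hrz'
        (fun w hw => (hK.card_colorsAt_le w).trans (hS w hw)) hH
      omega
  obtain ⟨K', hK', hcol⟩ := hK.toIsColoringOn.exists_isExtension (S.subset_insert r)
    (enumeratesNewEdges_insert_two hr hz hz' hne hN)
    (Fin.forall_fin_two.2 ⟨by simp; omega, by simp; omega⟩)
  have hr' : K'.headColors r = ∅ := by
    rw [hK'.headColors_eq (by simp [Fin.forall_fin_two, hrz.ne', hrz'.ne']),
      hK.toIsColoringOn.headColors_eq_empty hr]
  refine ⟨K', hK.of_isExtension_insert hK' hcol (by simp [Fin.forall_fin_two]) ?_, hr'⟩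
  intro w hw hwr hdeg
  obtain rfl | hne := eq_or_ne w r
  · simp [hr']
  have hempty : K.headColors w = ∅ := by
    have hwS := Finset.mem_of_mem_insert_of_ne hw hne
    rw [degreeOn_insert_of_adj hr (hwr.resolve_left hne)] at hdeg
    obtain rfl | rfl := (hN w hwS).1 (hwr.resolve_left hne).symm
    · exact hIz.resolve_right fun h => by omega
    · exact hdz' (by omega)
  exact hK'.card_headColors_le hempty {r} (by simp [Fin.forall_fin_two])

theorem IsGoodOn.exists_insert_two (hG : ∀ v, G.degree v ≤ 3) (hK : K.IsGoodOn G S) (hr : r ∉ S)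
    (hz : z ∈ S) (hz' : z' ∈ S) (hne : z ≠ z') (hN : ∀ x ∈ S, G.Adj r x ↔ x = z ∨ x = z')
    (hI : K.headColors z = ∅ ∨ degreeOn G S z = 2)
    (hI' : K.headColors z' = ∅ ∨ degreeOn G S z' = 2)
    (h : K.headColors z = ∅ ∨ K.headColors z' = ∅ ∨ ∀ w ∈ S, degreeOn G S w ≤ 2) :
    ∃ K' : ArcColoring V (Fin 8), K'.IsGoodOn G (insert r S) ∧ K'.headColors r = ∅ := by
  have h1 {w : V} (hw : w ∈ S) (h : K.headColors w = ∅ ∨ degreeOn G S w = 2) :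
      (K.headColors w).card ≤ 1 :=
    h.elim (by simp [·]) (hK.card_headColors_le_one w hw)
  have h0 {w : V} (h : K.headColors w = ∅ ∨ degreeOn G S w = 2) (hd : degreeOn G S w = 1) :
      K.headColors w = ∅ := h.resolve_right (by omega)
  obtain hz0 | hz0 := hI
  · exact hK.exists_insert_two_of_card_headColors_le hG hr hz hz' hne hN (Or.inl hz0) (h1 hz' hI')
      (h0 hI')
  obtain h | h | h := h
  · exact hK.exists_insert_two_of_card_headColors_le hG hr hz hz' hne hN (Or.inl h) (h1 hz' hI')
      (h0 hI')
  · exact hK.exists_insert_two_of_card_headColors_le hG hr hz' hz hne.symm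
      (fun x hx => (hN x hx).trans or_comm) (Or.inl h) (h1 hz (Or.inr hz0)) (h0 (Or.inr hz0))
  · exact hK.exists_insert_two_of_card_headColors_le hG hr hz hz' hne hN
      (Or.inr ⟨h1 hz (Or.inr hz0), hz0, h⟩) (h1 hz' hI') (h0 hI')

/-- Of the two edges at `r`, one is designated at `r` and the other one at its neighbor. -/
theorem IsGoodOn.exists_insert_of_path (hG : ∀ v, G.degree v ≤ 3) (hK : K.IsGoodOn G S)
    (hr : r ∉ S) (hz : z ∈ S) (hz' : z' ∈ S) (hne : z ≠ z')
    (hN : ∀ x ∈ S, G.Adj r x ↔ x = z ∨ x = z') (hdz : degreeOn G S z = 1)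
    (hdz' : degreeOn G S z' = 1) (hI : K.headColors z = ∅) :
    ∃ K' : ArcColoring V (Fin 8), K'.IsGoodOn G (insert r S) := by
  have hrz : G.Adj r z := (hN z hz).2 (Or.inl rfl)
  have hrz' : G.Adj r z' := (hN z' hz').2 (Or.inr rfl)
  have hIz' := (hK.card_headColors_le z').trans_eq hdz'
  have hforb : (K.forbidden G r z).card ≤ 7 :=
    (hK.toIsColoringOn.card_forbidden_le hG hr hrz
      (fun w _ => hK.toIsValid.card_colorsAt_le_three hG w) fun w hw hwz hrw => by
        rw [((hN w hw).1 hrw).resolve_left hwz]).trans (Nat.add_le_add_left hIz' 6)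
  have hforb' : (K.forbidden G z' r).card ≤ 6 :=
    hK.toIsColoringOn.card_forbidden_le_six hG hz' hrz'.symm fun w hw hrw => by
      obtain rfl | rfl := (hN w hw).1 hrw <;> assumption
  obtain ⟨K', hK', hcol⟩ := hK.toIsColoringOn.exists_isExtension (S.subset_insert r)
    ((enumeratesNewEdges_insert_two hr hz hz' hne hN).reorient (e' := ![(r, z), (z', r)])
      (by simp [Fin.forall_fin_two]))
    (Fin.forall_fin_two.2 ⟨by simp; omega, by simp; omega⟩)
  refine ⟨K', hK.of_isExtension_insert hK' hcol (by simp [Fin.forall_fin_two]) ?_⟩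
  intro w hw hwr _
  obtain rfl | hwr' := eq_or_ne w r
  · exact hK'.card_headColors_le (hK.toIsColoringOn.headColors_eq_empty hr) {z'}
      (by simp [Fin.forall_fin_two, hrz.ne'])
  obtain rfl | rfl := (hN w (Finset.mem_of_mem_insert_of_ne hw hwr')).1
    (hwr.resolve_left hwr').symm
  · exact hK'.card_headColors_le hI {r} (by simp [Fin.forall_fin_two, hrz.ne])
  · rwa [hK'.headColors_eq (by simp [Fin.forall_fin_two, hne, hwr'.symm])]

end GoodOn

end ArcColoring

section Rooted

variable {V : Type*} {G : SimpleGraph V} {S A B : Finset V} {r t y z z' : V}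

variable (G) in
/-- The set `S` has a good coloring with no edge designated at the root `r`; the condition on `r`
is waived if all degrees are two, so that `S` induces a cycle when it is connected. -/
def HasRootedColoring (S : Finset V) (r : V) : Prop :=
  ∃ K : ArcColoring V (Fin 8), K.IsGoodOn G S ∧
    (K.headColors r = ∅ ∨ ∀ w ∈ S, degreeOn G S w = 2)

variable (G) in
/-- The set `S` has a good coloring with no edge designated at either of the roots `r` and `t`. -/
def HasTwoRootedColoring (S : Finset V) (r t : V) : Prop :=
  ∃ K : ArcColoring V (Fin 8), K.IsGoodOn G S ∧ K.headColors r = ∅ ∧ K.headColors t = ∅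

lemma IsConnectedOn.eq_singleton (hS : IsConnectedOn G S) (hr : r ∈ S)
    (h : degreeOn G S r = 0) : S = {r} := by
  refine (hS.2 {r} (by simpa using hr) (Finset.singleton_nonempty r) fun a ha b hb hab => ?_).symm
  exact absurd (Finset.mem_singleton.1 ha ▸ hab) (not_adj_of_degreeOn_eq_zero h hb)

lemma IsConnectedOn.eq_pair [DecidableEq V] (hS : IsConnectedOn G S) (hr : r ∈ S) (ht : t ∈ S)
    (hrN : ∀ x ∈ S, G.Adj r x → x = t) (htN : ∀ x ∈ S, G.Adj t x → x = r) : S = {r, t} := by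
  refine (hS.2 {r, t} (by simp [Finset.insert_subset_iff, hr, ht]) ⟨r, by simp⟩ ?_).symm
  intro a ha b hb hab
  obtain rfl | rfl := by simpa using ha
  · simp [hrN b hb hab]
  · simp [htN b hb hab]

variable [G.LocallyFinite]

lemma HasRootedColoring.insert_one [DecidableEq V] (hG : ∀ v, G.degree v ≤ 3)
    (h : HasRootedColoring G S z) (hr : r ∉ S) (hz : z ∈ S) (hN : ∀ x ∈ S, G.Adj r x ↔ x = z) :
    HasRootedColoring G (insert r S) r := by
  obtain ⟨K, hK, hI⟩ := h
  obtain ⟨K', hK', hhead⟩ := hK.exists_insert_one hG hr hz hN fun h1 =>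
    hI.resolve_right fun h2 => by have := h2 z hz; omega
  exact ⟨K', hK', Or.inl (by
    rw [hhead r ((hN z hz).2 rfl).ne, hK.toIsColoringOn.headColors_eq_empty hr])⟩

lemma HasRootedColoring.insert_two [DecidableEq V] (hG : ∀ v, G.degree v ≤ 3)
    (h : HasRootedColoring G S z) (hr : r ∉ S) (hz : z ∈ S) (hz' : z' ∈ S) (hne : z ≠ z')
    (hN : ∀ x ∈ S, G.Adj r x ↔ x = z ∨ x = z') (hdz' : degreeOn G S z' = 2) :
    HasRootedColoring G (insert r S) r := by
  obtain ⟨K, hK, hI⟩ := h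
  obtain ⟨K', hK', hr'⟩ := hK.exists_insert_two hG hr hz hz' hne hN
    (hI.imp_right fun h => h z hz) (Or.inr hdz')
    (hI.imp_right fun h => Or.inr fun w hw => (h w hw).le)
  exact ⟨K', hK', Or.inl hr'⟩

lemma HasRootedColoring.insert_cycle [DecidableEq V] (hG : ∀ v, G.degree v ≤ 3)
    (h : HasRootedColoring G S z) (hr : r ∉ S) (hz : z ∈ S) (hz' : z' ∈ S) (hne : z ≠ z')
    (hN : ∀ x ∈ S, G.Adj r x ↔ x = z ∨ x = z') (hdz : degreeOn G S z = 1)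
    (hdz' : degreeOn G S z' = 1) (hcyc : ∀ w ∈ insert r S, degreeOn G (insert r S) w = 2) :
    HasRootedColoring G (insert r S) r := by
  obtain ⟨K, hK, hI⟩ := h
  obtain ⟨K', hK'⟩ := hK.exists_insert_of_path hG hr hz hz' hne hN hdz hdz' <|
    hI.resolve_right fun h => by have := h z hz; omega
  exact ⟨K', hK', Or.inr hcyc⟩

lemma HasTwoRootedColoring.insert_two [DecidableEq V] (hG : ∀ v, G.degree v ≤ 3)
    (h : HasTwoRootedColoring G S z z') (hr : r ∉ S) (hz : z ∈ S) (hz' : z' ∈ S) (hne : z ≠ z')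
    (hN : ∀ x ∈ S, G.Adj r x ↔ x = z ∨ x = z') : HasRootedColoring G (insert r S) r := by
  obtain ⟨K, hK, hI, hI'⟩ := h
  obtain ⟨K', hK', hr'⟩ := hK.exists_insert_two hG hr hz hz' hne hN (Or.inl hI) (Or.inl hI')
    (Or.inl hI)
  exact ⟨K', hK', Or.inl hr'⟩

lemma HasRootedColoring.insert_union [DecidableEq V] (hG : ∀ v, G.degree v ≤ 3)
    (hzK : HasRootedColoring G A z)
    (hzL : HasRootedColoring G B z') (hAB : A ∪ B = S) (hd : Disjoint A B)
    (hA : IsClosedIn G S A) (hB : IsClosedIn G S B) (hr : r ∉ S) (hz : z ∈ A) (hz' : z' ∈ B)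
    (hN : ∀ x ∈ S, G.Adj r x ↔ x = z ∨ x = z') : HasRootedColoring G (insert r S) r := by
  obtain ⟨K, hK, hI⟩ := hzK
  obtain ⟨L, hL, hJ⟩ := hzL
  obtain ⟨M, hM, hMA, hMB⟩ := hK.exists_union hAB hd hA hB hL
  have hAS : A ⊆ S := hAB ▸ Finset.subset_union_left
  have hBS : B ⊆ S := hAB ▸ Finset.subset_union_right
  have hne : z ≠ z' := by
    rintro rfl
    exact Finset.disjoint_left.1 hd hz hz'
  have hdA : (∀ w ∈ A, degreeOn G A w = 2) → ∀ w ∈ A, degreeOn G S w = 2 := fun h w hw => by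
    rw [← degreeOn_congr hAS hA hw, h w hw]
  have hdB : (∀ w ∈ B, degreeOn G B w = 2) → ∀ w ∈ B, degreeOn G S w = 2 := fun h w hw => by
    rw [← degreeOn_congr hBS hB hw, h w hw]
  rw [← hMA z hz] at hI
  rw [← hMB z' hz'] at hJ
  replace hI := hI.imp_right hdA
  replace hJ := hJ.imp_right hdB
  obtain ⟨K', hK', hr'⟩ := hM.exists_insert_two hG hr (hAS hz) (hBS hz') hne hN
    (hI.imp_right fun h => h z hz) (hJ.imp_right fun h => h z' hz')
    (hI.imp_right fun hI => hJ.imp_right fun hJ w hw =>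
      (Finset.mem_union.1 (hAB ▸ hw)).elim (fun hw => (hI w hw).le) fun hw => (hJ w hw).le)
  exact ⟨K', hK', Or.inl hr'⟩

lemma HasTwoRootedColoring.insert_one [DecidableEq V] (hG : ∀ v, G.degree v ≤ 3)
    (h : HasTwoRootedColoring G S r y) (ht : t ∉ S) (hry : r ≠ y) (hy : y ∈ S)
    (hN : ∀ x ∈ S, G.Adj t x ↔ x = y) : HasTwoRootedColoring G (insert t S) r t := by
  obtain ⟨K, hK, hI, hIy⟩ := h
  obtain ⟨K', hK', hhead⟩ := hK.exists_insert_one hG ht hy hN fun _ => hIy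
  exact ⟨K', hK', by rw [hhead r hry, hI], by
    rw [hhead t ((hN y hy).2 rfl).ne, hK.toIsColoringOn.headColors_eq_empty ht]⟩

lemma HasRootedColoring.insert_second_root [DecidableEq V] (hG : ∀ v, G.degree v ≤ 3)
    (h : HasRootedColoring G S r) (hr : r ∈ S) (hdr : degreeOn G S r = 1) (ht : t ∉ S)
    (hry : r ≠ y) (hy : y ∈ S) (hN : ∀ x ∈ S, G.Adj t x ↔ x = y) (hdy : degreeOn G S y ≠ 1) :
    HasTwoRootedColoring G (insert t S) r t := by
  obtain ⟨K, hK, hI⟩ := h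
  obtain ⟨K', hK', hhead⟩ := hK.exists_insert_one hG ht hy hN (absurd · hdy)
  refine ⟨K', hK', ?_, by
    rw [hhead t ((hN y hy).2 rfl).ne, hK.toIsColoringOn.headColors_eq_empty ht]⟩
  rw [hhead r hry, hI.resolve_right fun h => by have := h r hr; omega]

variable (G) in
/-- The claim that is proved by induction on `S`: rooted colorings exist for every root of degree
at most two, and for every two roots of degree one unless `S` induces a path between them. -/
def IsRootable (S : Finset V) : Prop :=
  (∀ r ∈ S, degreeOn G S r ≤ 2 → HasRootedColoring G S r) ∧
    ∀ r ∈ S, ∀ t ∈ S, r ≠ t → degreeOn G S r = 1 → degreeOn G S t = 1 →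
      (∃ v ∈ S, v ≠ r ∧ v ≠ t ∧ degreeOn G S v ≠ 2) → HasTwoRootedColoring G S r t

lemma IsConnectedOn.hasTwoRootedColoring (hG : ∀ v, G.degree v ≤ 3) (hS : IsConnectedOn G S)
    (ih : ∀ T ⊂ S, IsConnectedOn G T → IsRootable G T) (hr : r ∈ S) (ht : t ∈ S) (hrt : r ≠ t)
    (hdr : degreeOn G S r = 1) (hdt : degreeOn G S t = 1)
    (hv : ∃ v ∈ S, v ≠ r ∧ v ≠ t ∧ degreeOn G S v ≠ 2) : HasTwoRootedColoring G S r t := by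
  classical
  obtain ⟨v, hv, hvr, hvt, hdv⟩ := hv
  obtain ⟨y, hy, hN⟩ := exists_of_degreeOn_eq_one hdt
  have hty : G.Adj t y := (hN y hy).2 rfl
  have hry : r ≠ y := by
    rintro rfl
    obtain ⟨z, -, hzN⟩ := exists_of_degreeOn_eq_one hdr
    obtain rfl := (hzN t ht).1 hty.symm
    have := hS.eq_pair hr ht (fun x hx => (hzN x hx).1) fun x hx => (hN x hx).1
    simp [this, hvr, hvt] at hv
  have hye : y ∈ S.erase t := by simp [hy, hty.ne']
  have hre : r ∈ S.erase t := by simp [hr, hrt]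
  have hNe (x : V) (hx : x ∈ S.erase t) : G.Adj t x ↔ x = y := hN x (Finset.mem_of_mem_erase hx)
  have hdeg {x : V} (hx : x ∈ S) (hxy : x ≠ y) : degreeOn G (S.erase t) x = degreeOn G S x :=
    degreeOn_erase_of_not_adj fun h => hxy ((hN x hx).1 h.symm)
  obtain ⟨ih₁, ih₂⟩ := ih _ (Finset.erase_ssubset ht) (hS.erase_of_degreeOn_eq_one ht hy hN)
  rw [← Finset.insert_erase ht]
  by_cases hdy : degreeOn G (S.erase t) y = 1
  · have := degreeOn_erase_of_adj ht hty.symm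
    have hvy : v ≠ y := by
      rintro rfl
      omega
    refine (ih₂ r hre y hye hry ((hdeg hr hry).trans hdr) hdy ⟨v, ?_⟩).insert_one hG
      (S.notMem_erase t) hry hye hNe
    exact ⟨by simp [hv, hvt], hvr, hvy, by rwa [hdeg hv hvy]⟩
  · have hdr' := (hdeg hr hry).trans hdr
    exact (ih₁ r hre (by omega)).insert_second_root hG hre hdr' (S.notMem_erase t) hry hye hNe hdy

lemma IsConnectedOn.hasRootedColoring_of_erase [DecidableEq V] (hG : ∀ v, G.degree v ≤ 3)
    (hS : IsConnectedOn G (S.erase r)) (ih : IsRootable G (S.erase r)) (hr : r ∈ S)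
    (hz : z ∈ S.erase r) (hz' : z' ∈ S.erase r) (hne : z ≠ z')
    (hN : ∀ x ∈ S.erase r, G.Adj r x ↔ x = z ∨ x = z') (hd : degreeOn G S r = 2) :
    HasRootedColoring G S r := by
  have hrS := S.notMem_erase r
  have hd₁ {w : V} (hw : w ∈ S.erase r) (hrw : G.Adj r w) :
      degreeOn G (S.erase r) w + 1 = degreeOn G S w ∧ degreeOn G (S.erase r) w ≠ 0 ∧
        degreeOn G (S.erase r) w ≤ 2 := by
    have := degreeOn_erase_of_adj hr hrw.symm
    have := (degreeOn_le_degree S w).trans (hG w)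
    refine ⟨by omega, fun h => hne ?_, by omega⟩
    have := hS.eq_singleton hw h
    rw [this, Finset.mem_singleton] at hz hz'
    rw [hz, hz']
  have hdz := hd₁ hz ((hN z hz).2 (Or.inl rfl))
  have hdz' := hd₁ hz' ((hN z' hz').2 (Or.inr rfl))
  rw [← Finset.insert_erase hr]
  by_cases h2' : degreeOn G (S.erase r) z' = 2
  · exact (ih.1 z hz hdz.2.2).insert_two hG hrS hz hz' hne hN h2'
  by_cases h2 : degreeOn G (S.erase r) z = 2
  · exact (ih.1 z' hz' hdz'.2.2).insert_two hG hrS hz' hz hne.symm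
      (fun x hx => (hN x hx).trans or_comm) h2
  have h1 : degreeOn G (S.erase r) z = 1 := by omega
  have h1' : degreeOn G (S.erase r) z' = 1 := by omega
  by_cases hcyc : ∀ w ∈ S, degreeOn G S w = 2
  · exact (ih.1 z hz hdz.2.2).insert_cycle hG hrS hz hz' hne hN h1 h1'
      (by rwa [Finset.insert_erase hr])
  push Not at hcyc
  obtain ⟨v, hv, hdv⟩ := hcyc
  have hvr : v ≠ r := by rintro rfl; omega
  have hvz : v ≠ z := by rintro rfl; omega
  have hvz' : v ≠ z' := by rintro rfl; omega
  have hve : v ∈ S.erase r := by simp [hv, hvr]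
  refine (ih.2 z hz z' hz' hne h1 h1' ⟨v, hve, hvz, hvz', ?_⟩).insert_two hG hrS hz hz' hne hN
  rwa [degreeOn_erase_of_not_adj fun h => ((hN v hve).1 h.symm).elim hvz hvz']

lemma IsConnectedOn.hasRootedColoring (hG : ∀ v, G.degree v ≤ 3) (hS : IsConnectedOn G S)
    (ih : ∀ T ⊂ S, IsConnectedOn G T → IsRootable G T) (hr : r ∈ S) (hd : degreeOn G S r ≤ 2) :
    HasRootedColoring G S r := by
  classical
  have hrS := S.notMem_erase r
  have hssub := Finset.erase_ssubset hr
  have hdeg {w : V} (hrw : G.Adj r w) : degreeOn G (S.erase r) w ≤ 2 := by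
    have := degreeOn_erase_of_adj hr hrw.symm
    have := (degreeOn_le_degree S w).trans (hG w)
    omega
  obtain hd | hd | hd : degreeOn G S r = 0 ∨ degreeOn G S r = 1 ∨ degreeOn G S r = 2 := by omega
  · rw [hS.eq_singleton hr hd]
    exact ⟨_, ArcColoring.isGoodOn_of_forall_not_adj (by simp),
      Or.inl (ArcColoring.headColors_eq_empty (by simp))⟩
  · obtain ⟨z, hz, hN⟩ := exists_of_degreeOn_eq_one hd
    have hrz : G.Adj r z := (hN z hz).2 rfl
    have hze : z ∈ S.erase r := by simp [hz, hrz.ne']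
    rw [← Finset.insert_erase hr]
    exact ((ih _ hssub (hS.erase_of_degreeOn_eq_one hr hz hN)).1 z hze (hdeg hrz)).insert_one hG
      hrS hze fun x hx => hN x (Finset.mem_of_mem_erase hx)
  obtain ⟨z, hz, z', hz', hne, hN⟩ := exists_of_degreeOn_eq_two hd
  have hrz : G.Adj r z := (hN z hz).2 (Or.inl rfl)
  have hrz' : G.Adj r z' := (hN z' hz').2 (Or.inr rfl)
  have hNe (x : V) (hx : x ∈ S.erase r) := hN x (Finset.mem_of_mem_erase hx)
  by_cases hconn : IsConnectedOn G (S.erase r)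
  · exact hconn.hasRootedColoring_of_erase hG (ih _ hssub hconn) hr (by simp [hz, hrz.ne'])
      (by simp [hz', hrz'.ne']) hne hNe hd
  obtain ⟨A, B, hAB, hdis, hzA, hzB, hA, hB, hAc, hBc⟩ := hS.exists_split hr hz hN hconn
  have hAS : A ⊆ S.erase r := hAB ▸ Finset.subset_union_left
  have hBS : B ⊆ S.erase r := hAB ▸ Finset.subset_union_right
  rw [← Finset.insert_erase hr]
  refine HasRootedColoring.insert_union hG ?_ ?_ hAB hdis hAc hBc hrS hzA hzB hNe
  · exact (ih A (hAS.trans_ssubset hssub) hA).1 z hzA ((degreeOn_mono hAS z).trans (hdeg hrz))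
  · exact (ih B (hBS.trans_ssubset hssub) hB).1 z' hzB ((degreeOn_mono hBS z').trans (hdeg hrz'))

theorem IsConnectedOn.isRootable (hG : ∀ v, G.degree v ≤ 3) (hS : IsConnectedOn G S) :
    IsRootable G S := by
  classical
  induction S using Finset.strongInduction with
  | H S ih =>
    exact ⟨fun r hr => hS.hasRootedColoring hG ih hr,
      fun r hr t ht => hS.hasTwoRootedColoring hG ih hr ht⟩

end Rooted

section Light

variable {V : Type*} {G : SimpleGraph V} {S T : Finset V} {r s x : V}

variable (G) in
/-- Every component of the subgraph induced by `S` has a vertex of degree at most two. -/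
def IsLight (S : Finset V) : Prop :=
  ∀ T ⊆ S, T.Nonempty → IsClosedIn G S T → ∃ w ∈ T, degreeOn G S w ≤ 2

/-- The set `T` is a component of the subgraph induced by `S` and induces a cycle. -/
structure IsCycleComponent (G : SimpleGraph V) (S T : Finset V) : Prop where
  subset : T ⊆ S
  isClosedIn : IsClosedIn G S T
  isConnectedOn : IsConnectedOn G T
  degreeOn_eq_two : ∀ w ∈ T, degreeOn G S w = 2

lemma IsLight.sdiff [DecidableEq V] (h : IsLight G S) (hT : IsClosedIn G S T) : IsLight G
    (S \ T) := by
  intro U hU hne hcl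
  obtain ⟨w, hw, hd⟩ := h U (hU.trans Finset.sdiff_subset) hne (hT.sdiff.trans hcl hU)
  exact ⟨w, hw, by rwa [degreeOn_congr Finset.sdiff_subset hT.sdiff (hU hw)]⟩

lemma IsCycleComponent.degreeOn_erase [DecidableEq V] (hT : IsCycleComponent G S T) (hs : s ∈ T)
    (hx : x ∈ S) (hsx : G.Adj s x) : degreeOn G (S.erase s) x = 1 := by
  have := degreeOn_erase_of_adj (hT.subset hs) hsx.symm
  have := hT.degreeOn_eq_two x (hT.isClosedIn s hs x hx hsx)
  omega

lemma IsCycleComponent.not_isCycleComponent_erase [DecidableEq V] {U : Finset V}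
    (hT : IsCycleComponent G S T)
    (hs : s ∈ T) (hr : r ∈ T) (hrU : r ∈ U) : ¬ IsCycleComponent G (S.erase s) U := by
  intro hU
  have hn (x : V) (hx : x ∈ U) : ¬ G.Adj x s := fun hxs => by
    have := hT.degreeOn_erase hs (Finset.mem_of_mem_erase (hU.subset hx)) hxs.symm
    have := hU.degreeOn_eq_two x hx
    omega
  have := hT.isConnectedOn.2 (U ∩ T) Finset.inter_subset_right ⟨r, by simp [hr, hrU]⟩ <| by
    intro a ha b hb hab
    rw [Finset.mem_inter] at ha ⊢
    exact ⟨hU.isClosedIn.of_erase hn a ha.1 b (hT.subset hb) hab, hb⟩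
  exact S.notMem_erase s (hU.subset (Finset.mem_inter.1 (this ▸ hs)).1)

lemma isConnectedOn_univ [Fintype V] (h : G.Connected) : IsConnectedOn G Finset.univ := by
  obtain ⟨v⟩ := h.nonempty
  refine ⟨⟨v, Finset.mem_univ v⟩, fun T _ ⟨x, hx⟩ hcl => Finset.eq_univ_of_forall fun y => ?_⟩
  obtain ⟨p⟩ := h.preconnected x y
  induction p with
  | nil => exact hx
  | cons hadj _ ih => exact ih (hcl _ hx _ (Finset.mem_univ _) hadj)

variable [G.LocallyFinite]

lemma IsLight.erase [DecidableEq V] (hG : ∀ v, G.degree v ≤ 3) (h : IsLight G S) (hs : s ∈ S) :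
    IsLight G (S.erase s) := by
  intro U hU hne hcl
  by_cases hn : ∃ x ∈ U, G.Adj x s
  · obtain ⟨x, hx, hxs⟩ := hn
    have := degreeOn_erase_of_adj hs hxs
    have := (degreeOn_le_degree S x).trans (hG x)
    exact ⟨x, hx, by omega⟩
  · push Not at hn
    obtain ⟨w, hw, hd⟩ := h U (hU.trans (S.erase_subset s)) hne (hcl.of_erase hn)
    exact ⟨w, hw, (degreeOn_mono (S.erase_subset s) w).trans hd⟩

theorem IsLight.exists_isGoodOn (hG : ∀ v, G.degree v ≤ 3) (h : IsLight G S) :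
    ∃ K : ArcColoring V (Fin 8), K.IsGoodOn G S := by
  classical
  induction S using Finset.strongInduction with
  | H S ih =>
    obtain rfl | ⟨r, hr⟩ := S.eq_empty_or_nonempty
    · exact ⟨_, ArcColoring.isGoodOn_of_forall_not_adj (by simp)⟩
    obtain ⟨T, hTS, hrT, hcl, hconn⟩ := exists_component (G := G) S hr
    obtain ⟨w, hw, hd⟩ := h T hTS ⟨r, hrT⟩ hcl
    obtain ⟨K, hK, -⟩ := (hconn.isRootable hG).1 w hw ((degreeOn_mono hTS w).trans hd)
    obtain ⟨L, hL⟩ := ih (S \ T) (Finset.sdiff_ssubset hTS ⟨r, hrT⟩) (h.sdiff hcl)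
    obtain ⟨M, hM, -⟩ := hK.exists_union (Finset.union_sdiff_of_subset hTS) Finset.disjoint_sdiff
      hcl hcl.sdiff hL
    exact ⟨M, hM⟩

theorem IsLight.exists_isGoodOn_root (hG : ∀ v, G.degree v ≤ 3) (h : IsLight G S) (hr : r ∈ S)
    (hd : degreeOn G S r ≤ 2) : ∃ K : ArcColoring V (Fin 8), K.IsGoodOn G S ∧
      (K.headColors r = ∅ ∨ ∃ T, r ∈ T ∧ IsCycleComponent G S T) := by
  classical
  obtain ⟨T, hTS, hrT, hcl, hconn⟩ := exists_component (G := G) S hr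
  obtain ⟨K, hK, hI⟩ := (hconn.isRootable hG).1 r hrT ((degreeOn_mono hTS r).trans hd)
  obtain ⟨L, hL⟩ := (h.sdiff hcl).exists_isGoodOn hG
  obtain ⟨M, hM, hMT, -⟩ := hK.exists_union (Finset.union_sdiff_of_subset hTS)
    Finset.disjoint_sdiff hcl hcl.sdiff hL
  exact ⟨M, hM, hI.imp (hMT r hrT).trans fun hI =>
    ⟨T, hrT, hTS, hcl, hconn, fun w hw => (degreeOn_congr hTS hcl hw).symm.trans (hI w hw)⟩⟩

/-- If `r` lies on a cycle component, remove `s` from that cycle and give the two edges at `s` the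
designated end `s`. -/
theorem IsLight.exists_isColoringOn_root (hG : ∀ v, G.degree v ≤ 3) (h : IsLight G S)
    (hr : r ∈ S) (hd : degreeOn G S r ≤ 2) (hrs : r ≠ s)
    (hT : ∀ T, r ∈ T → IsCycleComponent G S T → s ∈ T) :
    ∃ K : ArcColoring V (Fin 8), K.IsColoringOn G S ∧ K.headColors r = ∅ ∧
      ∀ w ∈ S, w ≠ s → degreeOn G S w = 2 → (K.headColors w).card ≤ 1 := by
  classical
  obtain ⟨K, hK, hI | ⟨T, hrT, hTc⟩⟩ := h.exists_isGoodOn_root hG hr hd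
  · exact ⟨K, hK.toIsColoringOn, hI, fun w hw _ hd => hK.card_headColors_le_one w hw hd⟩
  clear K hK
  have hsT := hT T hrT hTc
  have hsS := hTc.subset hsT
  have hsn := S.notMem_erase s
  obtain ⟨u, hu, u', hu', huu, hN⟩ := exists_of_degreeOn_eq_two (hTc.degreeOn_eq_two s hsT)
  have hsu : G.Adj s u := (hN u hu).2 (Or.inl rfl)
  have hsu' : G.Adj s u' := (hN u' hu').2 (Or.inr rfl)
  have hue : u ∈ S.erase s := by simp [hu, hsu.ne']
  have hue' : u' ∈ S.erase s := by simp [hu', hsu'.ne']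
  obtain ⟨K, hK, hI⟩ := (h.erase hG hsS).exists_isGoodOn_root hG (r := r) (by simp [hr, hrs])
    ((degreeOn_mono (S.erase_subset s) r).trans hd)
  replace hI := hI.resolve_right fun ⟨U, hrU, hU⟩ => hTc.not_isCycleComponent_erase hsT hrT hrU hU
  have hd₁ (w : V) (hw : w ∈ S.erase s) (hsw : G.Adj s w) : degreeOn G (S.erase s) w = 1 :=
    hTc.degreeOn_erase hsT (Finset.mem_of_mem_erase hw) hsw
  have hforb := hK.card_forbidden_le_six hG hue hsu.symm hd₁
  have hforb' := hK.card_forbidden_le_six hG hue' hsu'.symm hd₁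
  obtain ⟨K', hK', hcol⟩ := hK.toIsColoringOn.exists_isExtension (Finset.subset_insert s _)
    ((ArcColoring.enumeratesNewEdges_insert_two hsn hue hue' huu fun x hx =>
      hN x (Finset.mem_of_mem_erase hx)).reorient (e' := ![(u, s), (u', s)])
      (by simp [Fin.forall_fin_two]))
    (Fin.forall_fin_two.2 ⟨by simp; omega, by simp; omega⟩)
  have hhead {w : V} (hw : w ≠ s) : K'.headColors w = K.headColors w :=
    hK'.headColors_eq (by simp [Fin.forall_fin_two, hw.symm])
  rw [Finset.insert_erase hsS] at hcol
  refine ⟨K', hcol, (hhead hrs).trans hI, fun w hw hws hdw => ?_⟩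
  rw [hhead hws]
  have hwe : w ∈ S.erase s := by simp [hw, hws]
  by_cases hsw : G.Adj s w
  · exact (hK.card_headColors_le w).trans_eq (hd₁ w hwe hsw)
  · exact hK.card_headColors_le_one w hwe <| by
      rw [degreeOn_erase_of_not_adj fun h => hsw h.symm, hdw]

theorem IsConnectedOn.isLight_sdiff [DecidableEq V] {X : Finset V} (hG : ∀ v, G.degree v ≤ 3)
    (hS : IsConnectedOn G S) (hX : X ⊆ S) (hne : X.Nonempty) : IsLight G (S \ X) := by
  intro T hT hTne hcl
  by_contra! h
  obtain ⟨x, hx⟩ := hne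
  have hTS := hS.2 T (hT.trans Finset.sdiff_subset) hTne fun a ha b hb hab => by
    refine hcl a ha b (Finset.mem_sdiff.2 ⟨hb, fun hbX => ?_⟩) hab
    have := degreeOn_insert_of_adj (S := S \ X) (by simp [hbX]) hab
    have := (degreeOn_le_degree (insert b (S \ X)) a).trans (hG a)
    have := h a ha
    omega
  exact (Finset.mem_sdiff.1 (hT (hTS ▸ hX hx))).2 hx

end Light

namespace ArcColoring

section Pendant

variable {V C ι : Type*} {G : SimpleGraph V} {K K' : ArcColoring V C} {e : ι → V × V}
  {S X T : Finset V} {u v x y p : V} {a : C}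

/-- `K` is a valid coloring of the edges inside `S` and of the edges joining `S` to `X`, the latter
with designated end in `S`. -/
structure IsPendantColoring (K : ArcColoring V C) (G : SimpleGraph V) (S X : Finset V) : Prop
    extends K.IsValid G where
  disjoint : Disjoint S X
  colored_iff : ∀ u v, (∃ a, K.HasColor u v a) ↔
    G.Adj u v ∧ (u ∈ S ∧ (v ∈ S ∨ v ∈ X) ∨ u ∈ X ∧ v ∈ S)
  head_mem : ∀ {u v a}, K u v a → v ∈ S

lemma IsColoringOn.isPendantColoring (hK : K.IsColoringOn G S) : K.IsPendantColoring G S ∅ where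
  toIsValid := hK.toIsValid
  disjoint := Finset.disjoint_empty_right S
  colored_iff := by simpa using hK.colored_iff
  head_mem h := hK.mem_right (Or.inl h)

lemma IsPendantColoring.mem_left (hK : K.IsPendantColoring G S X) (h : K.HasColor u v a) :
    u ∈ S ∨ u ∈ X := by
  have := ((hK.colored_iff u v).1 ⟨a, h⟩).2
  tauto

lemma IsPendantColoring.mem_right (hK : K.IsPendantColoring G S X) (h : K.HasColor u v a)
    (hu : u ∉ S) : v ∈ S := by
  have := ((hK.colored_iff u v).1 ⟨a, h⟩).2
  tauto

lemma IsPendantColoring.insert_of_forall_not_adj [DecidableEq V] (hK : K.IsPendantColoring G S X)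
    (hyS : y ∉ S) (hy : ∀ p ∈ S, ¬ G.Adj y p) : K.IsPendantColoring G S (insert y X) where
  toIsValid := hK.toIsValid
  disjoint := Finset.disjoint_insert_right.2 ⟨hyS, hK.disjoint⟩
  head_mem := hK.head_mem
  colored_iff u v := by
    rw [hK.colored_iff]
    refine and_congr_right fun huv => ?_
    have h₁ (h : v = y) : u ∉ S := fun hu => hy u hu (h ▸ huv.symm)
    have h₂ (h : u = y) : v ∉ S := fun hv => hy v hv (h ▸ huv)
    simp only [Finset.mem_insert]
    tauto

lemma IsPendantColoring.isColoringOn (hK : K.IsPendantColoring G S X) (h : K.IsExtension G e K')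
    (hS : S ⊆ T) (hX : X ⊆ T) (he : ∀ i, (e i).1 ∈ T ∧ (e i).2 ∈ T)
    (hex : ∀ u ∈ T, u ∉ S → ∀ v ∈ T, G.Adj u v → (v ∈ S → u ∉ X) →
      ∃ i, s((e i).1, (e i).2) = s(u, v)) : K'.IsColoringOn G T where
  toIsValid := h.toIsValid
  colored_iff u v := by
    rw [h.hasColor_iff, hK.colored_iff]
    constructor
    · rintro (⟨huv, ⟨hu, hv⟩ | ⟨hu, hv⟩⟩ | ⟨i, hi⟩)
      · exact ⟨huv, hS hu, hv.elim (@hS v) (@hX v)⟩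
      · exact ⟨huv, hX hu, hS hv⟩
      · obtain ⟨a, ha⟩ := h.colored i
        have hadj := h.adj ha
        obtain ⟨rfl, rfl⟩ | ⟨rfl, rfl⟩ := Sym2.eq_iff.1 hi
        exacts [⟨hadj, he i⟩, ⟨hadj.symm, (he i).symm⟩]
    · rintro ⟨huv, hu, hv⟩
      have h₁ (huS : u ∉ S) := hex u hu huS v hv huv
      have h₂ (hvS : v ∉ S) := Sym2.eq_swap (a := u) ▸ hex v hv hvS u hu huv.symm
      tauto

lemma IsPendantColoring.isFresh (hK : K.IsPendantColoring G S X)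
    (he : EnumeratesNewEdges G ∅ X e) : K.IsFresh G e where
  adj := he.adj
  uncolored i _ h := by
    have hX {w : V} (hw : w ∈ X) : w ∉ S := Finset.disjoint_right.1 hK.disjoint hw
    exact hX (he.mem i).2 (hK.mem_right h (hX (he.mem i).1))
  edge_injective := he.edge_injective

lemma IsPendantColoring.isColoringOn_univ [Fintype V] [DecidableEq V]
    (hK : K.IsPendantColoring G (Finset.univ \ X) X) (he : EnumeratesNewEdges G ∅ X e)
    (h : K.IsExtension G e K') : K'.IsColoringOn G Finset.univ :=
  hK.isColoringOn h (Finset.subset_univ _) (Finset.subset_univ _) (by simp)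
    fun u _ hu v _ huv huvX => he.exists_eq u (by simpa using hu) (by simp) v
      (by simp_all) huv

variable [Fintype C]

lemma IsPendantColoring.headColors_eq_empty (hK : K.IsPendantColoring G S X) (hx : x ∉ S) :
    K.headColors x = ∅ := ArcColoring.headColors_eq_empty fun _ _ h => hx (hK.head_mem h)

lemma IsPendantColoring.colorsAt_eq_empty (hK : K.IsPendantColoring G S X) (hx : x ∉ S)
    (h : ∀ p ∈ S, ¬ G.Adj x p) : K.colorsAt x = ∅ :=
  ArcColoring.colorsAt_eq_empty fun _ _ hp => h _ (hK.mem_right hp hx) (hK.adj_of_hasColor hp)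

lemma IsPendantColoring.colorsAt_eq_empty_of_notMem (hK : K.IsPendantColoring G S X) (hx : x ∉ S)
    (hxX : x ∉ X) : K.colorsAt x = ∅ :=
  ArcColoring.colorsAt_eq_empty fun _ _ h => (hK.mem_left h).elim hx hxX

lemma IsPendantColoring.colorsAt_subset (hK : K.IsPendantColoring G S X) (hx : x ∉ S)
    (hp : ∀ q ∈ S, G.Adj x q → q = p) : K.colorsAt x ⊆ K.headColors p := by
  intro a ha
  obtain ⟨q, hq⟩ := mem_colorsAt.1 ha
  obtain rfl := hp q (hK.mem_right hq hx) (hK.adj_of_hasColor hq)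
  exact mem_headColors.2 ⟨x, hq.resolve_right fun h => hx (hK.head_mem h)⟩

lemma IsPendantColoring.card_colorsAt_le_one (hK : K.IsPendantColoring G S X) (hx : x ∉ S)
    (hp : ∀ q ∈ S, G.Adj x q → q = p) : (K.colorsAt x).card ≤ 1 :=
  hK.toIsValid.card_colorsAt_le {p} fun q _ hq =>
    Finset.mem_singleton.2 (hp q (hK.mem_right hq hx) (hK.adj_of_hasColor hq))

lemma IsPendantColoring.forbidden_subset (hK : K.IsPendantColoring G S X) {F : Finset C}
    (hu : K.colorsAt u ⊆ F) (hv : ∀ w, w ≠ u → G.Adj v w → K.colorsAt w ⊆ F)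
    (hh : ∀ w ∈ S, w ≠ v → G.Adj u w → K.headColors w ⊆ F) : K.forbidden G u v ⊆ F := by
  refine ArcColoring.forbidden_subset hu hv fun w hw huw => ?_
  by_cases hwS : w ∈ S
  exacts [hh w hwS hw huw, by simp [hK.headColors_eq_empty hwS]]

section Insert

variable (hK : K.IsPendantColoring G S X) (hyS : y ∉ S) (hyX : y ∉ X) (hpS : p ∈ S)
  (hyp : G.Adj y p) (hp : ∀ q ∈ S, G.Adj y q → q = p)

include hK hyS hyX hyp in
lemma IsPendantColoring.isExtension_pendant (ha : a ∉ K.forbidden G y p) :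
    K.IsExtension G (Function.const Unit (y, p))
      (K.addArcs (Function.const Unit (y, p)) (Function.const Unit a)) :=
  IsFresh.isExtension_addArcs
    ⟨fun _ => hyp, fun _ _ h => (hK.mem_left h).elim hyS hyX, Function.injective_of_subsingleton _⟩
    hK.toIsValid (Function.injective_of_subsingleton _) fun _ => ha

include hK hyS hyX hpS hyp hp

lemma IsPendantColoring.insert_pendant [DecidableEq V] (ha : a ∉ K.forbidden G y p) :
    (K.addArcs (Function.const Unit (y, p)) (Function.const Unit a)).IsPendantColoring G S
      (insert y X) := by
  have hE := hK.isExtension_pendant hyS hyX hyp ha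
  refine ⟨hE.toIsValid, Finset.disjoint_insert_right.2 ⟨hyS, hK.disjoint⟩, fun u v => ?_, ?_⟩
  · rw [hE.hasColor_iff, hK.colored_iff]
    simp only [Function.const_apply, exists_const, Sym2.eq_iff, Finset.mem_insert]
    constructor
    · rintro (h | ⟨rfl, rfl⟩ | ⟨rfl, rfl⟩)
      exacts [⟨h.1, by tauto⟩, ⟨hyp, by tauto⟩, ⟨hyp.symm, by tauto⟩]
    · rintro ⟨huv, ⟨hu, hv | rfl | hv⟩ | ⟨rfl | hu, hv⟩⟩
      exacts [Or.inl ⟨huv, by tauto⟩, Or.inr (Or.inr ⟨rfl, (hp u hu huv.symm).symm⟩),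
        Or.inl ⟨huv, by tauto⟩, Or.inr (Or.inl ⟨rfl, (hp v hv huv).symm⟩), Or.inl ⟨huv, by tauto⟩]
  · rintro u v b (h | ⟨_, ⟨⟩, _⟩)
    exacts [hK.head_mem h, hpS]

omit hpS in
lemma IsPendantColoring.card_forbidden_pendant_le [G.LocallyFinite] (hG : ∀ v, G.degree v ≤ 3) :
    (K.forbidden G y p).card ≤ 6 := by
  have := card_forbidden_le (K := K) (k := 3) (H := ∅) hG hyp
    (fun w _ => hK.toIsValid.card_colorsAt_le_three hG w) fun w hw hyw => ?_
  · simpa [hK.colorsAt_eq_empty_of_notMem hyS hyX] using this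
  · rw [hK.headColors_eq_empty fun hwS => hw (hp w hwS hyw)]

end Insert

lemma card_headColors_addArcs_le (K : ArcColoring V C) (y p : V) (a : C) :
    ((K.addArcs (Function.const Unit (y, p)) (Function.const Unit a)).headColors p).card ≤
      (K.headColors p).card + 1 := by
  classical
  refine (Finset.card_le_card fun b hb => ?_).trans (Finset.card_insert_le a _)
  obtain ⟨z, hz | ⟨-, -, rfl⟩⟩ := mem_headColors.1 hb
  exacts [Finset.mem_insert_of_mem (mem_headColors.2 ⟨z, hz⟩), Finset.mem_insert_self _ _]

theorem IsColoringOn.exists_isPendantColoring [G.LocallyFinite] (hG : ∀ v, G.degree v ≤ 3)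
    (hC : 6 < Fintype.card C) (hK : K.IsColoringOn G S) (hd : Disjoint S X)
    (hX : ∀ x ∈ X, ∃ p, ∀ q ∈ S, G.Adj x q → q = p) :
    ∃ K' : ArcColoring V C, K'.IsPendantColoring G S X ∧
      ∀ p, (K'.headColors p).card ≤ (K.headColors p).card + degreeOn G X p := by
  classical
  induction X using Finset.induction_on with
  | empty => exact ⟨K, hK.isPendantColoring, fun p => Nat.le_add_right _ _⟩
  | insert y X hyX ih =>
    obtain ⟨hyS, hd⟩ := Finset.disjoint_insert_right.1 hd
    obtain ⟨K', hK', hhead⟩ := ih hd fun x hx => hX x (Finset.mem_insert_of_mem hx)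
    by_cases hy : ∀ p ∈ S, ¬ G.Adj y p
    · exact ⟨K', hK'.insert_of_forall_not_adj hyS hy, fun p => (hhead p).trans
        (Nat.add_le_add_left (degreeOn_mono (Finset.subset_insert y X) p) _)⟩
    push Not at hy
    obtain ⟨p, hpS, hyp⟩ := hy
    have hp : ∀ q ∈ S, G.Adj y q → q = p := by
      obtain ⟨p', hp'⟩ := hX y (Finset.mem_insert_self y X)
      exact fun q hq hyq => (hp' q hq hyq).trans (hp' p hpS hyp).symm
    have hcard := hK'.card_forbidden_pendant_le hyS hyX hyp hp hG
    obtain ⟨a, ha⟩ := Finset.exists_mem_notMem_of_card_lt_card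
      (hcard.trans_lt hC : _ < (Finset.univ : Finset C).card)
    refine ⟨_, hK'.insert_pendant hyS hyX hpS hyp hp ha.2, fun q => ?_⟩
    obtain rfl | hqp := eq_or_ne q p
    · have := card_headColors_addArcs_le K' y q a
      have := hhead q
      rw [degreeOn_insert_of_adj hyX hyp.symm]
      omega
    · rw [(hK'.isExtension_pendant hyS hyX hyp ha.2).headColors_eq fun _ => hqp.symm]
      exact (hhead q).trans (Nat.add_le_add_left (degreeOn_mono (Finset.subset_insert y X) q) _)

theorem exists_isPendantColoring [Fintype V] [DecidableEq V] [G.LocallyFinite]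
    (hG : ∀ v, G.degree v ≤ 3) (hc : IsConnectedOn G Finset.univ) (hne : X.Nonempty)
    (hX : ∀ x ∈ X, ∃ p, ∀ q ∉ X, G.Adj x q → q = p) :
    ∃ K : ArcColoring V (Fin 8), K.IsPendantColoring G (Finset.univ \ X) X := by
  obtain ⟨K, hK⟩ := (hc.isLight_sdiff hG (Finset.subset_univ X) hne).exists_isGoodOn hG
  obtain ⟨K', hK', -⟩ := hK.exists_isPendantColoring hG (by simp) Finset.sdiff_disjoint
    (by simpa using hX)
  exact ⟨K', hK'⟩

theorem IsPendantColoring.exists_isColoringOn_univ [Fintype V] [DecidableEq V] {n : ℕ}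
    {e : Fin n → V × V} (hK : K.IsPendantColoring G (Finset.univ \ X) X)
    (he : EnumeratesNewEdges G ∅ X e) {F : Fin n → Finset C}
    (hF : ∀ i, K.forbidden G (e i).1 (e i).2 ⊆ F i)
    (h : ∀ i, (F i).card + i < Fintype.card C) :
    ∃ K' : ArcColoring V C, K'.IsColoringOn G Finset.univ :=
  let ⟨_, _, _, hK'⟩ := (hK.isFresh he).exists_addArcs hK.toIsValid hF h
  ⟨_, hK.isColoringOn_univ he hK'⟩

end Pendant

end ArcColoring

open ArcColoring

section CycleComponent

variable {V : Type*} {G : SimpleGraph V} {S T : Finset V} {w : V}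

lemma IsCycleComponent.two_lt_card (h : IsCycleComponent G S T) : 2 < T.card := by
  classical
  obtain ⟨w, hw⟩ := h.isConnectedOn.1
  have hdeg := h.degreeOn_eq_two w hw
  have hle := degreeOn_le_card (X := T.erase w) fun x hx hwx =>
    Finset.mem_erase.2 ⟨hwx.ne', h.isClosedIn w hw x hx hwx⟩
  rw [Finset.card_erase_of_mem hw] at hle
  omega

lemma IsCycleComponent.exists_adj_notMem [G.LocallyFinite] (h : IsCycleComponent G S T)
    (hw : w ∈ T) (hd : G.degree w = 3) : ∃ x ∉ S, G.Adj w x :=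
  degreeOn_lt_degree_iff.1 (by simp [hd, h.degreeOn_eq_two w hw])

end CycleComponent

lemma card_union_union_le {α : Type*} [DecidableEq α] (A B C : Finset α) :
    (A ∪ B ∪ C).card ≤ A.card + B.card + C.card :=
  (Finset.card_union_le _ _).trans (Nat.add_le_add_right (Finset.card_union_le _ _) _)

section Configurations

variable {V : Type*} [Fintype V] {G : SimpleGraph V} [G.LocallyFinite]

theorem exists_isColoringOn_univ_of_complete (hG : ∀ v, G.degree v ≤ 3)
    (hc : IsConnectedOn G Finset.univ) {u v c₁ c₂ : V}
    (hu : ∀ x, G.Adj u x ↔ x = v ∨ x = c₁ ∨ x = c₂)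
    (hv : ∀ x, G.Adj v x ↔ x = u ∨ x = c₁ ∨ x = c₂)
    (h₁ : ∀ x, G.Adj c₁ x ↔ x = u ∨ x = v ∨ x = c₂)
    (h₂ : ∀ x, G.Adj c₂ x ↔ x = u ∨ x = v ∨ x = c₁) :
    ∃ K : ArcColoring V (Fin 8), K.IsColoringOn G Finset.univ := by
  classical
  let X : Finset V := {u, v, c₁, c₂}
  have hX : ∀ x ∈ X, ∀ q, G.Adj x q → q ∈ X := by
    simp only [X, Finset.mem_insert, Finset.mem_singleton]
    rintro x (rfl | rfl | rfl | rfl) q hq <;> simp_all <;> tauto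
  obtain ⟨K, hK⟩ := exists_isPendantColoring hG hc (X := X) ⟨u, by simp [X]⟩ fun x hx =>
    ⟨x, fun q hq h => absurd (hX x hx q h) hq⟩
  have hempty (x : V) (hx : x ∈ X) : K.colorsAt x = ∅ :=
    hK.colorsAt_eq_empty (by simpa using hx) fun q hq h => by simp [hX x hx q h] at hq
  have huv := ((hu v).2 (by simp)).ne
  have hu₁ := ((hu c₁).2 (by simp)).ne
  have hu₂ := ((hu c₂).2 (by simp)).ne
  have hv₁ := ((hv c₁).2 (by simp)).ne
  have hv₂ := ((hv c₂).2 (by simp)).ne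
  have h₁₂ := ((h₁ c₂).2 (by simp)).ne
  have he : EnumeratesNewEdges G ∅ X
      ![(u, v), (u, c₁), (u, c₂), (v, c₁), (v, c₂), (c₁, c₂)] := by
    refine ⟨?_, ?_, by simp, ?_, ?_⟩
    · simp [Fin.forall_fin_succ, hu, hv, h₁]
    · simp [Fin.forall_fin_succ, X]
    · rw [← List.nodup_ofFn]
      simp [*, Ne.symm]
    · simp [Fin.exists_fin_succ, X, hu, hv, h₁, h₂]
  refine hK.exists_isColoringOn_univ he (F := fun _ => ∅) (fun i => ?_) (by simp; omega)
  refine hK.forbidden_subset (hempty _ (he.mem i).1).le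
    (fun w _ hw => (hempty w (hX _ (he.mem i).2 w hw)).le) fun w hw _ h => ?_
  simp [hX _ (he.mem i).1 w h] at hw

theorem exists_isColoringOn_univ_of_diamond (hG : ∀ v, G.degree v ≤ 3)
    (hc : IsConnectedOn G Finset.univ) {u v c₁ c₂ p₁ p₂ : V} (hne : c₁ ≠ c₂)
    (hu : ∀ x, G.Adj u x ↔ x = v ∨ x = c₁ ∨ x = c₂)
    (hv : ∀ x, G.Adj v x ↔ x = u ∨ x = c₁ ∨ x = c₂)
    (h₁ : ∀ x, G.Adj c₁ x ↔ x = u ∨ x = v ∨ x = p₁)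
    (h₂ : ∀ x, G.Adj c₂ x ↔ x = u ∨ x = v ∨ x = p₂)
    (hp₁ : p₁ ≠ c₂) (hp₂ : p₂ ≠ c₁) :
    ∃ K : ArcColoring V (Fin 8), K.IsColoringOn G Finset.univ := by
  classical
  let X : Finset V := {u, v, c₁, c₂}
  obtain ⟨K, hK⟩ := exists_isPendantColoring hG hc (X := X) ⟨u, by simp [X]⟩ (by
    simp only [X, Finset.mem_insert, Finset.mem_singleton]
    rintro x (rfl | rfl | rfl | rfl)
    exacts [⟨x, by grind⟩, ⟨x, by grind⟩, ⟨p₁, by grind⟩, ⟨p₂, by grind⟩])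
  have huv := ((hu v).2 (by simp)).ne
  have hu₁ := ((hu c₁).2 (by simp)).ne
  have hu₂ := ((hu c₂).2 (by simp)).ne
  have hv₁ := ((hv c₁).2 (by simp)).ne
  have hv₂ := ((hv c₂).2 (by simp)).ne
  have he : EnumeratesNewEdges G ∅ X ![(u, c₁), (v, c₁), (u, c₂), (v, c₂), (u, v)] := by
    refine ⟨?_, ?_, by simp, ?_, ?_⟩
    · simp [Fin.forall_fin_succ, hu, hv]
    · simp [Fin.forall_fin_succ, X]
    · rw [← List.nodup_ofFn]
      simp [*, Ne.symm]
    · simp [Fin.exists_fin_succ, X, hu, hv, h₁, h₂, hne, hne.symm, hp₁.symm, hp₂.symm,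
        hu₁.symm, hu₂.symm, hv₁.symm, hv₂.symm]
  have hcu : K.colorsAt u = ∅ := hK.colorsAt_eq_empty (by simp [X]) (by grind)
  have hcv : K.colorsAt v = ∅ := hK.colorsAt_eq_empty (by simp [X]) (by grind)
  have hc₁ := hK.card_colorsAt_le_one (x := c₁) (p := p₁) (by simp [X]) (by grind)
  have hc₂ := hK.card_colorsAt_le_one (x := c₂) (p := p₂) (by simp [X]) (by grind)
  have hd₁ := hK.toIsValid.card_colorsAt_le_three hG p₁
  have hd₂ := hK.toIsValid.card_colorsAt_le_three hG p₂
  have hc₁₂ := Finset.card_union_le (K.colorsAt c₁) (K.colorsAt c₂)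
  refine hK.exists_isColoringOn_univ he (F := ![K.colorsAt p₁, K.colorsAt p₁, K.colorsAt p₂,
    K.colorsAt p₂, K.colorsAt c₁ ∪ K.colorsAt c₂]) (fun i => ?_) ?_
  · fin_cases i <;> apply hK.forbidden_subset <;> dsimp <;> grind
  · simp [Fin.forall_fin_succ]
    omega

section Triangle

variable {r y₁ y₂ d₀ d₁ d₂ : V} (hr : ∀ x, G.Adj r x ↔ x = y₁ ∨ x = y₂ ∨ x = d₀)
  (h₁ : ∀ x, G.Adj y₁ x ↔ x = r ∨ x = y₂ ∨ x = d₁) (h₂ : ∀ x, G.Adj y₂ x ↔ x = r ∨ x = y₁ ∨ x = d₂)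
  (h01 : d₀ ≠ d₁) (h02 : d₀ ≠ d₂) (hd₀ : d₀ ≠ y₁ ∧ d₀ ≠ y₂)

include hr h₁ h₂ h01 h02 hd₀

lemma exists_isPendantColoring_of_triangle [DecidableEq V] (hd : ∀ v, G.degree v = 3)
    (hc : IsConnectedOn G Finset.univ) : ∃ K : ArcColoring V (Fin 8),
      K.IsPendantColoring G (Finset.univ \ {r, y₁, y₂}) {r, y₁, y₂} ∧
        (K.headColors d₀).card ≤ 1 := by
  have hG : ∀ v, G.degree v ≤ 3 := fun v => (hd v).le
  let X : Finset V := {r, y₁, y₂}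
  have hrd := (hr d₀).2 (by simp)
  have hd₀X : d₀ ∉ X := by
    have := hrd.ne
    grind
  have hX : ∀ x ∈ X, ∃ p, ∀ q ∈ Finset.univ \ X, G.Adj x q → q = p := by
    simp only [X, Finset.mem_insert, Finset.mem_singleton]
    rintro x (rfl | rfl | rfl)
    exacts [⟨d₀, by grind⟩, ⟨d₁, by grind⟩, ⟨d₂, by grind⟩]
  have hdeg : degreeOn G (Finset.univ \ X) d₀ < G.degree d₀ :=
    degreeOn_lt_degree_iff.2 ⟨r, by simp [X], hrd.symm⟩
  have hcycle (T : Finset V) (hT : IsCycleComponent G (Finset.univ \ X) T) : d₂ ∈ T := by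
    have hTd : T ⊆ {d₀, d₁, d₂} := fun w hw => by
      obtain ⟨x, hx, hwx⟩ := hT.exists_adj_notMem hw (hd w)
      have hwX := hT.subset hw
      have := hwx.symm
      grind
    have := hT.two_lt_card
    rw [Finset.eq_of_subset_of_card_le hTd (Finset.card_le_three.trans this)]
    simp
  obtain ⟨K₀, hK₀, hroot, -⟩ := (hc.isLight_sdiff hG (Finset.subset_univ X)
    ⟨r, by simp [X]⟩).exists_isColoringOn_root hG (by simpa using hd₀X)
      (Nat.le_of_lt_succ (hdeg.trans_eq (hd d₀))) h02 fun T _ hT => hcycle T hT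
  obtain ⟨K, hK, hhead⟩ := hK₀.exists_isPendantColoring hG (by simp) Finset.sdiff_disjoint hX
  have hdX : degreeOn G X d₀ ≤ ({r} : Finset V).card := degreeOn_le_card fun x hx hdx => by
    have := hdx.symm
    grind
  exact ⟨K, hK, (hhead d₀).trans (by simpa [hroot] using hdX)⟩

theorem exists_isColoringOn_univ_of_triangle (hd : ∀ v, G.degree v = 3)
    (hc : IsConnectedOn G Finset.univ) (hd₁ : d₁ ≠ r ∧ d₁ ≠ y₂) (hd₂ : d₂ ≠ r ∧ d₂ ≠ y₁) :
    ∃ K : ArcColoring V (Fin 8), K.IsColoringOn G Finset.univ := by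
  classical
  obtain ⟨K, hK, hhd₀⟩ := exists_isPendantColoring_of_triangle hr h₁ h₂ h01 h02 hd₀ hd hc
  have hr₁ := ((hr y₁).2 (by simp)).ne
  have hr₂ := ((hr y₂).2 (by simp)).ne
  have hy := ((h₁ y₂).2 (by simp)).ne
  have he : EnumeratesNewEdges G ∅ {r, y₁, y₂} ![(y₁, y₂), (r, y₁), (r, y₂)] := by
    refine ⟨?_, ?_, by simp, ?_, ?_⟩
    · simp [Fin.forall_fin_succ, hr, h₁]
    · simp [Fin.forall_fin_succ]
    · rw [← List.nodup_ofFn]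
      simp [*, Ne.symm]
    · simp [Fin.exists_fin_succ, hr, h₁, h₂, hr₁, hr₁.symm, hr₂, hr₂.symm, hy, hy.symm,
        hd₀.1.symm, hd₀.2.symm, hd₁.1.symm, hd₁.2.symm, hd₂.1.symm, hd₂.2.symm]
  have hcr := hK.card_colorsAt_le_one (x := r) (p := d₀) (by simp) (by grind)
  have hc₁ := hK.card_colorsAt_le_one (x := y₁) (p := d₁) (by simp) (by grind)
  have hc₂ := hK.card_colorsAt_le_one (x := y₂) (p := d₂) (by simp) (by grind)
  have hs₀ := hK.colorsAt_subset (x := r) (p := d₀) (by simp) (by grind)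
  have hs₁ := hK.colorsAt_subset (x := y₁) (p := d₁) (by simp) (by grind)
  have hcd₁ := hK.toIsValid.card_colorsAt_le_three (fun v => (hd v).le) d₁
  have hcd₂ := hK.toIsValid.card_colorsAt_le_three (fun v => (hd v).le) d₂
  have hhead := K.headColors_subset_colorsAt d₁
  have h8 := Fintype.card_fin 8
  refine hK.exists_isColoringOn_univ he (F := ![K.colorsAt d₁ ∪ K.colorsAt r ∪ K.colorsAt d₂,
    K.headColors d₀ ∪ K.colorsAt y₂ ∪ K.colorsAt d₁,
    K.headColors d₀ ∪ K.colorsAt y₁ ∪ K.colorsAt d₂]) (fun i => ?_) fun i => ?_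
  · fin_cases i <;> apply hK.forbidden_subset <;> dsimp <;> grind
  · fin_cases i <;> refine (Nat.add_le_add_right (card_union_union_le _ _ _) _).trans_lt ?_ <;>
      dsimp <;> omega

end Triangle

end Configurations

section OnePendant

variable {V C : Type*} [Fintype C] {G : SimpleGraph V} [G.LocallyFinite] {S X : Finset V}
  {y p q : V}

lemma ArcColoring.mem_colorsAt_addArcs_const {K : ArcColoring V C} {a b : C} :
    b ∈ (K.addArcs (Function.const Unit (y, p)) (Function.const Unit a)).colorsAt p ↔
      b ∈ K.colorsAt p ∨ a = b := by
  simp [mem_colorsAt, hasColor_addArcs, exists_or]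

theorem ArcColoring.IsPendantColoring.exists_insert_colorsAt_ne [DecidableEq V]
    {K : ArcColoring V C} (hK : K.IsPendantColoring G S X) (hG : ∀ v, G.degree v ≤ 3)
    (hC : 7 < Fintype.card C) (hyS : y ∉ S) (hyX : y ∉ X) (hpS : p ∈ S) (hyp : G.Adj y p)
    (hp : ∀ q ∈ S, G.Adj y q → q = p) (hqy : q ≠ y) (hqp : q ≠ p) :
    ∃ K' : ArcColoring V C, K'.IsPendantColoring G S (insert y X) ∧
      K'.colorsAt q ≠ K'.colorsAt p := by
  classical
  have hcard := hK.card_forbidden_pendant_le hyS hyX hyp hp hG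
  obtain ⟨a, ha, b, hb, hab⟩ : ∃ a ∈ (K.forbidden G y p)ᶜ, ∃ b ∈ (K.forbidden G y p)ᶜ, a ≠ b := by
    refine Finset.one_lt_card.1 ?_
    rw [Finset.card_compl]
    omega
  rw [Finset.mem_compl] at ha hb
  by_contra! hne
  have hqa := hne _ (hK.insert_pendant hyS hyX hpS hyp hp ha)
  have hqb := hne _ (hK.insert_pendant hyS hyX hpS hyp hp hb)
  have hq : ∀ i, (Function.const Unit (y, p) i).1 ≠ q ∧ (Function.const Unit (y, p) i).2 ≠ q := by
    simp [hqy.symm, hqp.symm]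
  rw [(hK.isExtension_pendant hyS hyX hyp ha).colorsAt_eq hq] at hqa
  rw [(hK.isExtension_pendant hyS hyX hyp hb).colorsAt_eq hq] at hqb
  have hbp := mem_colorsAt_addArcs_const.1 (hqa ▸ hqb ▸ mem_colorsAt_addArcs_const.2 (Or.inr rfl))
  refine hbp.elim (fun h => ?_) hab
  obtain ⟨z, hz⟩ := mem_colorsAt.1 h
  have hzy : z ≠ y := by
    rintro rfl
    exact (hK.mem_left hz.symm).elim hyS hyX
  exact not_hasColor_of_adj_head hb (hK.toIsValid.adj_of_hasColor hz) hzy p hz.symm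

end OnePendant

section CompleteBipartite

variable {V : Type*} [Fintype V] {G : SimpleGraph V} [G.LocallyFinite] (hG : ∀ v, G.degree v ≤ 3)
  {x x' c₁ c₂ c₃ p₁ p₂ p₃ : V} (h13 : c₁ ≠ c₃) (h23 : c₂ ≠ c₃)
  (hx : ∀ w, G.Adj x w ↔ w = c₁ ∨ w = c₂ ∨ w = c₃)
  (hx' : ∀ w, G.Adj x' w ↔ w = c₁ ∨ w = c₂ ∨ w = c₃)
  (hc₁ : ∀ w, G.Adj c₁ w ↔ w = x ∨ w = x' ∨ w = p₁)
  (hc₂ : ∀ w, G.Adj c₂ w ↔ w = x ∨ w = x' ∨ w = p₂)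
  (hc₃ : ∀ w, G.Adj c₃ w ↔ w = x ∨ w = x' ∨ w = p₃)
  (hp₁ : p₁ ≠ c₂ ∧ p₁ ≠ c₃) (hp₃ : p₃ ≠ x ∧ p₃ ≠ x' ∧ p₃ ≠ c₁ ∧ p₃ ≠ c₂) (h31 : p₁ ≠ p₃)

include hG h13 h23 hx hx' hc₁ hc₂ hc₃ hp₁ hp₃ h31

lemma exists_isPendantColoring_of_completeBipartite [DecidableEq V]
    (hc : IsConnectedOn G Finset.univ) : ∃ K : ArcColoring V (Fin 8),
      K.IsPendantColoring G (Finset.univ \ {c₃, x, x', c₁, c₂}) {c₃, x, x', c₁, c₂} ∧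
        K.colorsAt p₁ ≠ K.colorsAt p₃ := by
  let Y : Finset V := {x, x', c₁, c₂}
  have hx₃ := ((hx c₃).2 (by simp)).ne
  have hx₃' := ((hx' c₃).2 (by simp)).ne
  have hcp := (hc₃ p₃).2 (by simp)
  have hcp' := hcp.ne
  have hX (q : V) : q ∈ Finset.univ \ insert c₃ Y ↔
      q ≠ c₃ ∧ q ≠ x ∧ q ≠ x' ∧ q ≠ c₁ ∧ q ≠ c₂ := by
    simp [Y]
  obtain ⟨K₀, hK₀⟩ := (hc.isLight_sdiff hG (Finset.subset_univ (insert c₃ Y)) (by simp))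
    |>.exists_isGoodOn hG
  obtain ⟨K, hK, -⟩ := hK₀.toIsColoringOn.exists_isPendantColoring (X := Y) hG (by simp)
    (Finset.sdiff_disjoint.mono_right (Finset.subset_insert _ _)) (by
      simp only [Y, Finset.mem_insert, Finset.mem_singleton]
      rintro w (rfl | rfl | rfl | rfl)
      exacts [⟨w, by grind⟩, ⟨w, by grind⟩, ⟨p₁, by grind⟩, ⟨p₂, by grind⟩])
  exact hK.exists_insert_colorsAt_ne hG (by simp) (by simp) (by grind) (by grind) hcp (by grind)
    hp₁.2 h31

theorem exists_isColoringOn_univ_of_completeBipartite (hc : IsConnectedOn G Finset.univ)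
    (hxx : x ≠ x') (h12 : c₁ ≠ c₂) (hp₂ : p₂ ≠ c₁ ∧ p₂ ≠ c₃) :
    ∃ K : ArcColoring V (Fin 8), K.IsColoringOn G Finset.univ := by
  classical
  obtain ⟨K, hK, hne⟩ :=
    exists_isPendantColoring_of_completeBipartite hG h13 h23 hx hx' hc₁ hc₂ hc₃ hp₁ hp₃ h31 hc
  have hx₁ := ((hx c₁).2 (by simp)).ne
  have hx₂ := ((hx c₂).2 (by simp)).ne
  have hx₃ := ((hx c₃).2 (by simp)).ne
  have hx₁' := ((hx' c₁).2 (by simp)).ne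
  have hx₂' := ((hx' c₂).2 (by simp)).ne
  have hx₃' := ((hx' c₃).2 (by simp)).ne
  have he : EnumeratesNewEdges G ∅ {c₃, x, x', c₁, c₂}
      ![(x, c₁), (x', c₁), (x, c₂), (x', c₂), (x, c₃), (x', c₃)] := by
    refine ⟨?_, ?_, by simp, ?_, ?_⟩
    · simp [Fin.forall_fin_succ, hx, hx']
    · simp [Fin.forall_fin_succ]
    · rw [← List.nodup_ofFn]
      simp [*, Ne.symm]
    · simp [Fin.exists_fin_succ, *, Ne.symm]
  have hcx : K.colorsAt x = ∅ := hK.colorsAt_eq_empty (by simp) (by grind)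
  have hcx' : K.colorsAt x' = ∅ := hK.colorsAt_eq_empty (by simp) (by grind)
  have hcard := hK.toIsValid.card_colorsAt_le_three hG
  have hinter : (K.colorsAt p₁ ∩ K.colorsAt p₃).card ≤ 2 := by
    by_contra! h
    have := hcard p₁
    have := hcard p₃
    exact hne ((Finset.eq_of_subset_of_card_le Finset.inter_subset_left (by omega)).symm.trans
      (Finset.eq_of_subset_of_card_le Finset.inter_subset_right (by omega)))
  obtain ⟨f, -, -, hE⟩ := (hK.isFresh he).exists_addArcs_of_card_inter_le hK.toIsValid
    (F := ![K.colorsAt p₁, K.colorsAt p₁, K.colorsAt p₂, K.colorsAt p₂, K.colorsAt p₃,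
      K.colorsAt p₃])
    (fun i => by fin_cases i <;> apply hK.forbidden_subset <;> dsimp <;> grind)
    (by simp [Fin.forall_fin_succ, hcard]) (i := 0) (j := 4)
    (by simpa using Nat.add_le_add_right hinter 6)
  exact ⟨_, hK.isColoringOn_univ he hE⟩

end CompleteBipartite

section Cycle

variable {V : Type*} {G : SimpleGraph V} {k i j : ℕ} {c d : ℕ → V}

variable (G) in
/-- An induced cycle `c 0, …, c (k - 1)` in a cubic graph; `d i` is the neighbor of `c i` off the
cycle. These neighbors are distinct, and `d 0` can be adjacent only to the first of them. -/
structure RootedCycle (k : ℕ) (c d : ℕ → V) : Prop where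
  four_le : 4 ≤ k
  injOn : ∀ i j, i < k → j < k → c i = c j → i = j
  periodic : c k = c 0
  adj_zero : ∀ x, G.Adj (c 0) x ↔ x = c 1 ∨ x = c (k - 1) ∨ x = d 0
  adj_succ : ∀ i, i + 1 < k → ∀ x,
    G.Adj (c (i + 1)) x ↔ x = c i ∨ x = c (i + 2) ∨ x = d (i + 1)
  off_cycle : ∀ i j, i < k → j < k → d i ≠ c j
  off_injOn : ∀ i j, i < k → j < k → d i = d j → i = j
  le_three_of_adj : ∀ j, j < k → G.Adj (d 0) (d j) → j ≤ 3

lemma RootedCycle.ne (h : RootedCycle G k c d) (hi : i < k) (hj : j < k) (hij : i ≠ j) :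
    c i ≠ c j := fun H => hij (h.injOn i j hi hj H)

lemma RootedCycle.eq_of_adj (h : RootedCycle G k c d) (hi : i < k) (hj : j < k)
    (hadj : G.Adj (d i) (c j)) : i = j := by
  have hk := h.four_le
  rcases j with _ | j
  · rcases (h.adj_zero _).1 hadj.symm with H | H | H
    · exact (h.off_cycle i 1 hi (by omega) H).elim
    · exact (h.off_cycle i (k - 1) hi (by omega) H).elim
    · exact h.off_injOn i 0 hi hj H
  · rcases (h.adj_succ j hj _).1 hadj.symm with H | H | H
    · exact (h.off_cycle i j hi (by omega) H).elim
    · by_cases hj2 : j + 2 = k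
      · rw [hj2, h.periodic] at H
        exact (h.off_cycle i 0 hi (by omega) H).elim
      · exact (h.off_cycle i (j + 2) hi (by omega) H).elim
    · exact h.off_injOn i (j + 1) hi hj H

variable [Fintype V]

open scoped Classical in
/-- The vertices off the cycle `c 0, …, c (k - 1)` together with `c 1, …, c i`. -/
noncomputable def upTo (k : ℕ) (c : ℕ → V) (i : ℕ) : Finset V :=
  {x | ∀ j < k, c j = x → 1 ≤ j ∧ j ≤ i}

lemma mem_upTo {x : V} : x ∈ upTo k c i ↔ ∀ j < k, c j = x → 1 ≤ j ∧ j ≤ i := by simp [upTo]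

lemma upTo_subset_upTo (h : i ≤ j) : upTo k c i ⊆ upTo k c j := fun x hx => by
  rw [mem_upTo] at hx ⊢
  exact fun l hl hlx => ⟨(hx l hl hlx).1, (hx l hl hlx).2.trans h⟩

lemma RootedCycle.mem_upTo_iff (h : RootedCycle G k c d) (hj : j < k) :
    c j ∈ upTo k c i ↔ 1 ≤ j ∧ j ≤ i := by
  rw [mem_upTo]
  refine ⟨fun H => H j hj rfl, fun H l hl hlj => ?_⟩
  rwa [h.injOn l j hl hj hlj]

lemma RootedCycle.zero_notMem (h : RootedCycle G k c d) : c 0 ∉ upTo k c i := by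
  rw [h.mem_upTo_iff (by have := h.four_le; omega)]
  omega

lemma RootedCycle.succ_notMem_upTo (h : RootedCycle G k c d) (hij : i ≤ j) (hj : j < k) :
    c (j + 1) ∉ upTo k c i := by
  obtain rfl | hlt := (Nat.succ_le_of_lt hj).eq_or_lt
  · exact h.periodic ▸ h.zero_notMem
  · rw [h.mem_upTo_iff hlt]
    omega

lemma RootedCycle.mem_upTo (h : RootedCycle G k c d) (hj : j < k) : d j ∈ upTo k c i :=
  SemistrongColoring.mem_upTo.2 fun l hl hlj => (h.off_cycle j l hj hl hlj.symm).elim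

lemma RootedCycle.insert_upTo [DecidableEq V] (h : RootedCycle G k c d) (hi : i + 1 < k) :
    insert (c (i + 1)) (upTo k c i) = upTo k c (i + 1) := by
  ext x
  rw [Finset.mem_insert, SemistrongColoring.mem_upTo, SemistrongColoring.mem_upTo]
  constructor
  · rintro (rfl | H) j hj hx
    · have := h.injOn j (i + 1) hj hi hx
      omega
    · have := H j hj hx
      omega
  · intro H
    by_cases hx : x = c (i + 1)
    · exact Or.inl hx
    · refine Or.inr fun j hj hjx => ?_
      have := H j hj hjx
      have hne : j ≠ i + 1 := by
        rintro rfl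
        exact hx hjx.symm
      omega

variable {K : ArcColoring V (Fin 8)}

variable (G) in
/-- The invariant kept while the vertices of a rooted cycle are colored in the order
`c 1, c 2, …`. -/
structure IsStage (k : ℕ) (c d : ℕ → V) (i : ℕ) (K : ArcColoring V (Fin 8)) : Prop
    extends K.IsColoringOn G (upTo k c i) where
  headColors_last : K.headColors (c i) = ∅
  headColors_eq_empty : ∀ w, G.Adj (c 0) w → K.headColors w = ∅
  card_headColors_le : ∀ j, i < j → j < k → (K.headColors (d j)).card ≤ 1
  card_forbidden_inter_le : (K.forbidden G (c 0) (c 1) ∩ K.forbidden G (c 0) (d 0)).card ≤ 5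

variable [G.LocallyFinite] (hG : ∀ v, G.degree v ≤ 3)
include hG

lemma IsStage.card_forbidden_le (hK : IsStage G k c d i K) (h : RootedCycle G k c d) {v : V}
    (hv : G.Adj (c 0) v) : (K.forbidden G (c 0) v).card ≤ 6 :=
  hK.toIsColoringOn.card_forbidden_le hG (h.zero_notMem) hv (k := 3) (H := ∅)
    (fun w _ => hK.toIsValid.card_colorsAt_le_three hG w)
    fun _ _ _ hw => (hK.headColors_eq_empty _ hw).subset

lemma IsStage.exists_isExtension (hK : IsStage G k c d i K) (h : RootedCycle G k c d)
    (hi : 1 ≤ i) (hik : i + 1 < k) : ∃ K' : ArcColoring V (Fin 8),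
      K.IsExtension G ![(c (i + 1), c i), (c (i + 1), d (i + 1))] K' ∧
        K'.IsColoringOn G (upTo k c (i + 1)) := by
  classical
  have hN (x : V) (hx : x ∈ upTo k c i) : G.Adj (c (i + 1)) x ↔ x = c i ∨ x = d (i + 1) := by
    rw [h.adj_succ i hik]
    refine ⟨?_, by tauto⟩
    rintro (rfl | rfl | rfl)
    · exact Or.inl rfl
    · exact (h.succ_notMem_upTo (Nat.le_succ i) hik hx).elim
    · exact Or.inr rfl
  have hr : c (i + 1) ∉ upTo k c i := h.succ_notMem_upTo le_rfl (by omega)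
  have hz : c i ∈ upTo k c i := by rw [h.mem_upTo_iff (by omega)]; omega
  have hz' : d (i + 1) ∈ upTo k c i := h.mem_upTo hik
  have hne : c i ≠ d (i + 1) := (h.off_cycle _ _ hik (by omega)).symm
  have he := enumeratesNewEdges_insert_two hr hz hz' hne hN
  rw [h.insert_upTo hik] at he
  have h3 := hK.toIsValid.card_colorsAt_le_three hG
  have h₁ := hK.toIsColoringOn.card_forbidden_le hG hr ((hN _ hz).2 (Or.inl rfl)) (k := 3)
    (fun w _ => h3 w) (H := K.headColors (d (i + 1))) (by grind)
  have h₂ := hK.toIsColoringOn.card_forbidden_le hG hr ((hN _ hz').2 (Or.inr rfl)) (k := 3)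
    (fun w _ => h3 w) (H := ∅) (by have := hK.headColors_last; grind)
  have hd := hK.card_headColors_le (i + 1) (by omega) hik
  refine hK.toIsColoringOn.exists_isExtension (upTo_subset_upTo (Nat.le_add_right i 1)) he ?_
  simp only [Finset.card_empty] at h₂
  simp [Fin.forall_fin_two]
  omega

theorem IsStage.succ (h : RootedCycle G k c d) (hi : 3 ≤ i) (hik : i + 1 < k)
    (hK : IsStage G k c d i K) : ∃ K', IsStage G k c d (i + 1) K' := by
  have ⟨K', hE, hK'⟩ := hK.exists_isExtension hG h (by omega) hik
  have hcc (j l : ℕ) (hj : j < k) (hl : l < k) (hjl : j ≠ l) : c j ≠ c l := h.ne hj hl hjl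
  have hhead (w : V) (h₁ : c i ≠ w) (h₂ : d (i + 1) ≠ w) : K'.headColors w = K.headColors w :=
    hE.headColors_eq (by simp [Fin.forall_fin_two, h₁, h₂])
  have hcol (w : V) (h₀ : c (i + 1) ≠ w) (h₁ : c i ≠ w) (h₂ : d (i + 1) ≠ w) :
      K'.colorsAt w = K.colorsAt w :=
    hE.colorsAt_eq (by simp [Fin.forall_fin_two, h₀, h₁, h₂])
  have hdc (j l : ℕ) (hj : j < k) (hl : l < k) : d j ≠ c l := h.off_cycle j l hj hl
  have hdd (j l : ℕ) (hj : j < k) (hl : l < k) (hjl : j ≠ l) : d j ≠ d l :=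
    fun H => hjl (h.off_injOn j l hj hl H)
  have hempty (w : V) (hw : G.Adj (c 0) w) : K'.headColors w = ∅ := by
    rw [← hK.headColors_eq_empty w hw]
    obtain rfl | rfl | rfl := (h.adj_zero w).1 hw <;> apply hhead <;> grind
  have hsub (v : V) (hv : ∀ w, w ≠ c 0 → G.Adj v w → c (i + 1) ≠ w ∧ c i ≠ w ∧ d (i + 1) ≠ w) :
      K'.forbidden G (c 0) v ⊆ K.forbidden G (c 0) v := by
    refine forbidden_subset ?_ (fun w hw hvw => ?_) fun w _ hw => ?_
    · simp [hK'.colorsAt_eq_empty h.zero_notMem]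
    · obtain ⟨h₀, h₁, h₂⟩ := hv w hw hvw
      rw [hcol w h₀ h₁ h₂]
      exact fun a ha => mem_forbidden.2 (Or.inr (Or.inl ⟨w, hw, hvw, ha⟩))
    · simp [hempty w hw]
  refine ⟨K', hK', ?_, hempty, fun j hj hjk => ?_, ?_⟩
  · rw [hhead _ (by grind) (by grind)]
    exact hK.toIsColoringOn.headColors_eq_empty (h.succ_notMem_upTo le_rfl (by omega))
  · rw [hhead _ (by grind) (by grind)]
    exact hK.card_headColors_le j (by omega) hjk
  · refine (Finset.card_le_card (Finset.inter_subset_inter (hsub _ fun w hw hadj => ?_)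
      (hsub _ fun w hw hadj => ?_))).trans hK.card_forbidden_inter_le
    · obtain rfl | rfl | rfl := (h.adj_succ 0 (by omega) w).1 hadj <;> grind
    · refine ⟨?_, ?_, ?_⟩ <;> rintro rfl
      · have := h.eq_of_adj (by omega) hik hadj
        omega
      · have := h.eq_of_adj (by omega) (by omega) hadj
        omega
      · have := h.le_three_of_adj _ hik hadj
        omega

lemma IsStage.exists_isColoringOn_univ (hK : IsStage G k c d (k - 1) K) (h : RootedCycle G k c d) :
    ∃ K : ArcColoring V (Fin 8), K.IsColoringOn G Finset.univ := by
  have hk := h.four_le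
  have hadj (v : V) (hv : v = c 1 ∨ v = c (k - 1) ∨ v = d 0) := (h.adj_zero v).2 hv
  have hmem (w : V) (hw : w ≠ c 0) : w ∈ upTo k c (k - 1) := by
    rw [mem_upTo]
    rintro (_ | j) hj rfl
    · exact (hw rfl).elim
    · omega
  have h₁₂ : c 1 ≠ c (k - 1) := h.ne (by omega) (by omega) (by omega)
  have h₁ : d 0 ≠ c 1 := h.off_cycle _ _ (by omega) (by omega)
  have h₂ : d 0 ≠ c (k - 1) := h.off_cycle _ _ (by omega) (by omega)
  have he : EnumeratesNewEdges G (upTo k c (k - 1)) Finset.univ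
      ![(c 0, c 1), (c 0, c (k - 1)), (c 0, d 0)] := by
    refine ⟨by simp [Fin.forall_fin_succ, hadj], by simp,
      by simp [Fin.forall_fin_succ, h.zero_notMem], ?_, fun u _ hu v _ huv => ?_⟩
    · rw [← List.nodup_ofFn]
      simp [h₁₂, h₁.symm, h₂.symm, (hadj (c 1) (by simp)).ne', (hadj (c (k - 1)) (by simp)).ne']
    · obtain rfl : u = c 0 := not_imp_comm.1 (hmem u) hu
      obtain rfl | rfl | rfl := (h.adj_zero v).1 huv
      exacts [⟨0, rfl⟩, ⟨1, rfl⟩, ⟨2, rfl⟩]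
  obtain ⟨f, -, -, hE⟩ := (he.isFresh hK.toIsColoringOn).exists_addArcs_of_card_inter_le
    hK.toIsValid (fun i => subset_rfl) (fun i => by
      refine Nat.add_le_add_right (m := 6) ?_ 3
      fin_cases i <;> exact hK.card_forbidden_le hG h (hadj _ (by simp))) (i := 0) (j := 2)
    (Nat.add_le_add_right hK.card_forbidden_inter_le 3)
  exact ⟨_, hE.isColoringOn hK.toIsColoringOn (Finset.subset_univ _) he⟩

lemma IsStage.exists_isColoringOn_univ_of_three (h : RootedCycle G k c d)
    (hK : IsStage G k c d 3 K) : ∃ K : ArcColoring V (Fin 8), K.IsColoringOn G Finset.univ := by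
  have hk := h.four_le
  obtain ⟨K', hK'⟩ : ∃ K', IsStage G k c d (k - 1) K' := by
    refine Nat.le_induction (P := fun i _ => i < k → ∃ K', IsStage G k c d i K')
      (fun _ => ⟨K, hK⟩) (fun i hi ih hik => ?_) (k - 1) (by omega) (by omega)
    obtain ⟨K', hK'⟩ := ih (by omega)
    exact hK'.succ hG h hi hik
  exact hK'.exists_isColoringOn_univ hG h

end Cycle

section Start

variable {V : Type*} [Fintype V] {G : SimpleGraph V} [G.LocallyFinite]
  (hG : ∀ v, G.degree v ≤ 3) {k : ℕ} {c d : ℕ → V} (h : RootedCycle G k c d)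
include hG h

lemma RootedCycle.exists_isPendantColoring [DecidableEq V] {K₀ : ArcColoring V (Fin 8)}
    (hK₀ : K₀.IsColoringOn G (upTo k c 0)) (h0 : K₀.headColors (d 0) = ∅)
    (hle : ∀ j < k, j ≠ 2 → (K₀.headColors (d j)).card ≤ 1) : ∃ K : ArcColoring V (Fin 8),
      K.IsPendantColoring G (upTo k c 0) {c 1, c 2} ∧ K.headColors (d 0) = ∅ ∧
        (K.headColors (d 1)).card ≤ 2 ∧
        ∀ j, 3 ≤ j → j < k → (K.headColors (d j)).card ≤ 1 := by
  have hk := h.four_le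
  have hmem (j : ℕ) (hj : j < k) : c (j + 1) ∉ upTo k c 0 := h.succ_notMem_upTo j.zero_le hj
  obtain ⟨K, hK, hcard⟩ := hK₀.exists_isPendantColoring (X := {c 1, c 2}) hG (by simp)
    (by simp [hmem 0 (by omega), hmem 1 (by omega)]) (by
      rintro x hx
      obtain rfl | rfl := by simpa using hx
      · refine ⟨d 1, fun q hq hadj => ?_⟩
        obtain rfl | rfl | rfl := (h.adj_succ 0 (by omega) q).1 hadj
        exacts [(h.zero_notMem hq).elim, (hmem 1 (by omega) hq).elim, rfl]
      · refine ⟨d 2, fun q hq hadj => ?_⟩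
        obtain rfl | rfl | rfl := (h.adj_succ 1 (by omega) q).1 hadj
        exacts [(hmem 0 (by omega) hq).elim, (hmem 2 (by omega) hq).elim, rfl])
  have hdeg (j : ℕ) (hj : j < k) (h1 : j ≠ 1) (h2 : j ≠ 2) : degreeOn G {c 1, c 2} (d j) = 0 := by
    refine Nat.le_zero.1 (degreeOn_le_card (X := ∅) fun x hx hadj => ?_)
    obtain rfl | rfl := by simpa using hx
    exacts [(h1 (h.eq_of_adj hj (by omega) hadj)).elim, (h2 (h.eq_of_adj hj (by omega) hadj)).elim]
  refine ⟨K, hK, ?_, ?_, fun j hj hjk => ?_⟩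
  · have := hcard (d 0)
    rwa [h0, hdeg 0 (by omega) (by omega) (by omega), Finset.card_empty, Nat.le_zero,
      Finset.card_eq_zero] at this
  · refine (hcard _).trans (Nat.add_le_add (hle 1 (by omega) (by omega)) (?_ : _ ≤ 1))
    refine degreeOn_le_card (X := {c 1}) fun x hx hadj => ?_
    obtain rfl | rfl := by simpa using hx
    · simp
    · have := h.eq_of_adj (by omega) (by omega) hadj
      omega
  · simpa [hdeg j hjk (by omega) (by omega)] using
      (hcard (d j)).trans (Nat.add_le_add_right (hle j hjk (by omega)) _)

end Start

/-- If `X ⊆ {a, b} ∪ Q` meets `Y` in six elements, then `{a, b} ∪ Q = Y`, which leaves little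
choice for `a`. -/
lemma exists_card_le_two_forall_card_inter_le {C : Type*} [DecidableEq C] {D Q : Finset C}
    (hQ : Q.card ≤ 4) : ∃ F : Finset C, F.card ≤ 2 ∧ ∀ a ∉ F, ∀ b X Y,
      X ⊆ insert a (insert b Q) → Y.card ≤ 6 → D ⊆ Y → (a ∈ Y → a ∈ D) → (X ∩ Y).card ≤ 5 := by
  have key (a b X Y) (hX : X ⊆ insert a (insert b Q)) (hY : Y.card ≤ 6) (hXY : 5 < (X ∩ Y).card) :
      a ∉ Q ∧ a ∈ Y ∧ Y \ Q ⊆ {a, b} := by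
    have hab := Finset.card_insert_le a (insert b Q)
    have hb := Finset.card_insert_le b Q
    have hY' : X ∩ Y = Y := Finset.eq_of_subset_of_card_le Finset.inter_subset_right (by omega)
    have hX' : X ∩ Y = insert a (insert b Q) :=
      Finset.eq_of_subset_of_card_le (Finset.inter_subset_left.trans hX) (by omega)
    refine ⟨fun ha => ?_, ?_, ?_⟩
    · rw [Finset.insert_eq_of_mem (Finset.mem_insert_of_mem ha)] at hX'
      rw [hX'] at hXY
      omega
    · rw [← hY', hX']
      exact Finset.mem_insert_self a _
    · rw [← hY', hX']
      grind
  by_cases hD : (D \ Q).card ≤ 2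
  · refine ⟨D \ Q, hD, fun a ha b X Y hX hY _ haD => ?_⟩
    by_contra! hXY
    obtain ⟨haQ, haY, -⟩ := key a b X Y hX hY hXY
    exact ha (Finset.mem_sdiff.2 ⟨haD haY, haQ⟩)
  · refine ⟨∅, by simp, fun a _ b X Y hX hY hDY _ => ?_⟩
    by_contra! hXY
    have hsub := (Finset.sdiff_subset_sdiff hDY subset_rfl).trans (key a b X Y hX hY hXY).2.2
    exact hD ((Finset.card_le_card hsub).trans Finset.card_le_two)

lemma ArcColoring.colorsAt_addArcs_subset {V C ι : Type*} [Fintype C] {K : ArcColoring V C}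
    {e : ι → V × V} {f : ι → C} {w : V} {F : Finset C} (hK : K.colorsAt w ⊆ F)
    (h : ∀ i, (e i).1 = w ∨ (e i).2 = w → f i ∈ F) : (K.addArcs e f).colorsAt w ⊆ F := by
  intro a ha
  obtain ⟨x, hx⟩ := mem_colorsAt.1 ha
  obtain hx | ⟨i, hi, rfl⟩ := hasColor_addArcs.1 hx
  · exact hK (mem_colorsAt.2 ⟨x, hx⟩)
  · exact h i ((Sym2.mem_iff.1 (hi ▸ Sym2.mem_mk_left w x)).imp Eq.symm Eq.symm)

lemma ArcColoring.forbidden_mono {V C : Type*} [Fintype C] {G : SimpleGraph V}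
    {K K' : ArcColoring V C} (h : ∀ {u v a}, K u v a → K' u v a) (u v : V) :
    K.forbidden G u v ⊆ K'.forbidden G u v := by
  have hcol (w a) : a ∈ K.colorsAt w → a ∈ K'.colorsAt w := by
    simpa only [mem_colorsAt, HasColor] using Exists.imp fun _ => Or.imp h h
  have hhead (w a) : a ∈ K.headColors w → a ∈ K'.headColors w := by
    simpa only [mem_headColors] using Exists.imp fun _ => h
  intro a
  simp only [mem_forbidden]
  exact Or.imp (hcol u a) (Or.imp (Exists.imp fun w => And.imp_right (And.imp_right (hcol w a)))
    (Exists.imp fun w => And.imp_right (And.imp_right (hhead w a))))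

section StartArcs

variable {V : Type*} [Fintype V] [DecidableEq V] {G : SimpleGraph V} {k : ℕ} {c d : ℕ → V}
  (h : RootedCycle G k c d) {K K' : ArcColoring V (Fin 8)}
  (hK : K.IsPendantColoring G (upTo k c 0) {c 1, c 2})

/-- The arcs by which a rooted cycle is colored at `c 1`, `c 2`, `c 3`, once the edges from `c 1`
and `c 2` to `d 1` and `d 2` are colored. -/
def startArcs (c d : ℕ → V) : Fin 3 → V × V := ![(c 1, c 2), (c 3, d 3), (c 3, c 2)]

include h hK

lemma RootedCycle.isFresh_startArcs : K.IsFresh G (startArcs c d) := by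
  have hk := h.four_le
  have ha₁ := (h.adj_succ 0 (by omega) (c 2)).2 (by simp)
  have ha₃ := h.adj_succ 2 (by omega)
  have hmem (j : ℕ) (hj : j < k) : c (j + 1) ∉ upTo k c 0 := h.succ_notMem_upTo j.zero_le hj
  have h31 : c 3 ≠ c 1 := h.ne (by omega) (by omega) (by omega)
  have h32 : c 3 ≠ c 2 := h.ne (by omega) (by omega) (by omega)
  have hd₂ : d 3 ≠ c 2 := h.off_cycle 3 2 (by omega) (by omega)
  have hc₁ (a) : ¬ K.HasColor (c 1) (c 2) a := fun hx =>
    hmem 1 (by omega) (hK.mem_right hx (hmem 0 (by omega)))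
  have hc₃ (x a) : ¬ K.HasColor (c 3) x a := fun hx => by
    have := (hK.mem_left hx).resolve_left (hmem 2 (by omega))
    simp [h31, h32] at this
  refine ⟨?_, fun i a => ?_, ?_⟩
  · simp [startArcs, Fin.forall_fin_succ, ha₁, ha₃]
  · fin_cases i
    exacts [hc₁ a, hc₃ _ a, hc₃ _ a]
  · rw [← List.nodup_ofFn]
    simp [startArcs, *, Ne.symm]

lemma RootedCycle.isColoringOn_of_isExtension (hE : K.IsExtension G (startArcs c d) K') :
    K'.IsColoringOn G (upTo k c 3) := by
  have hk := h.four_le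
  have hz := h.zero_notMem (i := 3)
  have hmem (j : ℕ) (hj : 1 ≤ j) (hj' : j ≤ 3) : c j ∈ upTo k c 3 :=
    (h.mem_upTo_iff (by omega)).2 ⟨hj, hj'⟩
  refine hK.isColoringOn hE (upTo_subset_upTo (by omega)) ?_ ?_ ?_
  · simp [Finset.insert_subset_iff, hmem]
  · simp [startArcs, Fin.forall_fin_succ, hmem, h.mem_upTo (j := 3) (by omega)]
  · intro u hu hu₀ v hv huv hvX
    obtain ⟨j, hj, rfl⟩ : ∃ j < 4, c j = u := by
      simp only [SemistrongColoring.mem_upTo, not_forall] at hu hu₀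
      obtain ⟨j, hj, rfl, -⟩ := hu₀
      exact ⟨j, by have := hu j hj rfl; omega, rfl⟩
    have hd (j : ℕ) (hj : j < k) : d j ∈ upTo k c 0 := h.mem_upTo hj
    simp only [startArcs, Fin.exists_fin_succ, Sym2.eq_iff]
    interval_cases j
    · exact (hz hu).elim
    · obtain rfl | rfl | rfl := (h.adj_succ 0 (by omega) v).1 huv
      exacts [(hz hv).elim, by simp, (hvX (hd 1 (by omega)) (by simp)).elim]
    · obtain rfl | rfl | rfl := (h.adj_succ 1 (by omega) v).1 huv
      exacts [by simp, by simp, (hvX (hd 2 (by omega)) (by simp)).elim]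
    · obtain rfl | rfl | rfl := (h.adj_succ 2 (by omega) v).1 huv
      exacts [by simp, (h.succ_notMem_upTo le_rfl (by omega) hv).elim, by simp]

variable [G.LocallyFinite] (hG : ∀ v, G.degree v ≤ 3)
include hG

lemma RootedCycle.exists_addArcs_startArcs (hd₁ : (K.headColors (d 1)).card ≤ 2)
    (hd₃ : (K.headColors (d 3)).card ≤ 1) {F : Finset (Fin 8)} (hF : F.card ≤ 2) :
    ∃ f, f.Injective ∧ f 0 ∉ F ∧ K.IsExtension G (startArcs c d)
      (K.addArcs (startArcs c d) f) := by
  have hk := h.four_le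
  have ha₁ := h.adj_succ 0 (by omega)
  have ha₂ := h.adj_succ 1 (by omega)
  have ha₃ := h.adj_succ 2 (by omega)
  have hmem (j : ℕ) (hj : j < k) : c (j + 1) ∉ upTo k c 0 := h.succ_notMem_upTo j.zero_le hj
  have hc₃ : K.colorsAt (c 3) = ∅ := hK.colorsAt_eq_empty_of_notMem (hmem 2 (by omega))
    (by
    have h31 : c 3 ≠ c 1 := h.ne (by omega) (by omega) (by omega)
    have h32 : c 3 ≠ c 2 := h.ne (by omega) (by omega) (by omega)
    simp [h31, h32])
  have h₀ := h.zero_notMem (i := 0)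
  have hs₁ : K.colorsAt (c 1) ⊆ K.headColors (d 1) :=
    hK.colorsAt_subset (hmem 0 (by omega)) (by grind)
  have hc₁ : (K.colorsAt (c 1)).card ≤ 1 :=
    hK.card_colorsAt_le_one (p := d 1) (hmem 0 (by omega)) (by grind)
  have hd₂ := hK.toIsValid.card_colorsAt_le_three hG (d 2)
  have h₃ := card_forbidden_le (K := K) (k := 3) (u := c 3) (H := ∅) hG ((ha₃ (d 3)).2 (by simp))
    (fun w _ => hK.toIsValid.card_colorsAt_le_three hG w) fun w hw hadj => by
      obtain rfl | rfl | rfl := (ha₃ w).1 hadj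
      exacts [(hK.headColors_eq_empty (hmem 1 (by omega))).subset,
        (hK.headColors_eq_empty (hmem 3 (by omega))).subset, (hw rfl).elim]
  have h8 := Fintype.card_fin 8
  obtain ⟨f, hinj, hf, hE⟩ := (h.isFresh_startArcs hK).exists_addArcs hK.toIsValid
    (F := ![K.colorsAt (d 2) ∪ K.headColors (d 1) ∪ F, K.forbidden G (c 3) (d 3),
      K.colorsAt (c 1) ∪ K.colorsAt (d 2) ∪ K.headColors (d 3)])
    (fun i => by
      fin_cases i
      · apply hK.forbidden_subset <;> dsimp [startArcs] <;> grind
      · exact subset_rfl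
      · apply hK.forbidden_subset <;> dsimp [startArcs] <;> grind)
    (fun i => by
      fin_cases i
      · refine (Nat.add_le_add_right (card_union_union_le _ _ _) _).trans_lt ?_
        dsimp
        omega
      · simp only [hc₃, Finset.card_empty] at h₃
        dsimp
        omega
      · refine (Nat.add_le_add_right (card_union_union_le _ _ _) _).trans_lt ?_
        dsimp
        omega)
  refine ⟨f, hinj, fun hF => hf 0 ?_, hE⟩
  simp [hF]

lemma RootedCycle.card_forbidden_inter_le {f : Fin 3 → Fin 8}
    (hE : K.IsExtension G (startArcs c d) (K.addArcs (startArcs c d) f)) (hf : f.Injective)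
    (h₀ : ∀ w, G.Adj (c 0) w → (K.addArcs (startArcs c d) f).headColors w = ∅)
    (hF : ∀ b X Y, X ⊆ insert (f 0) (insert b (K.colorsAt (c 2) ∪ K.colorsAt (d 1))) →
      Y.card ≤ 6 → K.forbidden G (c 0) (d 0) ⊆ Y →
        (f 0 ∈ Y → f 0 ∈ K.forbidden G (c 0) (d 0)) → (X ∩ Y).card ≤ 5) :
    ((K.addArcs (startArcs c d) f).forbidden G (c 0) (c 1) ∩
      (K.addArcs (startArcs c d) f).forbidden G (c 0) (d 0)).card ≤ 5 := by
  have hk := h.four_le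
  have hK' := h.isColoringOn_of_isExtension hK hE
  have hempty := hK'.colorsAt_eq_empty h.zero_notMem
  have hd (j : ℕ) (hj : j < k) : d 1 ≠ c j := h.off_cycle 1 j (by omega) hj
  have hd₃ : d 1 ≠ d 3 := fun H => by simpa using h.off_injOn 1 3 (by omega) (by omega) H
  refine hF (f 2) _ _ (forbidden_subset ?_ (fun w hw hadj => ?_) fun w _ hw => ?_) ?_
    (forbidden_mono hE.le _ _) fun ha => ?_
  · simp [hempty]
  · obtain rfl | rfl | rfl := (h.adj_succ 0 (by omega) w).1 hadj
    · exact (hw rfl).elim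
    · refine colorsAt_addArcs_subset (by grind) fun i hi => ?_
      have h32 : c 3 ≠ c 2 := h.ne (by omega) (by omega) (by omega)
      have hd₂ : d 3 ≠ c 2 := h.off_cycle 3 2 (by omega) (by omega)
      fin_cases i
      exacts [by simp, by simp [startArcs, h32, hd₂] at hi, by simp]
    · rw [hE.colorsAt_eq (by simp [startArcs, Fin.forall_fin_succ, (hd _ _).symm, hd₃.symm,
        show 1 < k by omega, show 2 < k by omega, show 3 < k by omega])]
      grind
  · simp [h₀ w hw]
  · exact hK'.card_forbidden_le hG h.zero_notMem ((h.adj_zero _).2 (by simp)) (k := 3) (H := ∅)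
      (fun w _ => hK'.toIsValid.card_colorsAt_le_three hG w) fun w _ _ hw => (h₀ w hw).subset
  · obtain ha | ⟨w, hw, hadj, ha⟩ | ⟨w, -, hadj, ha⟩ := mem_forbidden.1 ha
    · simp [hempty] at ha
    · refine mem_forbidden.2 (Or.inr (Or.inl ⟨w, hw, hadj, ?_⟩))
      obtain ⟨x, hx⟩ := mem_colorsAt.1 ha
      obtain hx | ⟨i, hi, hfi⟩ := hasColor_addArcs.1 hx
      · exact mem_colorsAt.2 ⟨x, hx⟩
      · obtain rfl := hf hfi
        obtain rfl | rfl := Sym2.mem_iff.1 (hi ▸ Sym2.mem_mk_left w x : w ∈ s(c 1, c 2))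
        · simpa using h.eq_of_adj (by omega) (by omega) hadj
        · simpa using h.eq_of_adj (by omega) (by omega) hadj
    · simp [h₀ w hadj] at ha

lemma RootedCycle.exists_isStage (h₀ : K.headColors (d 0) = ∅)
    (hd₁ : (K.headColors (d 1)).card ≤ 2)
    (hd : ∀ j, 3 ≤ j → j < k → (K.headColors (d j)).card ≤ 1) : ∃ K', IsStage G k c d 3 K' := by
  have hk := h.four_le
  have hQ : (K.colorsAt (c 2) ∪ K.colorsAt (d 1)).card ≤ 4 := by
    have h₂ := hK.card_colorsAt_le_one (x := c 2) (p := d 2)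
      (h.succ_notMem_upTo (j := 1) (by omega) (by omega)) fun q hq hadj => by
        obtain rfl | rfl | rfl := (h.adj_succ 1 (by omega) q).1 hadj
        exacts [(h.succ_notMem_upTo (j := 0) (by omega) (by omega) hq).elim,
          (h.succ_notMem_upTo (j := 2) (by omega) (by omega) hq).elim, rfl]
    have h₁ := hK.toIsValid.card_colorsAt_le_three hG (d 1)
    exact (Finset.card_union_le _ _).trans (by omega)
  obtain ⟨F, hF, hFX⟩ := exists_card_le_two_forall_card_inter_le (D := K.forbidden G (c 0) (d 0)) hQ
  obtain ⟨f, hf, hf₀, hE⟩ := h.exists_addArcs_startArcs hK hG hd₁ (hd 3 le_rfl (by omega)) hF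
  have hhead (w : V) (hw : c 2 ≠ w ∧ d 3 ≠ w) :
      (K.addArcs (startArcs c d) f).headColors w = K.headColors w :=
    hE.headColors_eq (by simp [startArcs, Fin.forall_fin_succ, hw])
  have hnew (w : V) (hw : w ∉ upTo k c 0) (hw₂ : c 2 ≠ w) (hw₃ : d 3 ≠ w) :
      (K.addArcs (startArcs c d) f).headColors w = ∅ :=
    (hhead w ⟨hw₂, hw₃⟩).trans (hK.headColors_eq_empty hw)
  have hempty (w : V) (hw : G.Adj (c 0) w) : (K.addArcs (startArcs c d) f).headColors w = ∅ := by
    obtain rfl | rfl | rfl := (h.adj_zero w).1 hw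
    · exact hnew _ (h.succ_notMem_upTo (j := 0) le_rfl (by omega))
        (h.ne (by omega) (by omega) (by omega)) (h.off_cycle _ _ (by omega) (by omega))
    · obtain ⟨j, rfl⟩ : ∃ j, k = j + 2 := ⟨k - 2, by omega⟩
      exact hnew _ (h.succ_notMem_upTo (j := j) (by omega) (by omega))
        (h.ne (by omega) (by omega) (by omega)) (h.off_cycle _ _ (by omega) (by omega))
    · refine (hhead _ ⟨(h.off_cycle _ _ (by omega) (by omega)).symm, fun H => ?_⟩).trans h₀
      simpa using h.off_injOn _ _ (by omega) (by omega) H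
  refine ⟨_, h.isColoringOn_of_isExtension hK hE, ?_, hempty, fun j hj hjk => ?_,
    h.card_forbidden_inter_le hK hG hE hf hempty (hFX _ hf₀)⟩
  · exact hnew _ (h.succ_notMem_upTo (j := 2) (by omega) (by omega))
      (h.ne (by omega) (by omega) (by omega)) (h.off_cycle _ _ (by omega) (by omega))
  · rw [hhead _ ⟨(h.off_cycle _ _ (by omega) (by omega)).symm, fun H => ?_⟩]
    · exact hd j hj.le hjk
    · have := h.off_injOn _ _ (by omega) (by omega) H
      omega

end StartArcs

theorem RootedCycle.exists_isColoringOn_univ {V : Type*} [Fintype V] {G : SimpleGraph V}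
    [G.LocallyFinite] (hG : ∀ v, G.degree v ≤ 3) {k : ℕ} {c d : ℕ → V} (h : RootedCycle G k c d)
    {K₀ : ArcColoring V (Fin 8)} (hK₀ : K₀.IsColoringOn G (upTo k c 0))
    (h0 : K₀.headColors (d 0) = ∅) (hle : ∀ j < k, j ≠ 2 → (K₀.headColors (d j)).card ≤ 1) :
    ∃ K : ArcColoring V (Fin 8), K.IsColoringOn G Finset.univ := by
  classical
  obtain ⟨K, hK, h₀, hd₁, hd⟩ := h.exists_isPendantColoring hG hK₀ h0 hle
  obtain ⟨K', hK'⟩ := h.exists_isStage hK hG h₀ hd₁ hd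
  exact hK'.exists_isColoringOn_univ_of_three hG h

section CyclicSequence

variable {V : Type*} {G : SimpleGraph V} {k L s : ℕ} {c : ℕ → V}

variable (G) in
/-- The vertices `f 0, …, f (k - 1)` form a cycle in this order. -/
structure IsCyclicSequence (k : ℕ) (f : ℕ → V) : Prop where
  three_le : 3 ≤ k
  injOn : ∀ i j, i < k → j < k → f i = f j → i = j
  adj_succ : ∀ i, i + 1 < k → G.Adj (f i) (f (i + 1))
  adj_last : G.Adj (f (k - 1)) (f 0)

lemma exists_nonbacktracking_sequence {T : Finset V} (hne : T.Nonempty)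
    (hT : ∀ w ∈ T, 2 ≤ degreeOn G T w) :
    ∃ s : ℕ → V, ∀ n, s n ∈ T ∧ G.Adj (s n) (s (n + 1)) ∧ s (n + 2) ≠ s n := by
  classical
  have hnext (u v : V) (hv : v ∈ T) : ∃ w ∈ T, G.Adj v w ∧ w ≠ u := by
    obtain ⟨w, hw, hwu⟩ := Finset.exists_mem_ne (hT v hv) u
    exact ⟨w, (Finset.mem_filter.1 hw).1, (Finset.mem_filter.1 hw).2, hwu⟩
  choose! next hnext using hnext
  obtain ⟨v, hv⟩ := hne
  let p (n : ℕ) : V × V := (fun q => (q.2, next q.1 q.2))^[n] (v, next v v)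
  have hp (n : ℕ) : p (n + 1) = ((p n).2, next (p n).1 (p n).2) :=
    Function.iterate_succ_apply' _ _ _
  have hinv (n : ℕ) : (p n).1 ∈ T ∧ (p n).2 ∈ T ∧ G.Adj (p n).1 (p n).2 := by
    induction n with
    | zero => exact ⟨hv, (hnext v v hv).1, (hnext v v hv).2.1⟩
    | succ n ih =>
      have := hnext (p n).1 (p n).2 ih.2.1
      rw [hp]
      exact ⟨ih.2.1, this.1, this.2.1⟩
  refine ⟨fun n => (p n).1, fun n => ⟨(hinv n).1, ?_, ?_⟩⟩
  · simpa only [hp] using (hinv n).2.2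
  · simpa only [hp] using (hnext (p n).1 (p n).2 (hinv n).2.1).2.2

lemma exists_first_repetition [Finite V] (s : ℕ → V) :
    ∃ i j, i < j ∧ s i = s j ∧ Set.InjOn s (Set.Iio j) := by
  classical
  have hex : ∃ j, ∃ i < j, s i = s j := by
    obtain ⟨a, b, hab, he⟩ := Finite.exists_ne_map_eq_of_infinite s
    obtain h | h := lt_or_gt_of_ne hab
    exacts [⟨b, a, h, he⟩, ⟨a, b, h, he.symm⟩]
  obtain ⟨i, hij, he⟩ := Nat.find_spec hex
  refine ⟨i, _, hij, he, fun a ha b hb hab => ?_⟩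
  by_contra hne
  obtain h | h := lt_or_gt_of_ne hne
  exacts [Nat.find_min hex hb ⟨a, h, hab⟩, Nat.find_min hex ha ⟨b, h, hab.symm⟩]

lemma exists_isCyclicSequence [Finite V] {T : Finset V} (hne : T.Nonempty)
    (hT : ∀ w ∈ T, 2 ≤ degreeOn G T w) : ∃ k f, IsCyclicSequence G k f ∧ k ≤ T.card := by
  obtain ⟨s, hs⟩ := exists_nonbacktracking_sequence hne hT
  obtain ⟨i, j, hij, he, hinj⟩ := exists_first_repetition s
  have h1 : j ≠ i + 1 := by
    rintro rfl
    exact (hs i).2.1.ne he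
  have h2 : j ≠ i + 2 := by
    rintro rfl
    exact (hs i).2.2 he.symm
  have hinj' (a b : ℕ) (ha : a < j - i) (hb : b < j - i) (hab : s (i + a) = s (i + b)) :
      a = b := by
    simpa using hinj (Set.mem_Iio.2 (by omega)) (Set.mem_Iio.2 (by omega)) hab
  refine ⟨j - i, fun n => s (i + n), ⟨by omega, hinj', fun a _ => (hs (i + a)).2.1, ?_⟩, ?_⟩
  · have := (hs (j - 1)).2.1
    rw [Nat.sub_add_cancel (by omega), ← he] at this
    simpa [show i + (j - i - 1) = j - 1 by omega] using this
  · simpa using Finset.card_le_card_of_injOn (s := Finset.range (j - i)) (fun n => s (i + n))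
      (fun n _ => (hs _).1) fun a ha b hb => hinj' a b (by simpa using ha) (by simpa using hb)

variable (G) in
/-- A periodic parametrization of a cycle of minimum length. -/
structure IsShortestCycle (k : ℕ) (c : ℕ → V) : Prop where
  three_le : 3 ≤ k
  adj : ∀ i, G.Adj (c i) (c (i + 1))
  periodic : Function.Periodic c k
  injOn : ∀ s i j, i < k → j < k → c (s + i) = c (s + j) → i = j
  le : ∀ k' f, IsCyclicSequence G k' f → k ≤ k'

lemma exists_isShortestCycle (h : ∃ k f, IsCyclicSequence G k f) :
    ∃ k c, IsShortestCycle G k c := by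
  classical
  obtain ⟨f, hf⟩ := Nat.find_spec h
  have hmin (k' f) (hf : IsCyclicSequence G k' f) : Nat.find h ≤ k' := Nat.find_min' h ⟨f, hf⟩
  generalize Nat.find h = k at *
  have h3 := hf.three_le
  refine ⟨k, fun n => f (n % k), h3, fun i => ?_, (Nat.periodic_mod k).comp f,
    fun s i j hi hj he => ?_, hmin⟩
  · have hlt := Nat.mod_lt i (by omega : 0 < k)
    have h1 : 1 % k = 1 := Nat.mod_eq_of_lt (by omega)
    obtain hi | hi := (Nat.succ_le_of_lt hlt).eq_or_lt
    · have := hf.adj_last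
      simpa [Nat.add_mod i 1 k, h1, show i % k = k - 1 by omega,
        Nat.sub_add_cancel (by omega : 1 ≤ k)] using this
    · simpa [Nat.add_mod i 1 k, h1, Nat.mod_eq_of_lt hi] using hf.adj_succ _ hi
  · have := hf.injOn _ _ (Nat.mod_lt _ (by omega)) (Nat.mod_lt _ (by omega)) he
    exact Nat.ModEq.eq_of_lt_of_lt (Nat.ModEq.add_left_cancel' s this) hi hj

lemma exists_adj_iff_of_degree_eq_three [G.LocallyFinite] {v a b : V} (hd : G.degree v = 3)
    (ha : G.Adj v a) (hb : G.Adj v b) (hab : a ≠ b) :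
    ∃ c, c ≠ a ∧ c ≠ b ∧ ∀ x, G.Adj v x ↔ x = a ∨ x = b ∨ x = c := by
  classical
  have hsub : {a, b} ⊆ G.neighborFinset v := by
    simp [Finset.insert_subset_iff, ha, hb]
  obtain ⟨c, hc⟩ : ∃ c, G.neighborFinset v \ {a, b} = {c} := by
    rw [← Finset.card_eq_one, Finset.card_sdiff_of_subset hsub, G.card_neighborFinset_eq_degree, hd,
      Finset.card_pair hab]
  have key (x : V) : G.Adj v x ∧ x ≠ a ∧ x ≠ b ↔ x = c := by
    simpa using Finset.ext_iff.1 hc x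
  obtain ⟨-, hca, hcb⟩ := (key c).2 rfl
  refine ⟨c, hca, hcb, fun x => ?_⟩
  grind

namespace IsShortestCycle

lemma le_of_ear (h : IsShortestCycle G k c) {m : ℕ} {x : ℕ → V} (hm : 2 ≤ L + m) (hL : L < k)
    (hx : ∀ i < m, ∀ j, x (i + 1) ≠ c j)
    (hinj : ∀ i < m, ∀ j < m, x (i + 1) = x (j + 1) → i = j)
    (hadj : ∀ i ≤ m, G.Adj (x i) (x (i + 1))) (h₀ : x 0 = c (s + L)) (hlast : x (m + 1) = c s) :
    k ≤ L + m + 1 := by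
  let f (n : ℕ) : V := if n ≤ L then c (s + n) else x (n - L)
  have hle (n : ℕ) (hn : n ≤ L) : f n = c (s + n) := if_pos hn
  have hge (n : ℕ) : f (L + n) = x n := by
    cases n with
    | zero => rw [add_zero, hle L le_rfl, h₀]
    | succ n => simp [f]
  have hcases (n : ℕ) (hn : n < L + m + 1) : n ≤ L ∨ ∃ l < m, n = L + (l + 1) := by
    by_cases hnL : n ≤ L
    exacts [.inl hnL, .inr ⟨n - L - 1, by omega, by omega⟩]
  refine h.le (L + m + 1) f ⟨by omega, fun i j hi hj he => ?_, fun i hi => ?_, ?_⟩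
  · obtain hi | ⟨l, hl, rfl⟩ := hcases i hi <;> obtain hj | ⟨l', hl', rfl⟩ := hcases j hj
    · exact h.injOn s i j (by omega) (by omega) (by rwa [hle i hi, hle j hj] at he)
    · rw [hle i hi, hge] at he
      exact (hx l' hl' _ he.symm).elim
    · rw [hle j hj, hge] at he
      exact (hx l hl _ he).elim
    · rw [hge, hge] at he
      rw [hinj l hl l' hl' he]
  · obtain hiL | ⟨l, rfl⟩ : i + 1 ≤ L ∨ ∃ l, i = L + l := by
      by_cases hiL : i + 1 ≤ L
      exacts [.inl hiL, .inr ⟨i - L, by omega⟩]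
    · rw [hle i (by omega), hle _ hiL]
      exact h.adj (s + i)
    · rw [add_assoc, hge, hge]
      exact hadj l (by omega)
  · rw [Nat.add_sub_cancel, hge, hle 0 L.zero_le, add_zero, ← hlast]
    exact hadj m le_rfl

lemma le_of_chord (h : IsShortestCycle G k c) (h2 : 2 ≤ L) (hL : L < k)
    (hadj : G.Adj (c (s + L)) (c s)) : k ≤ L + 1 :=
  h.le_of_ear (m := 0) (x := fun | 0 => c (s + L) | _ => c s) h2 hL (by simp) (by simp)
    (by simpa using hadj) rfl rfl

lemma le_of_common_neighbor (h : IsShortestCycle G k c) {x : V} (h1 : 1 ≤ L) (hL : L < k)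
    (hx : ∀ i, x ≠ c i) (hxs : G.Adj x (c s)) (hxL : G.Adj x (c (s + L))) : k ≤ L + 2 :=
  h.le_of_ear (m := 1) (x := fun | 0 => c (s + L) | 1 => x | _ => c s) (by omega) hL
    (fun | 0, _ => hx) (fun | 0, _, 0, _ => fun _ => rfl) (fun | 0, _ => hxL.symm | 1, _ => hxs)
    rfl rfl

lemma le_of_adj_neighbors (h : IsShortestCycle G k c) {x y : V} (hL : L < k)
    (hx : ∀ i, x ≠ c i) (hy : ∀ i, y ≠ c i) (hxy : G.Adj x y) (hxs : G.Adj x (c s))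
    (hyL : G.Adj y (c (s + L))) : k ≤ L + 3 :=
  h.le_of_ear (m := 2) (x := fun | 0 => c (s + L) | 1 => y | 2 => x | _ => c s) (by omega) hL
    (fun | 0, _ => hy | 1, _ => hx)
    (fun
      | 0, _, 0, _ | 1, _, 1, _ => fun _ => rfl
      | 0, _, 1, _ => fun he => (hxy.ne he.symm).elim
      | 1, _, 0, _ => fun he => (hxy.ne he).elim)
    (fun | 0, _ => hyL.symm | 1, _ => hxy.symm | 2, _ => hxs) rfl rfl

lemma prev_adj (h : IsShortestCycle G k c) (i : ℕ) : G.Adj (c (i + k - 1)) (c i) := by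
  have := h.three_le
  simpa [Nat.sub_add_cancel (by omega : 1 ≤ i + k), h.periodic i] using h.adj (i + k - 1)

lemma eq_of_adj_of_lt (h : IsShortestCycle G k c) {i j : ℕ} (hij : i < j) (hj : j < k)
    (hadj : G.Adj (c i) (c j)) : j = i + 1 ∨ i = 0 ∧ j = k - 1 := by
  by_contra! hcon
  have := h.le_of_chord (s := i) (L := j - i) (by omega) (by omega)
    (by rw [Nat.add_sub_cancel' hij.le]; exact hadj.symm)
  omega

lemma eq_of_adj (h : IsShortestCycle G k c) {i j : ℕ} (hi : i < k) (hj : j < k)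
    (hadj : G.Adj (c i) (c j)) : c j = c (i + 1) ∨ c j = c (i + k - 1) := by
  have h3 := h.three_le
  obtain hij | rfl | hij := lt_trichotomy i j
  · obtain rfl | ⟨rfl, rfl⟩ := h.eq_of_adj_of_lt hij hj hadj
    · exact .inl rfl
    · exact .inr (by rw [zero_add])
  · exact (hadj.ne rfl).elim
  · obtain rfl | ⟨rfl, rfl⟩ := h.eq_of_adj_of_lt hij hi hadj.symm
    · exact .inr (by rw [show j + 1 + k - 1 = j + k by omega, h.periodic])
    · exact .inl (by rw [Nat.sub_add_cancel (by omega), h.periodic.eq])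

lemma four_le_of_cliqueFree (h : IsShortestCycle G k c) (hfree : G.CliqueFree 3) : 4 ≤ k := by
  classical
  by_contra! hk
  obtain rfl : k = 3 := by have := h.three_le; omega
  exact hfree {c 0, c 1, c 2} <| SimpleGraph.is3Clique_triple_iff.2
    ⟨h.adj 0, h.periodic.eq ▸ (h.adj 2).symm, h.adj 1⟩

variable [G.LocallyFinite] {d : ℕ → V}

lemma exists_third_neighbors (h : IsShortestCycle G k c) (hd : ∀ v, G.degree v = 3) :
    ∃ d : ℕ → V, (∀ i x, G.Adj (c i) x ↔ x = c (i + k - 1) ∨ x = c (i + 1) ∨ x = d i) ∧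
      ∀ i j, i < k → d i ≠ c j := by
  have h3 := h.three_le
  have hne (i : ℕ) : c (i + k - 1) ≠ c (i + 1) := fun he => by
    have := h.injOn i (k - 1) 1 (by omega) (by omega) (by rwa [← Nat.add_sub_assoc (by omega)])
    omega
  choose d hd₁ hd₂ hadj using fun i =>
    exists_adj_iff_of_degree_eq_three (hd (c i)) (h.prev_adj i).symm (h.adj i) (hne i)
  refine ⟨d, hadj, fun i j hi he => ?_⟩
  have hlt := Nat.mod_lt j (by omega : 0 < k)
  rw [← h.periodic.map_mod_nat] at he
  obtain H | H := h.eq_of_adj hi hlt ((hadj i _).2 (.inr (.inr he.symm)))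
  exacts [hd₂ i (he.trans H), hd₁ i (he.trans H)]

omit [G.LocallyFinite] in
lemma ne_of_lt (h : IsShortestCycle G k c) (h4 : 4 ≤ k) (hN : Function.Injective G.neighborSet)
    (hadj : ∀ i x, G.Adj (c i) x ↔ x = c (i + k - 1) ∨ x = c (i + 1) ∨ x = d i)
    (hoff : ∀ i j, i < k → d i ≠ c j) {i j : ℕ} (hij : i < j) (hj : j < k) : d i ≠ d j := by
  intro he
  have hcd (i : ℕ) : G.Adj (d i) (c i) := ((hadj i _).2 (by simp)).symm
  have h₁ := h.le_of_common_neighbor (s := i) (L := j - i) (x := d i) (by omega) (by omega)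
    (fun l => hoff i l (by omega)) (hcd i) (by rw [Nat.add_sub_cancel' hij.le, he]; exact hcd j)
  have h₂ := h.le_of_common_neighbor (s := j) (L := k - (j - i)) (x := d i) (by omega) (by omega)
    (fun l => hoff i l (by omega)) (he ▸ hcd j)
    (by rw [show j + (k - (j - i)) = i + k by omega, h.periodic]; exact hcd i)
  obtain rfl : j = i + 2 := by omega
  obtain rfl : k = 4 := by omega
  have hcc : c i = c (i + 2) := hN <| Set.ext fun x => by
    rw [SimpleGraph.mem_neighborSet, SimpleGraph.mem_neighborSet, hadj, hadj, ← he,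
      show i + 2 + 4 - 1 = i + 1 + 4 by omega, h.periodic]
    exact ⟨fun H => by tauto, fun H => by tauto⟩
  exact absurd (h.injOn i 0 2 (by omega) (by omega) hcc) (by omega)

lemma exists_rootedCycle (h : IsShortestCycle G k c) (hd : ∀ v, G.degree v = 3)
    (hfree : G.CliqueFree 3) (hN : Function.Injective G.neighborSet) :
    ∃ d, RootedCycle G k c d := by
  have h4 := h.four_le_of_cliqueFree hfree
  obtain ⟨d, hadj, hoff⟩ := h.exists_third_neighbors hd
  have hcd (i : ℕ) : G.Adj (d i) (c i) := ((hadj i _).2 (by simp)).symm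
  refine ⟨d, h4, fun i j hi hj he => h.injOn 0 i j hi hj (by simpa using he), h.periodic.eq,
    fun x => ?_, fun i hi x => ?_, fun i j hi _ => hoff i j hi, fun i j hi hj he => ?_,
    fun j hj hjd => ?_⟩
  · rw [hadj, zero_add, zero_add]
    tauto
  · rw [hadj, show i + 1 + k - 1 = i + k by omega, h.periodic]
  · obtain hij | hij | hij := lt_trichotomy i j
    exacts [(h.ne_of_lt h4 hN hadj hoff hij hj he).elim, hij,
      (h.ne_of_lt h4 hN hadj hoff hij hi he.symm).elim]
  · obtain rfl | hj0 := j.eq_zero_or_pos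
    · omega
    · have := h.le_of_adj_neighbors (s := j) (L := k - j) (by omega) (fun l => hoff j l hj)
        (fun l => hoff 0 l (by omega)) hjd.symm (hcd j)
        (by rw [Nat.add_sub_cancel' hj.le, h.periodic.eq]; exact hcd 0)
      omega

end IsShortestCycle

section RootedCycle

lemma RootedCycle.adj {d : ℕ → V} (h : RootedCycle G k c d) {j : ℕ} (hj : j < k) :
    G.Adj (c j) (d j) := by
  cases j with
  | zero => exact (h.adj_zero _).2 (by simp)
  | succ j => exact (h.adj_succ j hj _).2 (by simp)

variable [Fintype V] {d : ℕ → V}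

lemma upTo_zero [DecidableEq V] : upTo k c 0 = Finset.univ \ (Finset.range k).image c := by
  ext x
  simp [mem_upTo]
  grind

variable [G.LocallyFinite]

lemma RootedCycle.degreeOn_eq_two (h : RootedCycle G k c d) (hd : ∀ v, G.degree v = 3) {j : ℕ}
    (hj : j < k) : degreeOn G (upTo k c 0) (d j) = 2 := by
  classical
  have hN : (upTo k c 0).filter (G.Adj (d j)) = (G.neighborFinset (d j)).erase (c j) := by
    ext x
    simp only [upTo_zero, Finset.mem_filter, Finset.mem_sdiff, Finset.mem_univ, true_and,
      Finset.mem_image, Finset.mem_range, Finset.mem_erase, SimpleGraph.mem_neighborFinset]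
    refine and_congr_left fun hx => not_congr ⟨?_, fun he => ⟨j, hj, he.symm⟩⟩
    rintro ⟨l, hl, rfl⟩
    rw [h.eq_of_adj hj hl hx]
  rw [degreeOn, hN, Finset.card_erase_of_mem (by simpa using (h.adj hj).symm),
    G.card_neighborFinset_eq_degree, hd]

lemma RootedCycle.mem_image_of_isCycleComponent [DecidableEq V] {T : Finset V} {w : V}
    (h : RootedCycle G k c d) (hd : ∀ v, G.degree v = 3)
    (hT : IsCycleComponent G (upTo k c 0) T) (hw : w ∈ T) : w ∈ (Finset.range k).image d := by
  have hwS := hT.subset hw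
  have hoff (j : ℕ) (hj : j < k) : w ≠ c j := fun he =>
    absurd (SemistrongColoring.mem_upTo.1 hwS j hj he.symm) (by omega)
  obtain ⟨x, hx, hwx⟩ := hT.exists_adj_notMem hw (hd w)
  obtain ⟨j, hj, rfl⟩ : ∃ j < k, c j = x := by
    simpa [upTo_zero] using hx
  refine Finset.mem_image.2 ⟨j, Finset.mem_range.2 hj, ?_⟩
  have hk := h.four_le
  cases j with
  | zero =>
    obtain H | H | H := (h.adj_zero w).1 hwx.symm
    exacts [(hoff 1 (by omega) H).elim, (hoff _ (by omega) H).elim, H.symm]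
  | succ j =>
    obtain H | H | H := (h.adj_succ j hj w).1 hwx.symm
    · exact (hoff j (by omega) H).elim
    · exact (h.succ_notMem_upTo (Nat.zero_le _) hj (H ▸ hwS)).elim
    · exact H.symm

lemma RootedCycle.mem_of_isCycleComponent {T : Finset V} {j : ℕ}
    (h : RootedCycle G k c d) (hc : IsShortestCycle G k c) (hd : ∀ v, G.degree v = 3)
    (hT : IsCycleComponent G (upTo k c 0) T) (hj : j < k) : d j ∈ T := by
  classical
  have hsub : T ⊆ (Finset.range k).image d := fun w => h.mem_image_of_isCycleComponent hd hT
  obtain ⟨k', f, hf, hk'⟩ := exists_isCyclicSequence hT.isConnectedOn.1 fun w hw => by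
    rw [degreeOn_congr hT.subset hT.isClosedIn hw, hT.degreeOn_eq_two w hw]
  have hcard : ((Finset.range k).image d).card ≤ T.card :=
    (Finset.card_image_le.trans (Finset.card_range k).le).trans ((hc.le k' f hf).trans hk')
  rw [Finset.eq_of_subset_of_card_le hsub hcard]
  exact Finset.mem_image_of_mem d (Finset.mem_range.2 hj)

end RootedCycle

theorem exists_isColoringOn_univ_of_cliqueFree [Fintype V] [G.LocallyFinite]
    (hd : ∀ v, G.degree v = 3) (hc : IsConnectedOn G Finset.univ) (hfree : G.CliqueFree 3)
    (hN : Function.Injective G.neighborSet) :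
    ∃ K : ArcColoring V (Fin 8), K.IsColoringOn G Finset.univ := by
  classical
  have hG (v : V) : G.degree v ≤ 3 := (hd v).le
  obtain ⟨k, f, hf, -⟩ := exists_isCyclicSequence (G := G) hc.1 fun w _ => by
    have : G.degree w ≤ degreeOn G Finset.univ w :=
      not_lt.1 (degreeOn_lt_degree_iff.not.2 (by simp))
    have := hd w
    omega
  obtain ⟨k, c, hsc⟩ := exists_isShortestCycle ⟨k, f, hf⟩
  obtain ⟨d, h⟩ := hsc.exists_rootedCycle hd hfree hN
  have hk := h.four_le
  have hlight : IsLight G (upTo k c 0) := upTo_zero (V := V) ▸ hc.isLight_sdiff hG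
    (Finset.subset_univ _) ⟨c 0, Finset.mem_image_of_mem c (Finset.mem_range.2 (by omega))⟩
  have hne {i j : ℕ} (hi : i < k) (hj : j < k) (hij : i ≠ j) : d i ≠ d j := fun he =>
    hij (h.off_injOn i j hi hj he)
  obtain ⟨K, hK, h0, hle⟩ := hlight.exists_isColoringOn_root hG (r := d 0) (s := d 2)
    (h.mem_upTo (by omega)) (h.degreeOn_eq_two hd (by omega)).le
    (hne (by omega) (by omega) (by omega))
    fun T _ hT => h.mem_of_isCycleComponent hsc hd hT (by omega)
  exact h.exists_isColoringOn_univ hG hK h0 fun j hj hj2 =>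
    hle (d j) (h.mem_upTo hj) (hne hj (by omega) hj2) (h.degreeOn_eq_two hd hj)

end CyclicSequence

section Subcubic

variable {V : Type*} {G : SimpleGraph V} [G.LocallyFinite]

lemma adj_iff_of_degree_eq_three {v a b c : V} (hd : G.degree v = 3) (ha : G.Adj v a)
    (hb : G.Adj v b) (hc : G.Adj v c) (hab : a ≠ b) (hac : a ≠ c) (hbc : b ≠ c) (x : V) :
    G.Adj v x ↔ x = a ∨ x = b ∨ x = c := by
  obtain ⟨c', -, -, h⟩ := exists_adj_iff_of_degree_eq_three hd ha hb hab
  obtain rfl : c = c' := by simpa [hac.symm, hbc.symm] using (h c).1 hc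
  exact h x

variable [Fintype V]

lemma exists_isColoringOn_univ_of_two_triangles (hd : ∀ v, G.degree v = 3)
    (hc : IsConnectedOn G Finset.univ) {u v c₁ c₂ : V} (huv : G.Adj u v) (hu₁ : G.Adj u c₁)
    (hu₂ : G.Adj u c₂) (hv₁ : G.Adj v c₁) (hv₂ : G.Adj v c₂) (hne : c₁ ≠ c₂) :
    ∃ K : ArcColoring V (Fin 8), K.IsColoringOn G Finset.univ := by
  have hG (v : V) : G.degree v ≤ 3 := (hd v).le
  have hu := adj_iff_of_degree_eq_three (hd u) huv hu₁ hu₂ hv₁.ne hv₂.ne hne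
  have hv := adj_iff_of_degree_eq_three (hd v) huv.symm hv₁ hv₂ hu₁.ne hu₂.ne hne
  obtain ⟨p₁, -, -, h₁⟩ := exists_adj_iff_of_degree_eq_three (hd c₁) hu₁.symm hv₁.symm huv.ne
  obtain ⟨p₂, -, -, h₂⟩ := exists_adj_iff_of_degree_eq_three (hd c₂) hu₂.symm hv₂.symm huv.ne
  by_cases h : G.Adj c₁ c₂
  · obtain rfl : c₂ = p₁ := by simpa [hu₂.ne', hv₂.ne'] using (h₁ c₂).1 h
    obtain rfl : c₁ = p₂ := by simpa [hu₁.ne', hv₁.ne'] using (h₂ c₁).1 h.symm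
    exact exists_isColoringOn_univ_of_complete hG hc hu hv h₁ h₂
  · refine exists_isColoringOn_univ_of_diamond hG hc hne hu hv h₁ h₂ ?_ ?_
    · rintro rfl
      exact h ((h₁ _).2 (by simp))
    · rintro rfl
      exact h ((h₂ _).2 (by simp)).symm

theorem exists_isColoringOn_univ_of_not_cliqueFree (hd : ∀ v, G.degree v = 3)
    (hc : IsConnectedOn G Finset.univ) (hfree : ¬ G.CliqueFree 3) :
    ∃ K : ArcColoring V (Fin 8), K.IsColoringOn G Finset.univ := by
  classical
  obtain ⟨X, hX⟩ : ∃ X, G.IsNClique 3 X := by simpa [SimpleGraph.CliqueFree] using hfree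
  obtain ⟨r, y₁, y₂, h1, h2, h12, -⟩ := SimpleGraph.is3Clique_iff.1 hX
  obtain ⟨d₀, a₁, a₂, hr⟩ := exists_adj_iff_of_degree_eq_three (hd r) h1 h2 h12.ne
  obtain ⟨d₁, br, b₂, hy₁⟩ := exists_adj_iff_of_degree_eq_three (hd y₁) h1.symm h12 h2.ne
  obtain ⟨d₂, cr, c₁, hy₂⟩ := exists_adj_iff_of_degree_eq_three (hd y₂) h2.symm h12.symm h1.ne
  have hrd : G.Adj r d₀ := (hr d₀).2 (by simp)
  have hyd₁ : G.Adj y₁ d₁ := (hy₁ d₁).2 (by simp)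
  have hyd₂ : G.Adj y₂ d₂ := (hy₂ d₂).2 (by simp)
  obtain rfl | h01 := eq_or_ne d₀ d₁
  · exact exists_isColoringOn_univ_of_two_triangles hd hc h1 h2 hrd h12 hyd₁ a₂.symm
  obtain rfl | h02 := eq_or_ne d₀ d₂
  · exact exists_isColoringOn_univ_of_two_triangles hd hc h2 h1 hrd h12.symm hyd₂ a₁.symm
  exact exists_isColoringOn_univ_of_triangle hr hy₁ hy₂ h01 h02 ⟨a₁, a₂⟩ hd hc ⟨br, b₂⟩ ⟨cr, c₁⟩

omit [G.LocallyFinite] in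
theorem nonempty_completeBipartiteGraph_iso {ι κ : Type*} [Nonempty ι]
    (hc : IsConnectedOn G Finset.univ) {f : ι → V} {g : κ → V} (hf : Function.Injective f)
    (hg : Function.Injective g) (hfg : ∀ i w, G.Adj (f i) w ↔ ∃ j, w = g j)
    (hgf : ∀ j w, G.Adj (g j) w ↔ ∃ i, w = f i) :
    Nonempty (completeBipartiteGraph ι κ ≃g G) := by
  classical
  have hadj (i : ι) (j : κ) : G.Adj (f i) (g j) := (hfg i _).2 ⟨j, rfl⟩
  have hinj : Function.Injective (Sum.elim f g) :=
    hf.sumElim hg fun i j => (hadj i j).ne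
  have hsurj : Function.Surjective (Sum.elim f g) := by
    have := hc.2 {v | ∃ x, Sum.elim f g x = v} (Finset.subset_univ _)
      ⟨f (Classical.arbitrary ι), by simp⟩ (by
        intro v hv w _ hvw
        rw [Finset.mem_filter_univ] at hv ⊢
        obtain ⟨i | j, rfl⟩ := hv
        · obtain ⟨j, rfl⟩ := (hfg i w).1 hvw
          exact ⟨.inr j, rfl⟩
        · obtain ⟨i, rfl⟩ := (hgf j w).1 hvw
          exact ⟨.inl i, rfl⟩)
    exact fun v => (Finset.mem_filter_univ v).1 (this ▸ Finset.mem_univ v)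
  have hiff (a b : ι ⊕ κ) : G.Adj (Sum.elim f g a) (Sum.elim f g b) ↔
      (completeBipartiteGraph ι κ).Adj a b := by
    obtain i | j := a <;> obtain i' | j' := b
    · simpa [hfg] using fun j => (hadj i' j).ne
    · simpa using hadj i j'
    · simpa using (hadj i' j).symm
    · simpa [hgf] using fun i => (hadj i j').ne'
  exact ⟨⟨Equiv.ofBijective _ ⟨hinj, hsurj⟩, hiff _ _⟩⟩

theorem exists_isColoringOn_univ_of_not_injective (hd : ∀ v, G.degree v = 3)
    (hc : IsConnectedOn G Finset.univ) (hfree : G.CliqueFree 3)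
    (hK : IsEmpty (G ≃g completeBipartiteGraph (Fin 3) (Fin 3)))
    (hN : ¬ Function.Injective G.neighborSet) :
    ∃ K : ArcColoring V (Fin 8), K.IsColoringOn G Finset.univ := by
  classical
  have hG (v : V) : G.degree v ≤ 3 := (hd v).le
  obtain ⟨x, x', hN, hxx⟩ := Function.not_injective_iff.1 hN
  obtain ⟨c₁, c₂, c₃, h12, h13, h23, hN'⟩ := Finset.card_eq_three.1 (hd x)
  have hx (w : V) : G.Adj x w ↔ w = c₁ ∨ w = c₂ ∨ w = c₃ := by
    simpa using Finset.ext_iff.1 hN' w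
  have hx' (w : V) : G.Adj x' w ↔ w = c₁ ∨ w = c₂ ∨ w = c₃ :=
    (Set.ext_iff.1 hN w).symm.trans (hx w)
  have hthird (c : V) (hxc : G.Adj x c) : ∃ p, p ≠ x ∧ p ≠ x' ∧ (p ≠ c₁ ∧ p ≠ c₂ ∧ p ≠ c₃) ∧
      ∀ w, G.Adj c w ↔ w = x ∨ w = x' ∨ w = p := by
    obtain ⟨p, hpx, hpx', h⟩ := exists_adj_iff_of_degree_eq_three (hd c) hxc.symm
      ((hx' c).2 ((hx c).1 hxc)).symm hxx
    have hxp : ¬ G.Adj x p := fun hxp => hfree {x, c, p} <|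
      SimpleGraph.is3Clique_triple_iff.2 ⟨hxc, hxp, (h p).2 (by simp)⟩
    exact ⟨p, hpx, hpx', by simpa [hx] using hxp, h⟩
  obtain ⟨p₁, a₁, a₁', b₁, hc₁⟩ := hthird c₁ ((hx c₁).2 (by simp))
  obtain ⟨p₂, a₂, a₂', b₂, hc₂⟩ := hthird c₂ ((hx c₂).2 (by simp))
  obtain ⟨p₃, a₃, a₃', b₃, hc₃⟩ := hthird c₃ ((hx c₃).2 (by simp))
  obtain h13' | rfl := ne_or_eq p₁ p₃
  · exact exists_isColoringOn_univ_of_completeBipartite hG h13 h23 hx hx' hc₁ hc₂ hc₃ b₁.2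
      ⟨a₃, a₃', b₃.1, b₃.2.1⟩ h13' hc hxx h12 ⟨b₂.1, b₂.2.2⟩
  obtain h12' | rfl := ne_or_eq p₁ p₂
  · exact exists_isColoringOn_univ_of_completeBipartite hG h12 h23.symm
      (fun w => (hx w).trans (by tauto)) (fun w => (hx' w).trans (by tauto)) hc₁ hc₃ hc₂ b₁.2.symm
      ⟨a₂, a₂', b₂.1, b₂.2.2⟩ h12' hc hxx h13 ⟨b₃.1, b₃.2.1⟩
  have hp := adj_iff_of_degree_eq_three (hd p₁) ((hc₁ p₁).2 (by simp)).symm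
    ((hc₂ p₁).2 (by simp)).symm ((hc₃ p₁).2 (by simp)).symm h12 h13 h23
  obtain ⟨e⟩ := nonempty_completeBipartiteGraph_iso hc (f := ![x, x', p₁]) (g := ![c₁, c₂, c₃])
    (List.nodup_ofFn.1 (by simp [*, Ne.symm])) (List.nodup_ofFn.1 (by simp [*]))
    (by simp [Fin.forall_fin_succ, Fin.exists_fin_succ, hx, hx', hp])
    (by simp [Fin.forall_fin_succ, Fin.exists_fin_succ, hc₁, hc₂, hc₃])
  exact (hK.false e.symm).elim

theorem exists_isColoringOn_univ (hG : ∀ v, G.degree v ≤ 3) (hconn : G.Connected)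
    (hK : IsEmpty (G ≃g completeBipartiteGraph (Fin 3) (Fin 3))) :
    ∃ K : ArcColoring V (Fin 8), K.IsColoringOn G Finset.univ := by
  have hc := isConnectedOn_univ hconn
  by_cases hd : ∀ v, G.degree v = 3
  · by_cases hfree : G.CliqueFree 3
    · by_cases hN : Function.Injective G.neighborSet
      · exact exists_isColoringOn_univ_of_cliqueFree hd hc hfree hN
      · exact exists_isColoringOn_univ_of_not_injective hd hc hfree hK hN
    · exact exists_isColoringOn_univ_of_not_cliqueFree hd hc hfree
  · push Not at hd
    obtain ⟨v, hv⟩ := hd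
    have hlight : IsLight G Finset.univ := fun T _ hne hcl => by
      refine ⟨v, hc.2 T (Finset.subset_univ T) hne hcl ▸ Finset.mem_univ v, ?_⟩
      have := degreeOn_le_degree (G := G) Finset.univ v
      have := hG v
      omega
    obtain ⟨K, hgood⟩ := hlight.exists_isGoodOn hG
    exact ⟨K, hgood.toIsColoringOn⟩

end Subcubic

section Multigraph

open scoped Graph

variable {α β C : Type*} {G : Graph α β}

variable (G) in
/-- A coloring `col` of the edges in `A` whose color classes are semistrong matchings, the edge `e`
being given an end `head e` that has degree one in the graph induced by the ends of its class. -/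
structure IsPartialColoring (A : Set β) (col : β → C) (head : β → α) : Prop where
  inc : ∀ e ∈ A, G.Inc e (head e)
  proper : ∀ e ∈ A, ∀ f ∈ A, e ≠ f → col e = col f → ∀ x, G.Inc e x → ¬ G.Inc f x
  head_not_adj : ∀ e ∈ A, ∀ f ∈ A, e ≠ f → col e = col f → ∀ w, G.Inc f w → ¬ G.Adj (head e) w

lemma mem_colorClass {c : β → C} {i : C} {e : β} :
    e ∈ colorClass G (fun e : E(G) => c e) i ↔ e ∈ E(G) ∧ c e = i := by
  simp [colorClass]

lemma IsPartialColoring.isSemistrongColoring (hl : G.Loopless) {col : β → C} {head : β → α}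
    (h : IsPartialColoring G E(G) col head) :
    IsSemistrongColoring G (fun e : E(G) => col e) := by
  refine fun i => ⟨⟨fun e he => he.1, fun e he f hf hef x hx => ?_⟩, fun e he => ?_⟩
  · rw [mem_colorClass] at he hf
    exact h.proper e he.1 f hf.1 hef (he.2.trans hf.2.symm) x hx.1 hx.2
  obtain ⟨heE, hei⟩ := mem_colorClass.1 he
  obtain ⟨y, hy⟩ := h.inc e heE
  refine ⟨head e, hy.inc_left, Set.encard_eq_one.2 ⟨y, Set.ext fun z => ?_⟩⟩
  simp only [Set.mem_ofPred_eq, Set.mem_singleton_iff]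
  constructor
  · rintro ⟨⟨f, hf, hfz⟩, hne, hadj⟩
    obtain ⟨hfE, hfi⟩ := mem_colorClass.1 hf
    obtain rfl | hef := eq_or_ne e f
    · exact (hfz.eq_or_eq_of_isLink hy).resolve_left hne.symm
    · exact (h.head_not_adj e heE f hfE hef (hei.trans hfi.symm) z hfz hadj).elim
  · rintro rfl
    exact ⟨⟨e, he, hy.inc_right⟩, hy.ne, hy.adj⟩

lemma encard_incidenceSet_le_maxDegree (x : α) : (G.incidenceSet x).encard ≤ maxDegree G := by
  by_cases hx : x ∈ V(G)
  · exact le_self_add.trans (le_iSup₂ (f := fun x (_ : x ∈ V(G)) => degree G x) x hx)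
  · have h : G.incidenceSet x = ∅ :=
      Set.eq_empty_of_forall_notMem fun e (he : G.Inc e x) => hx he.vertex_mem
    simp [h]

variable (G) in
/-- The edges that may not share a color with `e`, whichever ends of the two are their heads. -/
def nearEdges (e : β) : Set β :=
  {f | f ≠ e ∧ ∃ x y, G.Inc e x ∧ G.Inc f y ∧ (x = y ∨ G.Adj x y)}

lemma IsPartialColoring.exists_insert {A : Set β} {col : β → C} {head : β → α}
    (h : IsPartialColoring G A col head) {e : β} (he : e ∈ E(G)) (heA : e ∉ A) {a : C}
    (ha : ∀ f ∈ nearEdges G e, col f ≠ a) :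
    ∃ (col' : β → C) (head' : β → α), IsPartialColoring G (insert e A) col' head' := by
  classical
  obtain ⟨x, y, hxy⟩ := Graph.exists_isLink_of_mem_edgeSet he
  have hne : ∀ f ∈ A, f ≠ e := fun f hf hfe => heA (hfe ▸ hf)
  have hcol : ∀ f ∈ A, Function.update col e a f = col f :=
    fun f hf => Function.update_of_ne (hne f hf) a col
  have hhead : ∀ f ∈ A, Function.update head e x f = head f :=
    fun f hf => Function.update_of_ne (hne f hf) x head
  refine ⟨Function.update col e a, Function.update head e x, ?_, ?_, ?_⟩
  · rintro f (rfl | hf)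
    · simpa using hxy.inc_left
    · exact hhead f hf ▸ h.inc f hf
  · rintro f (rfl | hf) g (rfl | hg) hfg hc z hz hz'
    · exact hfg rfl
    · rw [Function.update_self, hcol g hg] at hc
      exact ha g ⟨hne g hg, z, z, hz, hz', Or.inl rfl⟩ hc.symm
    · rw [Function.update_self, hcol f hf] at hc
      exact ha f ⟨hne f hf, z, z, hz', hz, Or.inl rfl⟩ hc
    · rw [hcol f hf, hcol g hg] at hc
      exact h.proper f hf g hg hfg hc z hz hz'
  · rintro f (rfl | hf) g (rfl | hg) hfg hc w hw hadj
    · exact hfg rfl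
    · rw [Function.update_self, hcol g hg] at hc
      rw [Function.update_self] at hadj
      exact ha g ⟨hne g hg, x, w, hxy.inc_left, hw, Or.inr hadj⟩ hc.symm
    · rw [Function.update_self, hcol f hf] at hc
      rw [hhead f hf] at hadj
      exact ha f ⟨hne f hf, w, head f, hw, h.inc f hf, Or.inr hadj.symm⟩ hc
    · rw [hcol f hf, hcol g hg] at hc
      rw [hhead f hf] at hadj
      exact h.head_not_adj f hf g hg hfg hc w hw hadj

/-- The edges that meet the far end of an edge at `x` other than the parallel edges `e` and `e'`. -/
def edgesBeyond (G : Graph α β) (e e' : β) (x : α) : Set β :=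
  {f | ∃ g y, G.IsLink g x y ∧ g ≠ e ∧ g ≠ e' ∧ G.Inc f y}

lemma encard_edgesBeyond_le (hdeg : maxDegree G ≤ 3) {e e' : β} (hee : e ≠ e') {x : α}
    (he : G.Inc e x) (he' : G.Inc e' x) : (edgesBeyond G e e' x).encard ≤ 3 := by
  have hthird : (G.incidenceSet x \ {e, e'}).Subsingleton := by
    have hsub : ({e, e'} : Set β) ⊆ G.incidenceSet x := by
      rintro f (rfl | rfl)
      exacts [he, he']
    have hsum := Set.encard_sdiff_add_encard_of_subset hsub
    rw [Set.encard_pair hee] at hsum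
    have hle : (G.incidenceSet x \ {e, e'}).encard + 2 ≤ 1 + 2 :=
      hsum.trans_le ((encard_incidenceSet_le_maxDegree x).trans hdeg)
    exact Set.encard_le_one_iff_subsingleton.1 ((ENat.add_le_add_iff_right (by simp)).1 hle)
  obtain hempty | ⟨f, g, y, hy, hge, hge', -⟩ := (edgesBeyond G e e' x).eq_empty_or_nonempty
  · simp [hempty]
  refine (Set.encard_le_encard ?_).trans ((encard_incidenceSet_le_maxDegree y).trans hdeg)
  rintro f ⟨g', y', hy', hge₁, hge₁', hf⟩
  obtain rfl : g' = g :=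
    hthird ⟨hy'.inc_left, by simp [hge₁, hge₁']⟩ ⟨hy.inc_left, by simp [hge, hge']⟩
  exact hy.right_unique hy' ▸ hf

lemma nearEdges_subset {e e' : β} {x y : α} (he : G.IsLink e x y) (he' : G.IsLink e' x y) :
    nearEdges G e ⊆ insert e' (edgesBeyond G e e' x ∪ edgesBeyond G e e' y) := by
  rintro f ⟨hfe, z, w, hz, hw, hzw⟩
  obtain rfl | hfe' := eq_or_ne f e'
  · exact Set.mem_insert _ _
  refine Or.inr ?_
  have hend : ∀ v, G.Inc f v → v = x ∨ v = y →
      f ∈ edgesBeyond G e e' x ∪ edgesBeyond G e e' y := by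
    rintro v hv (rfl | rfl)
    · exact Or.inl ⟨f, hv.other, hv.isLink_other, hfe, hfe', hv.inc_other⟩
    · exact Or.inr ⟨f, hv.other, hv.isLink_other, hfe, hfe', hv.inc_other⟩
  have hz' := hz.eq_or_eq_of_isLink he
  by_cases hwxy : w = x ∨ w = y
  · exact hend w hw hwxy
  obtain rfl | ⟨g, hg⟩ := hzw
  · exact hend z hw hz'
  have hne : ∀ p, G.IsLink p x y → g ≠ p := by
    rintro p hp rfl
    exact hwxy (hg.inc_right.eq_or_eq_of_isLink hp)
  rcases hz' with rfl | rfl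
  · exact Or.inl ⟨g, w, hg, hne e he, hne e' he', hw⟩
  · exact Or.inr ⟨g, w, hg, hne e he, hne e' he', hw⟩

lemma encard_nearEdges_le (hdeg : maxDegree G ≤ 3) {e e' : β} (hee : e ≠ e') {x y : α}
    (he : G.IsLink e x y) (he' : G.IsLink e' x y) : (nearEdges G e).encard ≤ 7 :=
  calc (nearEdges G e).encard
      ≤ (edgesBeyond G e e' x ∪ edgesBeyond G e e' y).encard + 1 :=
        (Set.encard_le_encard (nearEdges_subset he he')).trans (Set.encard_insert_le _ _)
    _ ≤ 3 + 3 + 1 := by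
        gcongr
        refine (Set.encard_union_le _ _).trans (add_le_add ?_ ?_)
        · exact encard_edgesBeyond_le hdeg hee he.inc_left he'.inc_left
        · exact encard_edgesBeyond_le hdeg hee he.inc_right he'.inc_right
    _ = 7 := rfl

lemma exists_forall_ne_of_encard_lt {ι : Type*} [Fintype C] {S : Set ι}
    (hS : S.encard < Fintype.card C) (col : ι → C) : ∃ a, ∀ f ∈ S, col f ≠ a := by
  by_contra! h
  have himg : col '' S = Set.univ := Set.eq_univ_of_forall h
  have := Set.encard_image_le col S
  rw [himg, Set.encard_univ, ENat.card_eq_coe_fintype_card] at this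
  exact this.not_gt hS

lemma finite_edgeSet (hV : V(G).Finite) (hdeg : maxDegree G < ⊤) : E(G).Finite := by
  refine (hV.biUnion fun x _ =>
    Set.encard_lt_top_iff.1 ((encard_incidenceSet_le_maxDegree x).trans_lt hdeg)).subset
      fun e he => ?_
  obtain ⟨x, y, hxy⟩ := Graph.exists_isLink_of_mem_edgeSet he
  exact Set.mem_biUnion hxy.left_mem hxy.inc_left

lemma IsPartialColoring.exists_edgeSet (hdeg : maxDegree G ≤ 3) (hV : V(G).Finite) {A : Set β}
    (hAE : A ⊆ E(G)) {col : β → Fin 8} {head : β → α} (h : IsPartialColoring G A col head)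
    (hrep : ∀ e x y, G.IsLink e x y → ∃ e' ∈ A, G.IsLink e' x y) :
    ∃ (col' : β → Fin 8) (head' : β → α), IsPartialColoring G E(G) col' head' := by
  classical
  have key : ∀ B : Finset β, (B : Set β) ⊆ E(G) →
      ∃ (col' : β → Fin 8) (head' : β → α), IsPartialColoring G (A ∪ B) col' head' := by
    intro B
    induction B using Finset.induction_on with
    | empty => exact fun _ => ⟨col, head, by simpa using h⟩
    | insert e B _ ih =>
      intro hB
      rw [Finset.coe_insert, Set.insert_subset_iff] at hB
      obtain ⟨col', head', h'⟩ := ih hB.2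
      rw [Finset.coe_insert, Set.union_insert]
      by_cases he : e ∈ A ∪ (B : Set β)
      · rw [Set.insert_eq_of_mem he]
        exact ⟨col', head', h'⟩
      obtain ⟨x, y, hxy⟩ := Graph.exists_isLink_of_mem_edgeSet hB.1
      obtain ⟨e', he', hxy'⟩ := hrep e x y hxy
      have hne : e ≠ e' := fun hee => he (Or.inl (hee ▸ he'))
      obtain ⟨a, ha⟩ := exists_forall_ne_of_encard_lt
        ((encard_nearEdges_le hdeg hne hxy hxy').trans_lt (by norm_num)) col'
      exact h'.exists_insert hB.1 he ha
  have hE := finite_edgeSet hV (hdeg.trans_lt (ENat.natCast_lt_top 3))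
  simpa [Set.union_eq_self_of_subset_left hAE] using key hE.toFinset (by simp)

lemma exists_isLink_of_isColoringOn_univ [Fintype V(G)]
    (hl : G.Loopless) {K : ArcColoring V(G) C} (hK : K.IsColoringOn G.toSimpleGraph Finset.univ)
    {e : β} (he : e ∈ E(G)) : ∃ (u v : V(G)) (a : C), G.IsLink e u v ∧ K u v a := by
  obtain ⟨x, y, hxy⟩ := Graph.exists_isLink_of_mem_edgeSet he
  have hadj : G.toSimpleGraph.Adj ⟨x, hxy.left_mem⟩ ⟨y, hxy.right_mem⟩ :=
    (Graph.toSimpleGraph_adj_iff _ _).2 hxy.adj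
  obtain ⟨a, ha | ha⟩ := (hK.colored_iff _ _).2 ⟨hadj, Finset.mem_univ _, Finset.mem_univ _⟩
  · exact ⟨_, _, a, hxy, ha⟩
  · exact ⟨_, _, a, hxy.symm, ha⟩

lemma ArcColoring.IsValid.exists_isPartialColoring [Nonempty V(G)] [Nonempty C]
    (hl : G.Loopless) {K : ArcColoring V(G) C} (hK : K.IsValid G.toSimpleGraph) {A : Set β}
    (hpar : ∀ e ∈ A, ∀ f ∈ A, ∀ x y, G.IsLink e x y → G.IsLink f x y → e = f)
    (hA : ∀ e ∈ A, ∃ (u v : V(G)) (a : C), G.IsLink e u v ∧ K u v a) :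
    ∃ (col : β → C) (head : β → α), IsPartialColoring G A col head := by
  choose! tail head col hlink hcol using hA
  have hend : ∀ e ∈ A, ∀ x, G.Inc e x →
      ∃ x' y : V(G), x' = x ∧ G.IsLink e x' y ∧ K.HasColor x' y (col e) := by
    intro e he x hx
    rcases hx.eq_or_eq_of_isLink (hlink e he) with rfl | rfl
    · exact ⟨tail e, head e, rfl, hlink e he, Or.inl (hcol e he)⟩
    · exact ⟨head e, tail e, rfl, (hlink e he).symm, Or.inr (hcol e he)⟩
  refine ⟨col, fun e => head e, fun e he => (hlink e he).inc_right, ?_, ?_⟩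
  · intro e he f hf hef hc x hxe hxf
    obtain ⟨x, y, rfl, hle, hce⟩ := hend e he x hxe
    obtain ⟨x', y', hx', hlf, hcf⟩ := hend f hf x hxf
    obtain rfl := Subtype.ext hx'
    obtain rfl := hK.proper hce (hc ▸ hcf)
    exact hef (hpar e he f hf _ _ hle hlf)
  · intro e he f hf hef hc w hw hadj
    obtain ⟨w, z, rfl, hlf, hcf⟩ := hend f hf w hw
    rw [← hc] at hcf
    obtain rfl | hwu := eq_or_ne w (tail e)
    · obtain rfl := hK.proper (Or.inl (hcol e he)) hcf
      exact hef (hpar e he f hf _ _ (hlink e he) hlf)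
    · exact hK.head (hcol e he) ((Graph.toSimpleGraph_adj_iff _ _).2 hadj) hwu hcf

lemma exists_subset_edgeSet_representatives (G : Graph α β) : ∃ A ⊆ E(G),
    (∀ e ∈ A, ∀ f ∈ A, ∀ x y, G.IsLink e x y → G.IsLink f x y → e = f) ∧
      ∀ e x y, G.IsLink e x y → ∃ e' ∈ A, G.IsLink e' x y := by
  obtain ⟨A, hAE, hbij⟩ := Set.exists_subset_bijOn E(G) G.Inc
  refine ⟨A, hAE, fun e he f hf x y hxe hxf => hbij.injOn he hf ?_, fun e x y hxy => ?_⟩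
  · ext z
    rw [Graph.isLink_iff_inc] at hxe hxf
    constructor
    · intro hz
      rcases hxe.2.2 z hz with rfl | rfl
      exacts [hxf.1, hxf.2.1]
    · intro hz
      rcases hxf.2.2 z hz with rfl | rfl
      exacts [hxe.1, hxe.2.1]
  · obtain ⟨e', he', heq⟩ := hbij.surjOn ⟨e, hxy.edge_mem, rfl⟩
    refine ⟨e', he', ?_⟩
    rw [Graph.isLink_iff_inc] at hxy ⊢
    rwa [heq]

lemma degree_toSimpleGraph_le_encard [G.toSimpleGraph.LocallyFinite] {x : V(G)} {B : Set β}
    (hB : ∀ y, G.toSimpleGraph.Adj x y → ∃ e ∈ B, G.IsLink e x y) :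
    G.toSimpleGraph.degree x ≤ B.encard := by
  choose t htB ht using fun y : G.toSimpleGraph.neighborSet x => hB y y.2
  have hinj : Function.Injective t := fun y z hyz =>
    Subtype.ext (Subtype.ext ((ht y).right_unique (hyz ▸ ht z)))
  calc (G.toSimpleGraph.degree x : ℕ∞) = ENat.card (G.toSimpleGraph.neighborSet x) := by
        rw [ENat.card_eq_coe_fintype_card, SimpleGraph.card_neighborSet_eq_degree]
    _ ≤ (Set.range t).encard := hinj.encard_range
    _ ≤ B.encard := Set.encard_le_encard (Set.range_subset_iff.2 htB)

lemma degree_toSimpleGraph_le_maxDegree [G.toSimpleGraph.LocallyFinite] (x : V(G)) :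
    G.toSimpleGraph.degree x ≤ maxDegree G := by
  refine (degree_toSimpleGraph_le_encard fun y hy => ?_).trans
    (encard_incidenceSet_le_maxDegree (x : α))
  obtain ⟨-, e, he⟩ := hy
  exact ⟨e, he.inc_left, he⟩

lemma degree_toSimpleGraph_add_one_le_maxDegree [G.toSimpleGraph.LocallyFinite] {e f : β}
    {x y : V(G)} (he : G.IsLink e x y) (hf : G.IsLink f x y) (hef : e ≠ f) :
    G.toSimpleGraph.degree x + 1 ≤ maxDegree G := by
  have hle : G.toSimpleGraph.degree x ≤ (G.incidenceSet (x : α) \ {e}).encard := by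
    refine degree_toSimpleGraph_le_encard fun z hz => ?_
    obtain ⟨-, g, hg⟩ := hz
    obtain rfl | hge := eq_or_ne g e
    · obtain rfl := Subtype.ext (hg.right_unique he)
      exact ⟨f, ⟨hf.inc_left, hef.symm⟩, hf⟩
    · exact ⟨g, ⟨hg.inc_left, hge⟩, hg⟩
  calc (G.toSimpleGraph.degree x : ℕ∞) + 1 ≤ (G.incidenceSet (x : α) \ {e}).encard + 1 := by gcongr
    _ = (G.incidenceSet (x : α)).encard := Set.encard_sdiff_singleton_add_one he.inc_left
    _ ≤ maxDegree G := encard_incidenceSet_le_maxDegree _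

lemma degree_completeBipartiteGraph_self {V : Type*} [Fintype V]
    [(completeBipartiteGraph V V).LocallyFinite] (x : V ⊕ V) :
    (completeBipartiteGraph V V).degree x = Fintype.card V := by
  rw [← SimpleGraph.card_neighborFinset_eq_degree]
  obtain v | v := x
  · have h : (completeBipartiteGraph V V).neighborFinset (.inl v) =
        Finset.univ.map .inr := by ext (_ | _) <;> simp
    simp [h]
  · have h : (completeBipartiteGraph V V).neighborFinset (.inr v) =
        Finset.univ.map .inl := by ext (_ | _) <;> simp
    simp [h]

lemma isK33_of_iso (hl : G.Loopless) (hdeg : maxDegree G ≤ 3)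
    (φ : G.toSimpleGraph ≃g completeBipartiteGraph (Fin 3) (Fin 3)) : IsK33 G := by
  refine ⟨{ eq_of_isLink := fun e f x y he hf => ?_ }, ⟨φ⟩⟩
  by_contra hef
  classical
  have := Fintype.ofEquiv _ φ.toEquiv.symm
  have hle := (degree_toSimpleGraph_add_one_le_maxDegree (x := ⟨x, he.left_mem⟩)
    (y := ⟨y, he.right_mem⟩) he hf hef).trans hdeg
  rw [← φ.degree_eq, degree_completeBipartiteGraph_self] at hle
  exact absurd hle (by decide)

theorem semistrongChromaticIndex_le_eight (hl : G.Loopless) (hV : V(G).Finite)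
    (hconn : G.toSimpleGraph.Connected) (hdeg : maxDegree G ≤ 3) (hK : ¬ IsK33 G) :
    semistrongChromaticIndex G ≤ 8 := by
  classical
  have := hV.fintype
  have := hconn.nonempty
  obtain ⟨K, hcol⟩ := exists_isColoringOn_univ (G := G.toSimpleGraph)
    (fun x => by exact_mod_cast (degree_toSimpleGraph_le_maxDegree x).trans hdeg) hconn
    ⟨fun φ => hK (isK33_of_iso hl hdeg φ)⟩
  obtain ⟨A, hAE, hpar, hrep⟩ := exists_subset_edgeSet_representatives G
  obtain ⟨col, head, hpart⟩ := hcol.toIsValid.exists_isPartialColoring hl hpar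
    fun e he => exists_isLink_of_isColoringOn_univ hl hcol (hAE he)
  obtain ⟨col', head', hpart'⟩ := hpart.exists_edgeSet hdeg hV hAE hrep
  exact iInf₂_le 8 ⟨_, hpart'.isSemistrongColoring hl⟩

end Multigraph

section Prism

open scoped Graph

lemma encard_edgeSet_le_mul {α β C : Type*} [Fintype C] {G : Graph α β} {c : E(G) → C} {m : ℕ∞}
    (h : ∀ i, (colorClass G c i).encard ≤ m) : E(G).encard ≤ Fintype.card C * m :=
  calc E(G).encard ≤ (⋃ i, colorClass G c i).encard :=
        Set.encard_le_encard fun e he => Set.mem_iUnion.2 ⟨c ⟨e, he⟩, he, rfl⟩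
    _ ≤ ∑ i, (colorClass G c i).encard := Set.encard_iUnion_le_of_fintype _
    _ ≤ ∑ _ : C, m := Finset.sum_le_sum fun i _ => h i
    _ = Fintype.card C * m := by simp

lemma IsSemistrongMatching.exists_isLink {α β : Type*} {G : Graph α β} (hl : G.Loopless)
    {M : Set β} (hM : IsSemistrongMatching G M) {e : β} (he : e ∈ M) :
    ∃ x y, G.IsLink e x y ∧ ∀ f ∈ M, f ≠ e → ∀ z, G.Inc f z → ¬ G.Adj x z := by
  obtain ⟨x, ⟨y, hxy⟩, hdeg⟩ := hM.2 e he
  refine ⟨x, y, hxy, fun f hf hfe z hz hadj => ?_⟩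
  have hsub := Set.encard_le_one_iff_subsingleton.1 hdeg.le
  obtain rfl : y = z :=
    hsub ⟨⟨e, he, hxy.inc_right⟩, hxy.ne, hxy.adj⟩ ⟨⟨f, hf, hz⟩, hadj.ne, hadj⟩
  exact hM.1.2 f hf e he hfe y ⟨hz, hxy.inc_right⟩

/-- The pairs `p` and `q` are disjoint edges whose first ends have degree one in the graph induced
by all four ends: two members of a semistrong matching, suitably oriented. -/
def IsSemistrongPair {V : Type*} (G : SimpleGraph V) (p q : V × V) : Prop :=
  G.Adj p.1 p.2 ∧ G.Adj q.1 q.2 ∧ ¬ G.Adj p.1 q.1 ∧ ¬ G.Adj p.1 q.2 ∧ ¬ G.Adj q.1 p.2 ∧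
    p.1 ≠ q.1 ∧ p.1 ≠ q.2 ∧ p.2 ≠ q.1 ∧ p.2 ≠ q.2

instance {V : Type*} [DecidableEq V] (G : SimpleGraph V) [DecidableRel G.Adj] (p q : V × V) :
    Decidable (IsSemistrongPair G p q) :=
  inferInstanceAs (Decidable (_ ∧ _))

lemma IsMatching.isSemistrongPair {V : Type*} {G : SimpleGraph V} {M : Set (Sym2 V)}
    (hM : IsMatching (Graph.ofSimpleGraph G) M) {e f : Sym2 V} (he : e ∈ M) (hf : f ∈ M)
    (hef : e ≠ f) {x y z w : V} (hxy : (Graph.ofSimpleGraph G).IsLink e x y)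
    (hzw : (Graph.ofSimpleGraph G).IsLink f z w)
    (hx : ∀ f ∈ M, f ≠ e → ∀ z, (Graph.ofSimpleGraph G).Inc f z →
      ¬ (Graph.ofSimpleGraph G).Adj x z)
    (hz : ∀ e ∈ M, e ≠ f → ∀ x, (Graph.ofSimpleGraph G).Inc e x →
      ¬ (Graph.ofSimpleGraph G).Adj z x) :
    IsSemistrongPair G (x, y) (z, w) := by
  simp only [Graph.ofSimpleGraph_adj_iff] at hx hz
  have hne : ∀ {u v}, (Graph.ofSimpleGraph G).Inc e u → (Graph.ofSimpleGraph G).Inc f v → u ≠ v :=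
    fun hu hv huv => hM.2 e he f hf hef _ ⟨hu, huv ▸ hv⟩
  exact ⟨(Graph.ofSimpleGraph_adj_iff x y).1 hxy.adj, (Graph.ofSimpleGraph_adj_iff z w).1 hzw.adj,
    hx f hf hef.symm z hzw.inc_left, hx f hf hef.symm w hzw.inc_right,
    hz e he hef y hxy.inc_right, hne hxy.inc_left hzw.inc_left, hne hxy.inc_left hzw.inc_right,
    hne hxy.inc_right hzw.inc_left, hne hxy.inc_right hzw.inc_right⟩

/-- The simple graph underlying `fivePrism`. -/
abbrev prism : SimpleGraph (Fin 5 × Fin 2) :=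
  (SimpleGraph.cycleGraph 5).boxProd ⊤

instance : DecidableRel prism.Adj :=
  fun _ _ => decidable_of_iff _ SimpleGraph.boxProd_adj.symm

lemma not_exists_isSemistrongPair_prism : ∀ p q, IsSemistrongPair prism p q →
    ¬ ∃ r, IsSemistrongPair prism p r ∧ IsSemistrongPair prism q r := by
  decide +kernel

lemma degree_ofSimpleGraph {V : Type*} (G : SimpleGraph V) [G.LocallyFinite] (x : V) :
    degree (Graph.ofSimpleGraph G) x = G.degree x := by
  classical
  have hloop : {e | (Graph.ofSimpleGraph G).IsLoopAt e x} = ∅ :=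
    Set.eq_empty_of_forall_notMem fun e he => G.not_isDiag_of_mem_edgeSet he.2 (he.1 ▸ rfl)
  have hinc : {e | (Graph.ofSimpleGraph G).Inc e x} = G.incidenceSet x := by
    ext e
    exact ⟨fun ⟨y, he, heG⟩ => ⟨heG, he ▸ Sym2.mem_mk_left x y⟩,
      fun ⟨heG, y, he⟩ => ⟨y, he, heG⟩⟩
  rw [degree, hloop, hinc, Set.encard_empty, add_zero, ← SimpleGraph.card_incidenceSet_eq_degree,
    Set.coe_fintypeCard]

lemma degree_prism (x : Fin 5 × Fin 2) [Fintype (prism.neighborSet x)] : prism.degree x = 3 := by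
  rw [SimpleGraph.degree_boxProd, SimpleGraph.cycleGraph_degree_three_le,
    SimpleGraph.complete_graph_degree, Fintype.card_fin]

lemma encard_edgeSet_fivePrism : E(fivePrism).encard = 15 := by
  have hsum := prism.sum_degrees_eq_twice_card_edges
  simp only [degree_prism, Finset.sum_const, Finset.card_univ, Fintype.card_prod,
    Fintype.card_fin, smul_eq_mul] at hsum
  have hcard : prism.edgeFinset.card = 15 := by omega
  change prism.edgeSet.encard = 15
  rw [← prism.coe_edgeFinset, Set.encard_coe_eq_coe_finsetCard, hcard]
  rfl

lemma simple_fivePrism : fivePrism.Simple where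
  not_isLoopAt _ _ h := prism.not_isDiag_of_mem_edgeSet h.2 (h.1 ▸ rfl)
  eq_of_isLink _ _ _ _ he hf := he.1.trans hf.1.symm

lemma connected_fivePrism : fivePrism.toSimpleGraph.Connected :=
  (Graph.toSimpleGraphOfSimpleGraphIso prism).connected_iff.2
    (SimpleGraph.cycleGraph_connected.boxProd SimpleGraph.connected_top)

lemma maxDegree_fivePrism : maxDegree fivePrism = 3 := by
  have hdeg : ∀ x, degree fivePrism x = 3 := fun x => by
    simp only [fivePrism, degree_ofSimpleGraph, degree_prism, Nat.cast_ofNat]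
  have hV : ∀ x, x ∈ V(fivePrism) := Set.mem_univ
  simp only [maxDegree, hdeg, hV, iSup_pos, ciSup_const]

lemma not_isK33_fivePrism : ¬ IsK33 fivePrism := by
  rintro ⟨-, ⟨φ⟩⟩
  have hcard := Fintype.card_congr
    ((Graph.toSimpleGraphOfSimpleGraphIso prism).symm.trans φ).toEquiv
  simp at hcard

lemma IsSemistrongMatching.encard_le_two_of_fivePrism {M : Set (Sym2 (Fin 5 × Fin 2))}
    (hM : IsSemistrongMatching fivePrism M) : M.encard ≤ 2 := by
  by_contra! hlt
  obtain ⟨T, hTM, hT⟩ := Set.exists_subset_encard_eq (Order.add_one_le_of_lt hlt)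
  obtain ⟨e, f, g, hef, heg, hfg, rfl⟩ := Set.encard_eq_three.1 hT
  have he : e ∈ M := hTM (by simp)
  have hf : f ∈ M := hTM (by simp)
  have hg : g ∈ M := hTM (by simp)
  have hl : fivePrism.Loopless := simple_fivePrism.toLoopless
  obtain ⟨x₁, y₁, h₁, k₁⟩ := hM.exists_isLink hl he
  obtain ⟨x₂, y₂, h₂, k₂⟩ := hM.exists_isLink hl hf
  obtain ⟨x₃, y₃, h₃, k₃⟩ := hM.exists_isLink hl hg
  exact not_exists_isSemistrongPair_prism _ _ (hM.1.isSemistrongPair he hf hef h₁ h₂ k₁ k₂)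
    ⟨_, hM.1.isSemistrongPair he hg heg h₁ h₃ k₁ k₃, hM.1.isSemistrongPair hf hg hfg h₂ h₃ k₂ k₃⟩

lemma eight_le_semistrongChromaticIndex_fivePrism : 8 ≤ semistrongChromaticIndex fivePrism := by
  refine le_iInf₂ fun k ⟨c, hc⟩ => ?_
  have hcount := encard_edgeSet_le_mul fun i => (hc i).encard_le_two_of_fivePrism
  rw [encard_edgeSet_fivePrism, Fintype.card_fin] at hcount
  norm_cast at hcount ⊢
  omega

end Prism

end SemistrongColoring

open SemistrongColoring in
open scoped Graph in
theorem theorem2 :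
    (∀ (α β : Type*) (G : Graph α β), G.Loopless → V(G).Finite →
      G.toSimpleGraph.Connected → maxDegree G ≤ 3 → ¬ IsK33 G →
      semistrongChromaticIndex G ≤ 8) ∧
    (fivePrism.Simple ∧ fivePrism.toSimpleGraph.Connected ∧ maxDegree fivePrism = 3 ∧
      ¬ IsK33 fivePrism ∧ semistrongChromaticIndex fivePrism = 8) := by
  refine ⟨fun _ _ _ hl hV hconn hdeg hK => semistrongChromaticIndex_le_eight hl hV hconn hdeg hK,
    simple_fivePrism, connected_fivePrism, maxDegree_fivePrism, not_isK33_fivePrism, ?_⟩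
  refine le_antisymm ?_ eight_le_semistrongChromaticIndex_fivePrism
  exact semistrongChromaticIndex_le_eight simple_fivePrism.toLoopless (Set.toFinite _)
    connected_fivePrism maxDegree_fivePrism.le not_isK33_fivePrism
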